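/- **Formal framework.** Consider the finite types generated from two ground types $0$ (natural numbers) and $X$ by function types $\tau(\rho)$ (functionals mapping objects of type $\rho$ to objects of type $\tau$); write $1=0(0)$. All systems below extend $\mathrm{WE\text{-}PA}^\omega$, weakly extensional Peano arithmetic in all finite types over $0,X$ (classical many-sorted logic with primitive equality only at type $0$, successor axioms, full induction, combinators, simultaneous primitive recursion in all types), by the schemata of quantifier-free choice $\mathrm{QF\text{-}AC}$ and dependent choice $\mathrm{DC}$ for tuples of variables of all types. Equality at higher types is pointwise equality, and $x=_Xy$ stands for $\Vert x-_Xy\Vert_X=_{\mathbb R}0$. Full extensionality is not an axiom; there is only the quantifier-free extensionality rule: from $A_0\to s=_\rho t$ with $A_0$ quantifier-free infer $A_0\to r[s]=_\tau r[t]$. Every object of type $1$ names a real number via fast converging Cauchy sequences of coded rationals; $=_{\mathbb R},<_{\mathbb R},\le_{\mathbb R}$ are the usual defined relations on names and the arithmetical operations are closed terms. There is a closed term $(\gamma)^{-1}_l$ representing $\gamma^{-1}$ whenever $|\gamma|>2^{-l}$. A formula in which $\gamma^{-1}$ occurs under a hypothesis $\gamma>_{\mathbb R}0$ is read with an additional universally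 quantified variable $l^0$, with $(\gamma)_l^{-1}$ in place of $\gamma^{-1}$, and with the hypothesis $\gamma>_{\mathbb R}2^{-l}$ in place of $\gamma>_{\mathbb R}0$; in particular $\frac{\gamma}{\lambda}$ stands for $\gamma\cdot(\lambda)_l^{-1}$ under the hypothesis $\lambda>_{\mathbb R}2^{-l}$. The language has constants $0_X,1_X$ of type $X$, vector addition, additive inverse, scalar multiplication and norm $\Vert\cdot\Vert_X$ (of type $1(X)$), and the axioms of a real normed space with $\Vert 1_X\Vert_X=_{\mathbb R}1$ (in the form which also yields the extensionality of these operations). For inner product spaces the parallelogram law is added, and $\langle x,y\rangle_X=\frac14(\Vert x+y\Vert_X^2-\Vert x-y\Vert_X^2)$. Further constants are $\chi_A$ of type $0(X)(X)$ (we write $y\in Ax$ for $\chi_Axy=_00$), $J^A$ of type $X(X)(1)$ (we write $J^A_\gamma x$ for $J^A\gamma x$), $\tilde\gamma$ of type $1$, $m$ of type $0$ and $c_X$ of type $X$, and, in the $\mathcal U$-systems only, $\tilde\rho$ of type $1$ and $n$ of type $0$. Let $x\in\mathrm{dom}(J^A_\gamma)$ abbreviate $\exists y^X(\gamma^{-1}(x-_Xy)\in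 Ay)$. **Systems with total resolvents.** - $\mathcal V^\omega$ (over normed spaces) and $\mathcal T^\omega$ (over inner product spaces) have the axioms (I) $\forall x^X,y^X\,(\chi_Axy\le_01)$; (II) $\forall\gamma^1,x^X\,(\gamma>_{\mathbb R}0\to\gamma^{-1}(x-_XJ^A_\gamma x)\in A(J^A_\gamma x))$; (III) $\forall x^X,y^X,u^X,v^X,\lambda^1\,(u\in Ax\wedge v\in Ay\to\Vert x-_Xy+_X|\lambda|(u-_Xv)\Vert_X\ge_{\mathbb R}\Vert x-_Xy\Vert_X)$; (IV) $\tilde\gamma\ge_{\mathbb R}2^{-m}$. - $\mathcal U^\omega$ (over inner product spaces) has (I), (II), (IV), the comonotonicity axiom $\forall x^X,y^X,u^X,v^X\,(u\in Ax\wedge v\in Ay\to\langle x-_Xy,u-_Xv\rangle_X\ge_{\mathbb R}\tilde\rho\Vert u-_Xv\Vert_X^2)$ instead of (III), and (V) $\tilde\rho\ge_{\mathbb R}-\tilde\gamma+2^{-n}$. - $\mathcal U^{*\omega}$ is $\mathcal U^\omega$ with (II) restricted to those $\gamma$ with $\tilde\rho>_{\mathbb R}-\gamma/2$ and with (V) replaced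 by $\tilde\rho\ge_{\mathbb R}-\tilde\gamma/2+2^{-n}$. **Systems with partial resolvents.** $\mathcal V^\omega_p,\mathcal T^\omega_p,\mathcal U^\omega_p,\mathcal U^{*\omega}_p$ arise from $\mathcal V^\omega,\mathcal T^\omega,\mathcal U^\omega,\mathcal U^{*\omega}$ by adding the premise $x\in\mathrm{dom}(J^A_\gamma)$ to the resolvent axiom (II) and adding the axiom $\forall\gamma^1(\gamma>_{\mathbb R}0\to\gamma^{-1}(c_X-_XJ^A_\gamma c_X)\in A(J^A_\gamma c_X))$, where for $\mathcal U^{*\omega}_p$ both axioms are restricted to those $\gamma$ with $\tilde\rho>_{\mathbb R}-\gamma/2$. In none of these systems is maximality or (full) extensionality of $A$ an axiom. **Proposition.** Consider, for $\gamma^1,\lambda^1,x^X$ with $\gamma>_{\mathbb R}0$ and $\lambda>_{\mathbb R}0$, the resolvent identity $$J^A_\lambda x=_XJ^A_\gamma\Big(\frac\gamma\lambda x+_X\Big(1-\frac\gamma\lambda\Big)J^A_\lambda x\Big)\tag{1}$$ and the bound $$\Vert x-_XJ^A_\gamma x\Vert_X\le_{\mathbb R}\Big(2+\frac\gamma\lambda\Big)\Vert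 x-_XJ^A_\lambda x\Vert_X.\tag{2}$$ 1. $\mathcal V^\omega$ and $\mathcal T^\omega$ each prove: for all $\gamma,\lambda>_{\mathbb R}0$ and all $x$, (1) and (2) hold. 2. $\mathcal U^\omega$ proves: for all $\gamma,\lambda>_{\mathbb R}0$ and all $x$, (1) holds if $\tilde\rho>_{\mathbb R}-\gamma$, and (2) holds if $\tilde\rho\ge_{\mathbb R}-\gamma/2$. $\mathcal U^{*\omega}$ proves: for all $\gamma,\lambda>_{\mathbb R}0$ and all $x$, (1) and (2) hold if $\tilde\rho>_{\mathbb R}-\lambda/2$ and $\tilde\rho>_{\mathbb R}-\gamma/2$. 3. $\mathcal V^\omega_p$ and $\mathcal T^\omega_p$ each prove: for all $\gamma,\lambda>_{\mathbb R}0$ and all $x$, (1) holds if $x\in\mathrm{dom}(J^A_\lambda)$, and (2) holds if $x\in\mathrm{dom}(J^A_\gamma)$ and $x\in\mathrm{dom}(J^A_\lambda)$. 4. $\mathcal U^\omega_p$ proves: for all $\gamma,\lambda>_{\mathbb R}0$ and all $x$, (1) holds if $\tilde\rho>_{\mathbb R}-\gamma$ and $x\in\mathrm{dom}(J^A_\lambda)$,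 and (2) holds if $\tilde\rho\ge_{\mathbb R}-\gamma/2$, $x\in\mathrm{dom}(J^A_\gamma)$ and $x\in\mathrm{dom}(J^A_\lambda)$. $\mathcal U^{*\omega}_p$ proves the same statements with the condition on $\tilde\rho$ replaced in both cases by $\tilde\rho>_{\mathbb R}-\gamma/2\wedge\tilde\rho>_{\mathbb R}-\lambda/2$. -/

import Mathlib

/-! # Systems of finite-type arithmetic over an abstract space, with a set-valued operator

Intrinsically typed (de Bruijn) syntax of the many-sorted language over the types generated from
`0` and `X`, a Hilbert-style calculus for weakly extensional Peano arithmetic in all finite types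
with quantifier-free choice and dependent choice, the coding of rational and real numbers, and
the theories of accretive / monotone / comonotone operators with their resolvents. -/

namespace FinTypeArith

/-! ## Types, variables, constants, terms -/

/-- The finite types over the ground types `0` and `X`; `ρ ⇒ τ` is the type written `τ(ρ)`. -/
inductive Ty : Type
  | nat : Ty
  | X : Ty
  | arr : Ty → Ty → Ty

infixr:60 " ⇒ " => Ty.arr

open Ty (nat X)

/-- The type `1 = 0(0)`. -/
abbrev one : Ty := nat ⇒ nat

/-- `arrs [ρ₁, …, ρₖ] τ = ρ₁ ⇒ … ⇒ ρₖ ⇒ τ`. -/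
def arrs : List Ty → Ty → Ty
  | [], τ => τ
  | ρ :: ρs, τ => ρ ⇒ arrs ρs τ

/-- The type of a step functional of simultaneous recursion in the tuple of types `ρs`. -/
abbrev stepTy (ρs : List Ty) (τ : Ty) : Ty := arrs ρs (nat ⇒ τ)

/-- A context lists the types of the free variables, innermost variable first. -/
abbrev Ctx := List Ty

/-- `Var Γ τ`: the variables of type `τ` in the context `Γ`
(also used as the positions of `τ` in a tuple of types). -/
inductive Var : Ctx → Ty → Type
  | z {Γ : Ctx} {σ : Ty} : Var (σ :: Γ) σ
  | s {Γ : Ctx} {σ τ : Ty} : Var Γ τ → Var (σ :: Γ) τ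

namespace Var

def inl {Γ : Ctx} : {Δ : Ctx} → {τ : Ty} → Var Δ τ → Var (Δ ++ Γ) τ
  | _, _, .z => .z
  | _, _, .s v => .s (inl v)

def inr {Γ : Ctx} : (Δ : Ctx) → {τ : Ty} → Var Γ τ → Var (Δ ++ Γ) τ
  | [], _, v => v
  | _ :: Δ, _, v => .s (inr Δ v)

/-- Case distinction on the two parts of a concatenated context. -/
def split {Γ : Ctx} {α : Ty → Type} : (Δ : Ctx) →
    (∀ τ, Var Δ τ → α τ) → (∀ τ, Var Γ τ → α τ) → ∀ τ, Var (Δ ++ Γ) τ → α τ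
  | [], _, g, τ, v => g τ v
  | _ :: _, f, _, _, .z => f _ .z
  | _ :: Δ, f, g, τ, .s v => split Δ (fun τ w => f τ (.s w)) g τ v

def map (F : Ty → Ty) : {Δ : Ctx} → {τ : Ty} → Var Δ τ → Var (Δ.map F) (F τ)
  | _, _, .z => .z
  | _, _, .s v => .s (map F v)

end Var

/-- The two languages: `op` has the constants for the operator and its resolvent, and `como` has in
addition the constants for the comonotonicity parameter. -/
inductive Lang : Type
  | op : Lang
  | como : Lang

/-- The constants. -/
inductive Const : Lang → Ty → Type
  | zero {L : Lang} : Const L nat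
  | succ {L : Lang} : Const L (nat ⇒ nat)
  | Pi {L : Lang} (ρ τ : Ty) : Const L (ρ ⇒ τ ⇒ ρ)
  | Sigma {L : Lang} (δ ρ τ : Ty) : Const L ((δ ⇒ ρ ⇒ τ) ⇒ (δ ⇒ ρ) ⇒ δ ⇒ τ)
  /-- The component `i` of the simultaneous recursor for the tuple of types `ρs`. -/
  | recr {L : Lang} (ρs : List Ty) (τ : Ty) (i : Var ρs τ) :
      Const L (nat ⇒ arrs ρs (arrs (ρs.map (stepTy ρs)) τ))
  | zeroX {L : Lang} : Const L X
  | oneX {L : Lang} : Const L X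
  | addX {L : Lang} : Const L (X ⇒ X ⇒ X)
  | negX {L : Lang} : Const L (X ⇒ X)
  | smulX {L : Lang} : Const L (one ⇒ X ⇒ X)
  | normX {L : Lang} : Const L (X ⇒ one)
  /-- The characteristic function of the graph of the operator. -/
  | chiA {L : Lang} : Const L (X ⇒ X ⇒ nat)
  /-- The resolvent, with arguments the index and the point. -/
  | resA {L : Lang} : Const L (one ⇒ X ⇒ X)
  | gammaT {L : Lang} : Const L one
  | mT {L : Lang} : Const L nat
  | cX {L : Lang} : Const L X
  | rhoT : Const .como one
  | nT : Const .como nat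

/-- Terms in a context; the only way of forming new terms is application. -/
inductive Tm (L : Lang) : Ctx → Ty → Type
  | var {Γ : Ctx} {τ : Ty} : Var Γ τ → Tm L Γ τ
  | con {Γ : Ctx} {τ : Ty} : Const L τ → Tm L Γ τ
  | app {Γ : Ctx} {ρ τ : Ty} : Tm L Γ (ρ ⇒ τ) → Tm L Γ ρ → Tm L Γ τ

infixl:80 " ⬝ " => Tm.app

/-- A simultaneous substitution; `Sub L ρs Δ` is also the type of tuples of terms of types `ρs`. -/
abbrev Sub (L : Lang) (Γ Δ : Ctx) := ∀ τ : Ty, Var Γ τ → Tm L Δ τ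

namespace Tm

variable {L : Lang}

def ren {Γ Δ : Ctx} (r : ∀ τ, Var Γ τ → Var Δ τ) : {τ : Ty} → Tm L Γ τ → Tm L Δ τ
  | _, .var v => .var (r _ v)
  | _, .con c => .con c
  | _, .app t u => .app (ren r t) (ren r u)

def subst {Γ Δ : Ctx} (f : Sub L Γ Δ) : {τ : Ty} → Tm L Γ τ → Tm L Δ τ
  | _, .var v => f _ v
  | _, .con c => .con c
  | _, .app t u => .app (subst f t) (subst f u)

/-- Weakening by one variable. -/
def wk {Γ : Ctx} {σ τ : Ty} (t : Tm L Γ τ) : Tm L (σ :: Γ) τ := t.ren fun _ v => .s v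

/-- Application to a tuple of terms. -/
def apps {Γ : Ctx} {τ : Ty} : (ρs : List Ty) → Tm L Γ (arrs ρs τ) → Sub L ρs Γ → Tm L Γ τ
  | [], t, _ => t
  | _ :: ρs, t, a => apps ρs (t ⬝ a _ .z) fun τ v => a τ (.s v)

/-- Lambda abstraction, defined through the combinators. -/
def lam {Γ : Ctx} {σ : Ty} : {τ : Ty} → Tm L (σ :: Γ) τ → Tm L Γ (σ ⇒ τ)
  | _, .var .z => .con (.Sigma σ (σ ⇒ σ) σ) ⬝ .con (.Pi σ (σ ⇒ σ)) ⬝ .con (.Pi σ σ)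
  | _, .var (.s v) => .con (.Pi _ σ) ⬝ .var v
  | _, .con c => .con (.Pi _ σ) ⬝ .con c
  | _, .app t u => .con (.Sigma σ _ _) ⬝ lam t ⬝ lam u

end Tm

namespace Sub

variable {L : Lang}

def lift {Γ Δ : Ctx} {σ : Ty} (f : Sub L Γ Δ) : Sub L (σ :: Γ) (σ :: Δ)
  | _, .z => .var .z
  | _, .s v => (f _ v).wk

/-- Replaces the innermost variable by `t`. -/
def inst {Γ : Ctx} {σ : Ty} (t : Tm L Γ σ) : Sub L (σ :: Γ) Γ
  | _, .z => t
  | _, .s v => .var v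

/-- The substitution from the empty context. -/
def empty {Γ : Ctx} : Sub L [] Γ := fun _ v => nomatch v

end Sub

/-! ## Formulas -/

/-- Formulas in a context; the only prime formulas are equations of type `0`. -/
inductive Fml (L : Lang) : Ctx → Type
  | eq {Γ : Ctx} : Tm L Γ nat → Tm L Γ nat → Fml L Γ
  | and {Γ : Ctx} : Fml L Γ → Fml L Γ → Fml L Γ
  | or {Γ : Ctx} : Fml L Γ → Fml L Γ → Fml L Γ
  | imp {Γ : Ctx} : Fml L Γ → Fml L Γ → Fml L Γ
  | all {Γ : Ctx} (σ : Ty) : Fml L (σ :: Γ) → Fml L Γ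
  | ex {Γ : Ctx} (σ : Ty) : Fml L (σ :: Γ) → Fml L Γ

infixr:35 " ⊓ₗ " => Fml.and
infixr:25 " ⟶ₗ " => Fml.imp

namespace Fml

variable {L : Lang}

def subst : {Γ Δ : Ctx} → Sub L Γ Δ → Fml L Γ → Fml L Δ
  | _, _, f, .eq s t => .eq (s.subst f) (t.subst f)
  | _, _, f, .and A B => .and (A.subst f) (B.subst f)
  | _, _, f, .or A B => .or (A.subst f) (B.subst f)
  | _, _, f, .imp A B => .imp (A.subst f) (B.subst f)
  | _, _, f, .all σ A => .all σ (A.subst f.lift)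
  | _, _, f, .ex σ A => .ex σ (A.subst f.lift)

def wk {Γ : Ctx} {σ : Ty} (A : Fml L Γ) : Fml L (σ :: Γ) := A.subst fun _ v => .var (.s v)

/-- A closed formula, read in the context `Γ`. -/
def closed (Γ : Ctx) (A : Fml L []) : Fml L Γ := A.subst Sub.empty

def IsQF : {Γ : Ctx} → Fml L Γ → Prop
  | _, .eq _ _ => True
  | _, .and A B => A.IsQF ∧ B.IsQF
  | _, .or A B => A.IsQF ∧ B.IsQF
  | _, .imp A B => A.IsQF ∧ B.IsQF
  | _, .all _ _ => False
  | _, .ex _ _ => False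

/-- Quantification over a tuple of variables. -/
def alls {Γ : Ctx} : (ρs : List Ty) → Fml L (ρs ++ Γ) → Fml L Γ
  | [], A => A
  | ρ :: ρs, A => alls ρs (.all ρ A)

def exs {Γ : Ctx} : (ρs : List Ty) → Fml L (ρs ++ Γ) → Fml L Γ
  | [], A => A
  | ρ :: ρs, A => exs ρs (.ex ρ A)

end Fml

/-! ## Closed terms for elementary arithmetic

All definitions below give closed terms, uniformly in the ambient context. -/

section Terms

variable {L : Lang} {Γ : Ctx}

open Tm (lam)

abbrev x0 {a : Ty} : Tm L (a :: Γ) a := .var .z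
abbrev x1 {a b : Ty} : Tm L (b :: a :: Γ) a := .var (.s .z)
abbrev x2 {a b c : Ty} : Tm L (c :: b :: a :: Γ) a := .var (.s (.s .z))
abbrev x3 {a b c d : Ty} : Tm L (d :: c :: b :: a :: Γ) a := .var (.s (.s (.s .z)))
abbrev x4 {a b c d e : Ty} : Tm L (e :: d :: c :: b :: a :: Γ) a :=
  .var (.s (.s (.s (.s .z))))

def O : Tm L Γ nat := .con .zero
def S (t : Tm L Γ nat) : Tm L Γ nat := .con .succ ⬝ t

/-- Recursion in a single type: `natRec 0 b f = b`, `natRec (n+1) b f = f (natRec n b f) n`. -/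
def natRec {ρ : Ty} (n : Tm L Γ nat) (b : Tm L Γ ρ) (f : Tm L Γ (ρ ⇒ nat ⇒ ρ)) : Tm L Γ ρ :=
  (.con (.recr [ρ] ρ .z) : Tm L Γ (nat ⇒ ρ ⇒ (ρ ⇒ nat ⇒ ρ) ⇒ ρ)) ⬝ n ⬝ b ⬝ f

def addC : Tm L Γ (nat ⇒ nat ⇒ nat) := lam (lam (natRec x0 x1 (lam (lam (S x1)))))
def add (s t : Tm L Γ nat) : Tm L Γ nat := addC ⬝ s ⬝ t

def mulC : Tm L Γ (nat ⇒ nat ⇒ nat) := lam (lam (natRec x0 O (lam (lam (add x1 x3)))))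
def mul (s t : Tm L Γ nat) : Tm L Γ nat := mulC ⬝ s ⬝ t

def predC : Tm L Γ (nat ⇒ nat) := lam (natRec x0 O (lam (lam x0)))
def pred (t : Tm L Γ nat) : Tm L Γ nat := predC ⬝ t

/-- Truncated subtraction. -/
def subC : Tm L Γ (nat ⇒ nat ⇒ nat) := lam (lam (natRec x0 x1 (lam (lam (pred x1)))))
def sub (s t : Tm L Γ nat) : Tm L Γ nat := subC ⬝ s ⬝ t

/-- `ite c a b` is `a` if `c = 0` and `b` otherwise. -/
def iteC : Tm L Γ (nat ⇒ nat ⇒ nat ⇒ nat) := lam (lam (lam (natRec x2 x1 (lam (lam x2)))))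
def ite (c a b : Tm L Γ nat) : Tm L Γ nat := iteC ⬝ c ⬝ a ⬝ b

def pow2C : Tm L Γ (nat ⇒ nat) := lam (natRec x0 (S O) (lam (lam (add x1 x1))))
def pow2 (t : Tm L Γ nat) : Tm L Γ nat := pow2C ⬝ t

/-- The distance of two numbers, which is `0` exactly if they are equal. -/
def distC : Tm L Γ (nat ⇒ nat ⇒ nat) := lam (lam (add (sub x1 x0) (sub x0 x1)))
def dist (s t : Tm L Γ nat) : Tm L Γ nat := distC ⬝ s ⬝ t

/-- `search P n` is the least `k < n` with `P k = 0` if there is one, and `n` otherwise. -/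
def searchC : Tm L Γ (one ⇒ nat ⇒ nat) :=
  lam (lam (natRec x0 O (lam (lam (ite (x3 ⬝ x1) x1 (S x0))))))
def search (P : Tm L Γ one) (n : Tm L Γ nat) : Tm L Γ nat := searchC ⬝ P ⬝ n

/-- `bmin P b` is the least `k ≤ b` with `P k = 0` if there is one, and `0` otherwise. -/
def bminC : Tm L Γ (one ⇒ nat ⇒ nat) :=
  lam (lam (ite (sub (search x1 (S x0)) x0) (search x1 (S x0)) O))
def bmin (P : Tm L Γ one) (b : Tm L Γ nat) : Tm L Γ nat := bminC ⬝ P ⬝ b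

/-- `(n + m)² + 3 n + m`. -/
def cantorC : Tm L Γ (nat ⇒ nat ⇒ nat) :=
  lam (lam (add (add (mul (add x1 x0) (add x1 x0)) (add (add x1 x1) x1)) x0))

/-- The pairing function `j(n, m) = min u ≤ (n+m)²+3n+m [2u = (n+m)²+3n+m]`. -/
def pairC : Tm L Γ (nat ⇒ nat ⇒ nat) :=
  lam (lam (bmin (lam (dist (add x0 x0) (cantorC ⬝ x2 ⬝ x1))) (cantorC ⬝ x1 ⬝ x0)))
def pair (s t : Tm L Γ nat) : Tm L Γ nat := pairC ⬝ s ⬝ t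

/-- `min x ≤ z [∃ y ≤ z, j(x, y) = z]`. -/
def fstC : Tm L Γ (nat ⇒ nat) :=
  lam (bmin (lam (dist (pair x0 (bmin (lam (dist (pair x1 x0) x2)) x1)) x1)) x0)
/-- `min y ≤ z [∃ x ≤ z, j(x, y) = z]`. -/
def sndC : Tm L Γ (nat ⇒ nat) :=
  lam (bmin (lam (dist (pair (bmin (lam (dist (pair x0 x1) x2)) x1) x0) x1)) x0)

/-- `half a = ⌊a / 2⌋ = min k ≤ a [a ≤ 2k+1]`. -/
def halfC : Tm L Γ (nat ⇒ nat) := lam (bmin (lam (sub x1 (S (add x0 x0)))) x0)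
def half (t : Tm L Γ nat) : Tm L Γ nat := halfC ⬝ t
def oddC : Tm L Γ (nat ⇒ nat) := lam (sub x0 (add (half x0) (half x0)))

/-! ## Rational numbers

`j(a, b)` codes `(a/2)/(b+1)` if `a` is even and `-((a+1)/2)/(b+1)` if `a` is odd. -/

/-- Positive part of the numerator. -/
def posC : Tm L Γ (nat ⇒ nat) := lam (ite (oddC ⬝ (fstC ⬝ x0)) (half (fstC ⬝ x0)) O)
/-- Negative part of the numerator. -/
def negC : Tm L Γ (nat ⇒ nat) := lam (ite (oddC ⬝ (fstC ⬝ x0)) O (S (half (fstC ⬝ x0))))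
def denC : Tm L Γ (nat ⇒ nat) := lam (S (sndC ⬝ x0))
def numPos (q : Tm L Γ nat) : Tm L Γ nat := posC ⬝ q
def numNeg (q : Tm L Γ nat) : Tm L Γ nat := negC ⬝ q
def den (q : Tm L Γ nat) : Tm L Γ nat := denC ⬝ q

/-- `mkQ p n d` codes `(p - n)/d`, for `d > 0`. -/
def mkQC : Tm L Γ (nat ⇒ nat ⇒ nat ⇒ nat) :=
  lam (lam (lam (pair
    (add (add (sub x2 x1) (sub x2 x1)) (pred (add (sub x1 x2) (sub x1 x2)))) (pred x0))))
def mkQ (p n d : Tm L Γ nat) : Tm L Γ nat := mkQC ⬝ p ⬝ n ⬝ d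

def addQC : Tm L Γ (nat ⇒ nat ⇒ nat) :=
  lam (lam (mkQ (add (mul (numPos x1) (den x0)) (mul (numPos x0) (den x1)))
    (add (mul (numNeg x1) (den x0)) (mul (numNeg x0) (den x1))) (mul (den x1) (den x0))))
def addQ (q r : Tm L Γ nat) : Tm L Γ nat := addQC ⬝ q ⬝ r

def negQC : Tm L Γ (nat ⇒ nat) := lam (mkQ (numNeg x0) (numPos x0) (den x0))
def negQ (q : Tm L Γ nat) : Tm L Γ nat := negQC ⬝ q
def subQ (q r : Tm L Γ nat) : Tm L Γ nat := addQ q (negQ r)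

def absQC : Tm L Γ (nat ⇒ nat) := lam (mkQ (add (numPos x0) (numNeg x0)) O (den x0))
def absQ (q : Tm L Γ nat) : Tm L Γ nat := absQC ⬝ q

def mulQC : Tm L Γ (nat ⇒ nat ⇒ nat) :=
  lam (lam (mkQ (add (mul (numPos x1) (numPos x0)) (mul (numNeg x1) (numNeg x0)))
    (add (mul (numPos x1) (numNeg x0)) (mul (numNeg x1) (numPos x0))) (mul (den x1) (den x0))))
def mulQ (q r : Tm L Γ nat) : Tm L Γ nat := mulQC ⬝ q ⬝ r

/-- The reciprocal (with value `0` at `0`). -/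
def invQC : Tm L Γ (nat ⇒ nat) :=
  lam (mkQ (ite (numPos x0) O (den x0)) (ite (numNeg x0) O (den x0)) (add (numPos x0) (numNeg x0)))
def invQ (q : Tm L Γ nat) : Tm L Γ nat := invQC ⬝ q

/-- A term which is `0` exactly if `q ≤ r` as rational numbers. -/
def leQC : Tm L Γ (nat ⇒ nat ⇒ nat) :=
  lam (lam (sub (add (mul (numPos x1) (den x0)) (mul (numNeg x0) (den x1)))
    (add (mul (numPos x0) (den x1)) (mul (numNeg x1) (den x0)))))
/-- A term which is `0` exactly if `q < r` as rational numbers. -/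
def ltQC : Tm L Γ (nat ⇒ nat ⇒ nat) :=
  lam (lam (sub (S (add (mul (numPos x1) (den x0)) (mul (numNeg x0) (den x1))))
    (add (mul (numPos x0) (den x1)) (mul (numNeg x1) (den x0)))))
def maxQ (q r : Tm L Γ nat) : Tm L Γ nat := ite (leQC ⬝ q ⬝ r) r q
def minQ (q r : Tm L Γ nat) : Tm L Γ nat := ite (leQC ⬝ q ⬝ r) q r

/-- The code `j(2, 2ⁿ - 1)` of `2⁻ⁿ`. -/
def twoNegQ (n : Tm L Γ nat) : Tm L Γ nat := pair (S (S O)) (pred (pow2 n))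

/-! ## Real numbers

Every `f` of type `1` represents a real number: it is read as the sequence `f̂` of rational numbers
which follows `f` up to the first `k` with `|f(k) - f(k+1)| ≥ 2^{-k-1}` and is constant from there
on, so that `f̂` is a Cauchy sequence with modulus `2⁻ⁿ`. -/

def hatC : Tm L Γ (one ⇒ one) :=
  lam (lam (x1 ⬝ search (lam (leQC ⬝ twoNegQ (S x0) ⬝ absQ (subQ (x2 ⬝ x0) (x2 ⬝ S x0)))) x0))
def hat (f : Tm L Γ one) (n : Tm L Γ nat) : Tm L Γ nat := hatC ⬝ f ⬝ n

/-- The real number given by a constant sequence. -/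
def ratR (q : Tm L Γ nat) : Tm L Γ one := .con (.Pi nat nat) ⬝ q
/-- The real number given by a natural number. -/
def natR (n : Tm L Γ nat) : Tm L Γ one := ratR (pair (add n n) O)
def zeroR : Tm L Γ one := natR O
def oneR : Tm L Γ one := natR (S O)
def twoR : Tm L Γ one := natR (S (S O))
/-- The real number `2⁻ⁿ`. -/
def twoNegR (n : Tm L Γ nat) : Tm L Γ one := ratR (twoNegQ n)

def addRC : Tm L Γ (one ⇒ one ⇒ one) :=
  lam (lam (lam (addQ (hat x2 (S x0)) (hat x1 (S x0)))))
def addR (f g : Tm L Γ one) : Tm L Γ one := addRC ⬝ f ⬝ g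

def negRC : Tm L Γ (one ⇒ one) := lam (lam (negQ (hat x1 x0)))
def negR (f : Tm L Γ one) : Tm L Γ one := negRC ⬝ f
def subR (f g : Tm L Γ one) : Tm L Γ one := addR f (negR g)

def absRC : Tm L Γ (one ⇒ one) := lam (lam (absQ (hat x1 x0)))
def absR (f : Tm L Γ one) : Tm L Γ one := absRC ⬝ f

/-- A number `k` with `2ᵏ ≥ |f̂(0)| + |ĝ(0)| + 2`. -/
def mulShiftC : Tm L Γ (one ⇒ one ⇒ nat) :=
  lam (lam (S (S (add (add (numPos (hat x1 O)) (numNeg (hat x1 O)))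
    (add (numPos (hat x0 O)) (numNeg (hat x0 O)))))))
/-- `(f · g)(n) = f̂(n + k) · ĝ(n + k)`. -/
def mulRC : Tm L Γ (one ⇒ one ⇒ one) :=
  lam (lam (lam (mulQ (hat x2 (add x0 (mulShiftC ⬝ x2 ⬝ x1)))
    (hat x1 (add x0 (mulShiftC ⬝ x2 ⬝ x1))))))
def mulR (f g : Tm L Γ one) : Tm L Γ one := mulRC ⬝ f ⬝ g
def sqR (f : Tm L Γ one) : Tm L Γ one := mulR f f

/-- The reciprocal `(f)⁻¹_l`, correct for `|f| > 2⁻ˡ`; the arguments are `l`, `f`: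
`(f)⁻¹_l(n)` is `1 / max (f̂(n+2l), 2⁻ˡ)` if `f̂(l+1) > 0`, and `1 / min (f̂(n+2l), -2⁻ˡ)` if not. -/
def invRC : Tm L Γ (nat ⇒ one ⇒ one) :=
  lam (lam (lam (ite (leQC ⬝ hat x1 (S x2) ⬝ O)
    (invQ (minQ (hat x1 (add x0 (add x2 x2))) (negQ (twoNegQ x2))))
    (invQ (maxQ (hat x1 (add x0 (add x2 x2))) (twoNegQ x2))))))
def invR (l : Tm L Γ nat) (f : Tm L Γ one) : Tm L Γ one := invRC ⬝ l ⬝ f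

/-- `f / 2`. -/
def halfR (f : Tm L Γ one) : Tm L Γ one := mulR (twoNegR (S O)) f

/-- `f / g`, with `g` assumed to satisfy `|g| > 2⁻ˡ`. -/
def divR (l : Tm L Γ nat) (f g : Tm L Γ one) : Tm L Γ one := mulR f (invR l g)

/-! ## Terms of type `X` -/

def zeroX : Tm L Γ X := .con .zeroX
def oneX : Tm L Γ X := .con .oneX
def addX (x y : Tm L Γ X) : Tm L Γ X := .con .addX ⬝ x ⬝ y
def negX (x : Tm L Γ X) : Tm L Γ X := .con .negX ⬝ x
def subX (x y : Tm L Γ X) : Tm L Γ X := addX x (negX y)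
def smulX (a : Tm L Γ one) (x : Tm L Γ X) : Tm L Γ X := .con .smulX ⬝ a ⬝ x
def normX (x : Tm L Γ X) : Tm L Γ one := .con .normX ⬝ x
/-- `J^A_γ x`. -/
def J (γ : Tm L Γ one) (x : Tm L Γ X) : Tm L Γ X := .con .resA ⬝ γ ⬝ x
/-- `⟨x, y⟩ = (‖x + y‖² - ‖x - y‖²) / 4`. -/
def innerX (x y : Tm L Γ X) : Tm L Γ one :=
  mulR (twoNegR (S (S O))) (subR (sqR (normX (addX x y))) (sqR (normX (subX x y))))

/-! ## Defined relations -/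

def bot : Fml L Γ := .eq O (S O)
def neg (A : Fml L Γ) : Fml L Γ := A ⟶ₗ bot

/-- `s ≤₀ t`. -/
def leN (s t : Tm L Γ nat) : Fml L Γ := .eq (sub s t) O
def leQ (q r : Tm L Γ nat) : Fml L Γ := .eq (leQC ⬝ q ⬝ r) O
def ltQ (q r : Tm L Γ nat) : Fml L Γ := .eq (ltQC ⬝ q ⬝ r) O

/-- `f =_ℝ g :≡ ∀ n (|f̂(n+1) - ĝ(n+1)| < 2⁻ⁿ)`. -/
def eqR (f g : Tm L Γ one) : Fml L Γ :=
  .all nat (ltQ (absQ (subQ (hat f.wk (S x0)) (hat g.wk (S x0)))) (twoNegQ x0))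
/-- `f <_ℝ g :≡ ∃ n (ĝ(n+1) - f̂(n+1) ≥ 2⁻ⁿ)`. -/
def ltR (f g : Tm L Γ one) : Fml L Γ :=
  .ex nat (leQ (twoNegQ x0) (subQ (hat g.wk (S x0)) (hat f.wk (S x0))))
def leR (f g : Tm L Γ one) : Fml L Γ := neg (ltR g f)

/-- `x =_X y :≡ ‖x - y‖ =_ℝ 0`. -/
def eqX (x y : Tm L Γ X) : Fml L Γ := eqR (normX (subX x y)) zeroR

/-- Equality at all types, defined pointwise. -/
def eqT : {Γ : Ctx} → {ρ : Ty} → Tm L Γ ρ → Tm L Γ ρ → Fml L Γ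
  | _, .nat, s, t => .eq s t
  | _, .X, s, t => eqX s t
  | _, .arr ρ _, s, t => .all ρ (eqT (s.wk ⬝ x0) (t.wk ⬝ x0))

/-- `y ∈ A x`. -/
def memA (y x : Tm L Γ X) : Fml L Γ := .eq (.con .chiA ⬝ x ⬝ y) O

/-- `γ⁻¹ (x - p) ∈ A p`, with the reciprocal read as `(γ)⁻¹_l`. -/
def resIncl (l : Tm L Γ nat) (γ : Tm L Γ one) (x p : Tm L Γ X) : Fml L Γ :=
  memA (smulX (invR l γ) (subX x p)) p

/-- `x ∈ dom(J^A_γ) :≡ ∃ y (γ⁻¹ (x - y) ∈ A y)`, with the reciprocal read as `(γ)⁻¹_l`. -/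
def domJ (l : Tm L Γ nat) (γ : Tm L Γ one) (x : Tm L Γ X) : Fml L Γ :=
  .ex X (resIncl l.wk γ.wk x.wk x0)

end Terms

/-! ## Derivability -/

section Choice

variable {L : Lang}

/-- The substitution `A(x, y) ↦ A(x, Y x)` of the axiom of choice, for tuples `x`, `y`, `Y`. -/
def acSub (Γ : Ctx) (xs ys : List Ty) :
    Sub L (ys ++ (xs ++ Γ)) (xs ++ (ys.map (arrs xs) ++ Γ)) :=
  Var.split ys
    (fun _ i => Tm.apps xs (.var (Var.inr xs (Var.inl (i.map (arrs xs))))) fun _ j =>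
      .var (Var.inl j))
    (Var.split xs (fun _ j => .var (Var.inl j)) fun _ v => .var (Var.inr xs (Var.inr _ v)))

/-- The substitution `A(x, y, z) ↦ A(x, f x, f (S x))` of dependent choice, for tuples. -/
def dcSub (Γ : Ctx) (ρs : List Ty) :
    Sub L (ρs ++ (ρs ++ (nat :: Γ))) (nat :: (ρs.map (Ty.arr nat) ++ Γ)) :=
  Var.split ρs (fun _ i => .var (.s (Var.inl (i.map (Ty.arr nat)))) ⬝ S x0)
    (Var.split ρs (fun _ i => .var (.s (Var.inl (i.map (Ty.arr nat)))) ⬝ x0)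
      (Sub.lift fun _ v => .var (Var.inr _ v)))

/-- The substitution `A(x) ↦ A(S x)`. -/
def succSub (Γ : Ctx) : Sub L (nat :: Γ) (nat :: Γ)
  | _, .z => S x0
  | _, .s v => .var (.s v)

end Choice

/-- `Proves T A`: the formula `A` (with free variables in the context `Γ`) is derivable in classical
many-sorted logic from weakly extensional Peano arithmetic in all finite types, the schemata of
quantifier-free choice and dependent choice, and the closed axioms `T`. -/
inductive Proves {L : Lang} (T : Set (Fml L [])) : {Γ : Ctx} → Fml L Γ → Prop
  | ax {Γ : Ctx} {A : Fml L []} : A ∈ T → Proves T (A.closed Γ)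
  -- propositional logic
  | mp {Γ : Ctx} {A B : Fml L Γ} : Proves T (A ⟶ₗ B) → Proves T A → Proves T B
  | impK {Γ : Ctx} (A B : Fml L Γ) : Proves T (A ⟶ₗ B ⟶ₗ A)
  | impS {Γ : Ctx} (A B C : Fml L Γ) :
      Proves T ((A ⟶ₗ B ⟶ₗ C) ⟶ₗ (A ⟶ₗ B) ⟶ₗ A ⟶ₗ C)
  | andI {Γ : Ctx} (A B : Fml L Γ) : Proves T (A ⟶ₗ B ⟶ₗ A ⊓ₗ B)
  | andL {Γ : Ctx} (A B : Fml L Γ) : Proves T (A ⊓ₗ B ⟶ₗ A)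
  | andR {Γ : Ctx} (A B : Fml L Γ) : Proves T (A ⊓ₗ B ⟶ₗ B)
  | orL {Γ : Ctx} (A B : Fml L Γ) : Proves T (A ⟶ₗ .or A B)
  | orR {Γ : Ctx} (A B : Fml L Γ) : Proves T (B ⟶ₗ .or A B)
  | orE {Γ : Ctx} (A B C : Fml L Γ) :
      Proves T ((A ⟶ₗ C) ⟶ₗ (B ⟶ₗ C) ⟶ₗ .or A B ⟶ₗ C)
  | efq {Γ : Ctx} (A : Fml L Γ) : Proves T (bot ⟶ₗ A)
  | em {Γ : Ctx} (A : Fml L Γ) : Proves T (.or A (neg A))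
  -- quantifiers
  | allE {Γ : Ctx} {σ : Ty} (A : Fml L (σ :: Γ)) (t : Tm L Γ σ) :
      Proves T (.all σ A ⟶ₗ A.subst (Sub.inst t))
  | exI {Γ : Ctx} {σ : Ty} (A : Fml L (σ :: Γ)) (t : Tm L Γ σ) :
      Proves T (A.subst (Sub.inst t) ⟶ₗ .ex σ A)
  | allI {Γ : Ctx} {σ : Ty} {A : Fml L Γ} {B : Fml L (σ :: Γ)} :
      Proves T (A.wk ⟶ₗ B) → Proves T (A ⟶ₗ .all σ B)
  | exE {Γ : Ctx} {σ : Ty} {A : Fml L (σ :: Γ)} {B : Fml L Γ} :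
      Proves T (A ⟶ₗ B.wk) → Proves T (.ex σ A ⟶ₗ B)
  -- equality of type `0`
  | eqRefl {Γ : Ctx} (s : Tm L Γ nat) : Proves T (.eq s s)
  | eqSymm {Γ : Ctx} (s t : Tm L Γ nat) : Proves T (.eq s t ⟶ₗ .eq t s)
  | eqTrans {Γ : Ctx} (s t u : Tm L Γ nat) : Proves T (.eq s t ⟶ₗ .eq t u ⟶ₗ .eq s u)
  -- arithmetic
  | succNe {Γ : Ctx} (s : Tm L Γ nat) : Proves T (neg (.eq (S s) O))
  | succInj {Γ : Ctx} (s t : Tm L Γ nat) : Proves T (.eq (S s) (S t) ⟶ₗ .eq s t)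
  | ind {Γ : Ctx} (A : Fml L (nat :: Γ)) :
      Proves T (A.subst (Sub.inst O) ⟶ₗ .all nat (A ⟶ₗ A.subst (succSub Γ)) ⟶ₗ .all nat A)
  -- combinators and simultaneous recursors
  | piEq {Γ : Ctx} {ρ τ : Ty} (s : Tm L Γ ρ) (t : Tm L Γ τ) :
      Proves T (eqT (.con (.Pi ρ τ) ⬝ s ⬝ t) s)
  | sigmaEq {Γ : Ctx} {δ ρ τ : Ty} (s : Tm L Γ (δ ⇒ ρ ⇒ τ)) (t : Tm L Γ (δ ⇒ ρ)) (u : Tm L Γ δ) :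
      Proves T (eqT (.con (.Sigma δ ρ τ) ⬝ s ⬝ t ⬝ u) (s ⬝ u ⬝ (t ⬝ u)))
  | recZero {Γ : Ctx} (ρs : List Ty) (τ : Ty) (i : Var ρs τ) (y : Sub L ρs Γ)
      (z : Sub L (ρs.map (stepTy ρs)) Γ) :
      Proves T (eqT (Tm.apps _ (Tm.apps ρs (.con (.recr ρs τ i) ⬝ O) y) z) (y τ i))
  | recSucc {Γ : Ctx} (ρs : List Ty) (τ : Ty) (i : Var ρs τ) (n : Tm L Γ nat) (y : Sub L ρs Γ)
      (z : Sub L (ρs.map (stepTy ρs)) Γ) :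
      Proves T (eqT (Tm.apps _ (Tm.apps ρs (.con (.recr ρs τ i) ⬝ S n) y) z)
        (Tm.apps ρs (z _ (i.map (stepTy ρs)))
          (fun σ j => Tm.apps _ (Tm.apps ρs (.con (.recr ρs σ j) ⬝ n) y) z) ⬝ n))
  -- the rule of quantifier-free extensionality
  | qfER {Γ : Ctx} {ρ τ : Ty} {A : Fml L Γ} {s t : Tm L Γ ρ} (r : Tm L (ρ :: Γ) τ) :
      A.IsQF → Proves T (A ⟶ₗ eqT s t) →
      Proves T (A ⟶ₗ eqT (r.subst (Sub.inst s)) (r.subst (Sub.inst t)))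
  -- quantifier-free choice and dependent choice, for tuples of variables
  | qfAC {Γ : Ctx} (xs ys : List Ty) (A : Fml L (ys ++ (xs ++ Γ))) : A.IsQF →
      Proves T (Fml.alls xs (Fml.exs ys A) ⟶ₗ
        Fml.exs (ys.map (arrs xs)) (Fml.alls xs (A.subst (acSub Γ xs ys))))
  | dc {Γ : Ctx} (ρs : List Ty) (A : Fml L (ρs ++ (ρs ++ (nat :: Γ)))) :
      Proves T (.all nat (Fml.alls ρs (Fml.exs ρs A)) ⟶ₗ
        Fml.exs (ρs.map (Ty.arr nat)) (.all nat (A.subst (dcSub Γ ρs))))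

/-! ## Theories -/

section Theories

variable {L : Lang}

/-- Real vector space axioms; equations are those of `=_X`. -/
def vectorSpaceAx : Set (Fml L []) :=
  { .all X (.all X (.all X (eqX (addX (addX x2 x1) x0) (addX x2 (addX x1 x0))))),
    .all X (.all X (eqX (addX x1 x0) (addX x0 x1))),
    .all X (eqX (addX x0 zeroX) x0),
    .all X (eqX (addX x0 (negX x0)) zeroX),
    .all X (eqX (smulX oneR x0) x0),
    .all one (.all one (.all X (eqX (smulX x2 (smulX x1 x0)) (smulX (mulR x2 x1) x0)))),
    .all one (.all X (.all X (eqX (smulX x2 (addX x1 x0)) (addX (smulX x2 x1) (smulX x2 x0))))),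
    .all one (.all one (.all X
      (eqX (smulX (addR x2 x1) x0) (addX (smulX x2 x0) (smulX x1 x0))))) }

/-- Norm axioms, in the form which also gives the extensionality of all operations. -/
def normAx : Set (Fml L []) :=
  { .all X (eqR (normX (subX x0 x0)) zeroR),
    .all X (.all X (eqR (normX (subX x1 x0)) (normX (subX x0 x1)))),
    .all X (.all X (.all X
      (leR (normX (subX x2 x0)) (addR (normX (subX x2 x1)) (normX (subX x1 x0)))))),
    .all one (.all X (.all X (eqR (normX (subX (smulX x2 x1) (smulX x2 x0)))
      (mulR (absR x2) (normX (subX x1 x0)))))),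
    .all one (.all one (.all X (eqR (normX (subX (smulX x2 x0) (smulX x1 x0)))
      (mulR (absR (subR x2 x1)) (normX x0))))),
    .all X (.all X (.all X (.all X (leR (normX (subX (addX x3 x2) (addX x1 x0)))
      (addR (normX (subX x3 x1)) (normX (subX x2 x0))))))),
    .all X (.all X (eqR (normX (subX (negX x1) (negX x0))) (normX (subX x1 x0)))),
    .all X (.all X (leR (absR (subR (normX x1) (normX x0))) (normX (subX x1 x0)))),
    eqR (normX oneX) oneR }

/-- The axioms for normed spaces, with `‖1_X‖ = 1`. -/
def normedAx : Set (Fml L []) := vectorSpaceAx ∪ normAx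

/-- `‖x + y‖² + ‖x - y‖² = 2 (‖x‖² + ‖y‖²)`. -/
def parallelogram : Fml L [] :=
  .all X (.all X (eqR (addR (sqR (normX (addX x1 x0))) (sqR (normX (subX x1 x0))))
    (mulR twoR (addR (sqR (normX x1)) (sqR (normX x0))))))

/-- The axioms for inner product spaces. -/
def innerAx : Set (Fml L []) := normedAx ∪ {parallelogram}

/-- `χ_A x y ≤ 1`. -/
def chiLeOne : Fml L [] := .all X (.all X (leN (.con .chiA ⬝ x1 ⬝ x0) (S O)))

/-- Total resolvents: `γ > 2⁻ˡ → γ⁻¹ (x - J_γ x) ∈ A (J_γ x)`, for all `γ`, `x`, `l`. -/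
def totalRes : Fml L [] :=
  .all one (.all X (.all nat (ltR (twoNegR x0) x2 ⟶ₗ resIncl x0 x2 x1 (J x2 x1))))

/-- Partial resolvents:
`γ > 2⁻ˡ ∧ x ∈ dom J_γ → γ⁻¹ (x - J_γ x) ∈ A (J_γ x)`, for all `γ`, `x`, `l`. -/
def partialRes : Fml L [] :=
  .all one (.all X (.all nat
    (ltR (twoNegR x0) x2 ⊓ₗ domJ x0 x2 x1 ⟶ₗ resIncl x0 x2 x1 (J x2 x1))))

/-- `c_X` is in the domain of all resolvents:
`γ > 2⁻ˡ → γ⁻¹ (c - J_γ c) ∈ A (J_γ c)`, for all `γ`, `l`. -/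
def anchorRes : Fml L [] :=
  .all one (.all nat
    (ltR (twoNegR x0) x1 ⟶ₗ resIncl x0 x1 (.con .cX) (J x1 (.con .cX))))

/-- Accretivity: `u ∈ A x ∧ v ∈ A y → ‖x - y + |λ| (u - v)‖ ≥ ‖x - y‖`,
for all `x`, `y`, `u`, `v`, `λ`. -/
def accretive : Fml L [] :=
  .all X (.all X (.all X (.all X (.all one (memA x2 x4 ⊓ₗ memA x1 x3 ⟶ₗ
    leR (normX (subX x4 x3)) (normX (addX (subX x4 x3) (smulX (absR x0) (subX x2 x1)))))))))

/-- `γ̃ ≥ 2^{-m}`. -/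
def gammaPos : Fml L [] := leR (twoNegR (.con .mT)) (.con .gammaT)

/-- The constant `ρ̃` of type `1`. -/
def rhoT {Γ : Ctx} : Tm .como Γ one := .con .rhoT

/-- `ρ̃ > -γ/2`. -/
def rhoGtHalf {Γ : Ctx} (γ : Tm .como Γ one) : Fml .como Γ := ltR (negR (halfR γ)) rhoT

/-- `ρ`-comonotonicity: `u ∈ A x ∧ v ∈ A y → ⟨x - y, u - v⟩ ≥ ρ̃ ‖u - v‖²`,
for all `x`, `y`, `u`, `v`. -/
def comonotone : Fml .como [] :=
  .all X (.all X (.all X (.all X (memA x1 x3 ⊓ₗ memA x0 x2 ⟶ₗ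
    leR (mulR rhoT (sqR (normX (subX x1 x0)))) (innerX (subX x3 x2) (subX x1 x0))))))

/-- `ρ̃ ≥ -γ̃ + 2^{-n}`. -/
def rhoGamma : Fml .como [] := leR (addR (negR (.con .gammaT)) (twoNegR (.con .nT))) rhoT

/-- `ρ̃ ≥ -γ̃/2 + 2^{-n}`. -/
def rhoGammaHalf : Fml .como [] :=
  leR (addR (negR (halfR (.con .gammaT))) (twoNegR (.con .nT))) rhoT

/-- `totalRes` restricted to indices with `ρ̃ > -γ/2`. -/
def totalResStar : Fml .como [] :=
  .all one (.all X (.all nat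
    (rhoGtHalf x2 ⊓ₗ ltR (twoNegR x0) x2 ⟶ₗ resIncl x0 x2 x1 (J x2 x1))))

/-- `partialRes` restricted to indices with `ρ̃ > -γ/2`. -/
def partialResStar : Fml .como [] :=
  .all one (.all X (.all nat
    (rhoGtHalf x2 ⊓ₗ ltR (twoNegR x0) x2 ⊓ₗ domJ x0 x2 x1 ⟶ₗ resIncl x0 x2 x1 (J x2 x1))))

/-- `anchorRes` restricted to indices with `ρ̃ > -γ/2`. -/
def anchorResStar : Fml .como [] :=
  .all one (.all nat (ltR (twoNegR x0) x1 ⊓ₗ rhoGtHalf x1 ⟶ₗ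
    resIncl x0 x1 (.con .cX) (J x1 (.con .cX))))

/-- Accretive operators with total resolvents, over normed spaces. -/
def sysV : Set (Fml .op []) := normedAx ∪ {chiLeOne, totalRes, accretive, gammaPos}
/-- Monotone operators with total resolvents, over inner product spaces. -/
def sysT : Set (Fml .op []) := innerAx ∪ {chiLeOne, totalRes, accretive, gammaPos}
/-- Comonotone operators with total resolvents. -/
def sysU : Set (Fml .como []) :=
  innerAx ∪ {chiLeOne, totalRes, comonotone, gammaPos, rhoGamma}
/-- Comonotone operators with total resolvents for the indices with `ρ̃ > -γ/2`. -/
def sysUStar : Set (Fml .como []) :=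
  innerAx ∪ {chiLeOne, totalResStar, comonotone, gammaPos, rhoGammaHalf}
/-- Accretive operators with partial resolvents. -/
def sysVp : Set (Fml .op []) :=
  normedAx ∪ {chiLeOne, partialRes, accretive, gammaPos, anchorRes}
/-- Monotone operators with partial resolvents. -/
def sysTp : Set (Fml .op []) :=
  innerAx ∪ {chiLeOne, partialRes, accretive, gammaPos, anchorRes}
/-- Comonotone operators with partial resolvents. -/
def sysUp : Set (Fml .como []) :=
  innerAx ∪ {chiLeOne, partialRes, comonotone, gammaPos, rhoGamma, anchorRes}
/-- Comonotone operators with partial resolvents for the indices with `ρ̃ > -γ/2`. -/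
def sysUpStar : Set (Fml .como []) :=
  innerAx ∪ {chiLeOne, partialResStar, comonotone, gammaPos, rhoGammaHalf, anchorResStar}

/-! ## The formalized properties of the resolvent -/

variable {Γ : Ctx}

/-- `J_λ x =_X J_γ ((γ/λ) x + (1 - γ/λ) J_λ x)`, for `λ > 2⁻ˡ`. -/
def resIdentity (l : Tm L Γ nat) (γ lam : Tm L Γ one) (x : Tm L Γ X) : Fml L Γ :=
  eqX (J lam x) (J γ (addX (smulX (divR l γ lam) x)
    (smulX (subR oneR (divR l γ lam)) (J lam x))))

/-- `‖x - J_γ x‖ ≤ (2 + γ/λ) ‖x - J_λ x‖`, for `λ > 2⁻ˡ`. -/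
def resBound (l : Tm L Γ nat) (γ lam : Tm L Γ one) (x : Tm L Γ X) : Fml L Γ :=
  leR (normX (subX x (J γ x)))
    (mulR (addR twoR (divR l γ lam)) (normX (subX x (J lam x))))

end Theories

end FinTypeArith

open FinTypeArith FinTypeArith.Ty

namespace FinTypeArith

/-! ## Substitution -/

section Substitution

variable {L : Lang}

/-! The mathematics behind the statement is short. Put `b = J_λ x` and `w = (γ/λ) x + (1 - γ/λ) b`.
Then `γ⁻¹ (w - b) = λ⁻¹ (x - b)`, and the right side lies in `A b`. So `b` and `J_γ w` both solve `p
+ γ u = w` with `u ∈ A p`. Nonexpansiveness (from accretivity, or from comonotonicity with `ρ̃ ≥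
-γ/2`) or a direct computation with comonotonicity (`ρ̃ > -γ`) shows that such a `p` is unique up to
`=_X`. For the bound, the nonexpansiveness inequality applied to `a = J_γ x` and `b` gives `‖a - b‖
≤ |1 - γ/λ| ‖x - b‖`, and the triangle inequality gives the rest (`Model.identity`, `Model.bound`).

The delicate point is that `A` need not respect `=_X`. With total resolvents this is harmless, since
only memberships supplied by the axioms are used. With partial resolvents the identity requires `w ∈
dom J_γ`, that is, `γ⁻¹ (w - b) ∈ A b`, where only `λ⁻¹ (x - b) ∈ A b` is known. The quantifier-free
extensionality rule bridges this gap: the equation of the two vectors is provable from `γ > 2⁻ᵏ` and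
`λ > 2⁻ˡ`, and these hypotheses become quantifier-free once the witnesses of the two strict
inequalities are free variables (`Model.smul_inv_combXS`).

No derivation is written out by hand. A fragment `Drv` of the calculus, without choice and with
recursion only at type `0`, is shown complete for a suitable class of models (`Drv.of_models`), so
that each claim becomes ordinary mathematics inside an arbitrary model. The models are Henkin term
models. Elements are terms modulo indiscernibility in contexts of type `0`; therefore equality of
type `0` is true equality, and an equation provable under a quantifier-free hypothesis becomes an
identity of elements whenever the hypothesis is true (`Model.ext`). Because the extensionality rule
applies only to theorems, hypotheses are carried as premises of implications and are never added to
the axioms.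

Inside a model, the natural numbers form an ordered semiring, generally nonstandard, so every
induction goes through a formula of the language. From it come an ordered field `Q` of rationals, an
ordered field `R` of limits of named regular sequences, and, after factoring type `X` by `=_X`, a
normed `R`-vector space `V`. In the comonotone case the identity `‖e + t d‖² = ‖e‖² + 2 t ⟨e, d⟩ +
t² ‖d‖²` is needed for all `t` in `R`; it is the Jordan–von Neumann argument carried out within the
model (`Model.norm_add_smul_sq`). -/

@[simp] theorem Tm.subst_var {Γ Δ : Ctx} {τ : Ty} (f : Sub L Γ Δ) (v : Var Γ τ) :
    (Tm.var v : Tm L Γ τ).subst f = f τ v := rfl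
@[simp] theorem Tm.subst_con {Γ Δ : Ctx} {τ : Ty} (f : Sub L Γ Δ) (c : Const L τ) :
    (Tm.con c : Tm L Γ τ).subst f = .con c := rfl
@[simp] theorem Tm.subst_app {Γ Δ : Ctx} {ρ τ : Ty} (f : Sub L Γ Δ) (t : Tm L Γ (ρ ⇒ τ))
    (u : Tm L Γ ρ) : (t ⬝ u).subst f = t.subst f ⬝ u.subst f := rfl
@[simp] theorem Tm.ren_var {Γ Δ : Ctx} {τ : Ty} (f : ∀ τ, Var Γ τ → Var Δ τ) (v : Var Γ τ) :
    (Tm.var v : Tm L Γ τ).ren f = .var (f τ v) := rfl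
@[simp] theorem Tm.ren_con {Γ Δ : Ctx} {τ : Ty} (f : ∀ τ, Var Γ τ → Var Δ τ) (c : Const L τ) :
    (Tm.con c : Tm L Γ τ).ren f = .con c := rfl
@[simp] theorem Tm.ren_app {Γ Δ : Ctx} {ρ τ : Ty} (f : ∀ τ, Var Γ τ → Var Δ τ)
    (t : Tm L Γ (ρ ⇒ τ)) (u : Tm L Γ ρ) : (t ⬝ u).ren f = t.ren f ⬝ u.ren f := rfl

theorem Tm.ren_eq_subst {Γ Δ : Ctx} (f : ∀ τ, Var Γ τ → Var Δ τ) {τ : Ty} (t : Tm L Γ τ) :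
    t.ren f = t.subst fun τ v => .var (f τ v) := by
  induction t with
  | var v => rfl
  | con c => rfl
  | app t u iht ihu => simp [iht, ihu]

theorem Tm.wk_eq_subst {Γ : Ctx} {σ τ : Ty} (t : Tm L Γ τ) :
    (t.wk : Tm L (σ :: Γ) τ) = t.subst fun _ v => .var (.s v) :=
  Tm.ren_eq_subst _ t

theorem Tm.subst_subst {Γ Δ Θ : Ctx} (f : Sub L Γ Δ) (g : Sub L Δ Θ) {τ : Ty} (t : Tm L Γ τ) :
    (t.subst f).subst g = t.subst fun τ v => (f τ v).subst g := by
  induction t with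
  | var v => rfl
  | con c => rfl
  | app t u iht ihu => simp [iht, ihu]

theorem Tm.subst_id {Γ : Ctx} {τ : Ty} (t : Tm L Γ τ) :
    t.subst (fun _ v => .var v) = t := by
  induction t with
  | var v => rfl
  | con c => rfl
  | app t u iht ihu => simp [iht, ihu]

@[simp] theorem Tm.wk_subst_inst {Γ : Ctx} {σ τ : Ty} (t : Tm L Γ τ) (a : Tm L Γ σ) :
    t.wk.subst (Sub.inst a) = t := by
  rw [Tm.wk_eq_subst, Tm.subst_subst]
  exact Tm.subst_id t

theorem Tm.wk_subst_lift {Γ Δ : Ctx} {σ τ : Ty} (t : Tm L Γ τ) (f : Sub L Γ Δ) :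
    t.wk.subst (Sub.lift (σ := σ) f) = (t.subst f).wk := by
  simp only [Tm.wk_eq_subst, Tm.subst_subst]
  congr 1; funext τ v
  exact Tm.wk_eq_subst _

theorem Sub.lift_id {Γ : Ctx} {σ : Ty} :
    (Sub.lift (fun _ v => .var v) : Sub L (σ :: Γ) (σ :: Γ)) = fun _ v => .var v := by
  funext τ v; cases v <;> rfl

theorem Sub.lift_comp {Γ Δ Θ : Ctx} {σ : Ty} (f : Sub L Γ Δ) (g : Sub L Δ Θ) :
    (Sub.lift (fun τ v => (f τ v).subst g) : Sub L (σ :: Γ) (σ :: Θ)) =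
      fun τ v => (Sub.lift f τ v).subst (Sub.lift g) := by
  funext τ v
  cases v with
  | z => rfl
  | s v => exact (Tm.wk_subst_lift _ _).symm

theorem Fml.subst_subst {Γ Δ Θ : Ctx} (f : Sub L Γ Δ) (g : Sub L Δ Θ) (A : Fml L Γ) :
    (A.subst f).subst g = A.subst fun τ v => (f τ v).subst g := by
  induction A generalizing Δ Θ with
  | eq s t => simp [Fml.subst, Tm.subst_subst]
  | and A B ihA ihB => simp [Fml.subst, ihA, ihB]
  | or A B ihA ihB => simp [Fml.subst, ihA, ihB]
  | imp A B ihA ihB => simp [Fml.subst, ihA, ihB]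
  | all σ A ih => simp [Fml.subst, ih, Sub.lift_comp]
  | ex σ A ih => simp [Fml.subst, ih, Sub.lift_comp]

theorem Fml.subst_id {Γ : Ctx} (A : Fml L Γ) : A.subst (fun _ v => .var v) = A := by
  induction A with
  | eq s t => simp [Fml.subst, Tm.subst_id]
  | and A B ihA ihB => simp [Fml.subst, ihA, ihB]
  | or A B ihA ihB => simp [Fml.subst, ihA, ihB]
  | imp A B ihA ihB => simp [Fml.subst, ihA, ihB]
  | all σ A ih => simp [Fml.subst, ih, Sub.lift_id]
  | ex σ A ih => simp [Fml.subst, ih, Sub.lift_id]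

@[simp] theorem Fml.wk_subst_inst {Γ : Ctx} {σ : Ty} (A : Fml L Γ) (a : Tm L Γ σ) :
    A.wk.subst (Sub.inst a) = A := by
  rw [Fml.wk, Fml.subst_subst]
  exact Fml.subst_id A

theorem Fml.wk_subst_lift {Γ Δ : Ctx} {σ : Ty} (A : Fml L Γ) (f : Sub L Γ Δ) :
    A.wk.subst (Sub.lift (σ := σ) f) = (A.subst f).wk := by
  simp only [Fml.wk, Fml.subst_subst]
  congr 1; funext τ v
  exact Tm.wk_eq_subst _

theorem Tm.subst_inst_subst {Γ Δ : Ctx} {σ τ : Ty} (t : Tm L (σ :: Γ) τ) (a : Tm L Γ σ)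
    (f : Sub L Γ Δ) :
    (t.subst (Sub.inst a)).subst f = (t.subst f.lift).subst (Sub.inst (a.subst f)) := by
  simp only [Tm.subst_subst]
  congr 1; funext τ v
  cases v with
  | z => rfl
  | s v => exact (Tm.wk_subst_inst _ _).symm

theorem Fml.subst_inst_subst {Γ Δ : Ctx} {σ : Ty} (A : Fml L (σ :: Γ)) (a : Tm L Γ σ)
    (f : Sub L Γ Δ) :
    (A.subst (Sub.inst a)).subst f = (A.subst f.lift).subst (Sub.inst (a.subst f)) := by
  simp only [Fml.subst_subst]
  congr 1; funext τ v
  cases v with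
  | z => rfl
  | s v => exact (Tm.wk_subst_inst _ _).symm

theorem Fml.subst_succSub_subst {Γ Δ : Ctx} (A : Fml L (nat :: Γ)) (f : Sub L Γ Δ) :
    (A.subst (succSub Γ)).subst f.lift = (A.subst f.lift).subst (succSub Δ) := by
  simp only [Fml.subst_subst]
  congr 1; funext τ v
  cases v with
  | z => rfl
  | s v =>
    change (f _ v).wk = (f _ v).wk.subst _
    simp only [Tm.wk_eq_subst, Tm.subst_subst]; rfl

theorem Fml.IsQF.subst {Γ Δ : Ctx} {A : Fml L Γ} (h : A.IsQF) (f : Sub L Γ Δ) :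
    (A.subst f).IsQF := by
  induction A generalizing Δ with
  | eq s t => trivial
  | and A B ihA ihB => exact ⟨ihA h.1 f, ihB h.2 f⟩
  | or A B ihA ihB => exact ⟨ihA h.1 f, ihB h.2 f⟩
  | imp A B ihA ihB => exact ⟨ihA h.1 f, ihB h.2 f⟩
  | all σ A ih => exact h.elim
  | ex σ A ih => exact h.elim

/-- Lifting of a renaming under a binder. -/
def liftRen {Γ Δ : Ctx} {σ : Ty} (f : ∀ τ, Var Γ τ → Var Δ τ) : ∀ τ, Var (σ :: Γ) τ → Var (σ :: Δ) τ
  | _, .z => .z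
  | _, .s v => .s (f _ v)

-- Renamings commute with `lam` on the nose, whereas substitutions do not: `lam` treats a variable
-- and a compound term not containing the bound variable differently.
@[simp] theorem Tm.ren_lam {Γ Δ : Ctx} {σ τ : Ty} (f : ∀ τ, Var Γ τ → Var Δ τ)
    (t : Tm L (σ :: Γ) τ) : t.lam.ren f = (t.ren (liftRen f)).lam := by
  induction t with
  | var v => cases v <;> rfl
  | con c => rfl
  | app t u iht ihu => simp [Tm.lam, iht, ihu]

/-- Each member of the family is a renaming of the one over the empty context, and all substitutions
out of the empty context agree. So stability under renaming, where `ren_lam` applies, is enough. -/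
theorem Tm.subst_of_ren {τ : Ty} (C : ∀ Γ, Tm L Γ τ)
    (h : ∀ (Γ Δ : Ctx) (f : ∀ τ, Var Γ τ → Var Δ τ), (C Γ).ren f = C Δ) {Γ Δ : Ctx}
    (f : Sub L Γ Δ) : (C Γ).subst f = C Δ := by
  rw [← h [] Γ (fun _ v => nomatch v), ← h [] Δ (fun _ v => nomatch v), Tm.ren_eq_subst,
    Tm.ren_eq_subst, Tm.subst_subst]
  congr 1; funext τ v; cases v

end Substitution

/-! ## Closed terms are stable under renaming and substitution -/

@[simp] theorem Tm.ren_natRec {L : Lang} {Γ Δ : Ctx} {ρ : Ty} (r : ∀ τ, Var Γ τ → Var Δ τ)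
    (n : Tm L Γ nat) (b : Tm L Γ ρ) (f : Tm L Γ (ρ ⇒ nat ⇒ ρ)) :
    (natRec n b f).ren r = natRec (n.ren r) (b.ren r) (f.ren r) := rfl

section ClosedTerms

variable {L : Lang} {Γ Δ : Ctx} (r : ∀ τ, Var Γ τ → Var Δ τ) (f : Sub L Γ Δ)

attribute [local simp] O S add mul pred sub ite pow2 dist search bmin pair half numPos
  numNeg den mkQ addQ negQ subQ absQ mulQ invQ maxQ minQ twoNegQ hat liftRen

@[simp] theorem ren_addC : (addC : Tm L Γ _).ren r = addC := by simp [addC]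
@[simp] theorem ren_mulC : (mulC : Tm L Γ _).ren r = mulC := by simp [mulC]
@[simp] theorem ren_predC : (predC : Tm L Γ _).ren r = predC := by simp [predC]
@[simp] theorem ren_subC : (subC : Tm L Γ _).ren r = subC := by simp [subC]
@[simp] theorem ren_iteC : (iteC : Tm L Γ _).ren r = iteC := by simp [iteC]
@[simp] theorem ren_pow2C : (pow2C : Tm L Γ _).ren r = pow2C := by simp [pow2C]
@[simp] theorem ren_distC : (distC : Tm L Γ _).ren r = distC := by simp [distC]
@[simp] theorem ren_searchC : (searchC : Tm L Γ _).ren r = searchC := by simp [searchC]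
@[simp] theorem ren_bminC : (bminC : Tm L Γ _).ren r = bminC := by simp [bminC]
@[simp] theorem ren_cantorC : (cantorC : Tm L Γ _).ren r = cantorC := by simp [cantorC]
@[simp] theorem ren_pairC : (pairC : Tm L Γ _).ren r = pairC := by simp [pairC]
@[simp] theorem ren_fstC : (fstC : Tm L Γ _).ren r = fstC := by simp [fstC]
@[simp] theorem ren_sndC : (sndC : Tm L Γ _).ren r = sndC := by simp [sndC]
@[simp] theorem ren_halfC : (halfC : Tm L Γ _).ren r = halfC := by simp [halfC]
@[simp] theorem ren_oddC : (oddC : Tm L Γ _).ren r = oddC := by simp [oddC]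
@[simp] theorem ren_posC : (posC : Tm L Γ _).ren r = posC := by simp [posC]
@[simp] theorem ren_negC : (negC : Tm L Γ _).ren r = negC := by simp [negC]
@[simp] theorem ren_denC : (denC : Tm L Γ _).ren r = denC := by simp [denC]
@[simp] theorem ren_mkQC : (mkQC : Tm L Γ _).ren r = mkQC := by simp [mkQC]
@[simp] theorem ren_addQC : (addQC : Tm L Γ _).ren r = addQC := by simp [addQC]
@[simp] theorem ren_negQC : (negQC : Tm L Γ _).ren r = negQC := by simp [negQC]
@[simp] theorem ren_absQC : (absQC : Tm L Γ _).ren r = absQC := by simp [absQC]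
@[simp] theorem ren_mulQC : (mulQC : Tm L Γ _).ren r = mulQC := by simp [mulQC]
@[simp] theorem ren_invQC : (invQC : Tm L Γ _).ren r = invQC := by simp [invQC]
@[simp] theorem ren_leQC : (leQC : Tm L Γ _).ren r = leQC := by simp [leQC]
@[simp] theorem ren_ltQC : (ltQC : Tm L Γ _).ren r = ltQC := by simp [ltQC]
@[simp] theorem ren_hatC : (hatC : Tm L Γ _).ren r = hatC := by simp [hatC]
@[simp] theorem ren_addRC : (addRC : Tm L Γ _).ren r = addRC := by simp [addRC]
@[simp] theorem ren_negRC : (negRC : Tm L Γ _).ren r = negRC := by simp [negRC]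
@[simp] theorem ren_absRC : (absRC : Tm L Γ _).ren r = absRC := by simp [absRC]
@[simp] theorem ren_mulShiftC : (mulShiftC : Tm L Γ _).ren r = mulShiftC := by simp [mulShiftC]
@[simp] theorem ren_mulRC : (mulRC : Tm L Γ _).ren r = mulRC := by simp [mulRC]
@[simp] theorem ren_invRC : (invRC : Tm L Γ _).ren r = invRC := by simp [invRC]

@[simp] theorem subst_addC : (addC : Tm L Γ _).subst f = addC :=
  Tm.subst_of_ren (fun _ => addC) (fun _ _ => ren_addC) f
@[simp] theorem subst_predC : (predC : Tm L Γ _).subst f = predC :=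
  Tm.subst_of_ren (fun _ => predC) (fun _ _ => ren_predC) f
@[simp] theorem subst_pow2C : (pow2C : Tm L Γ _).subst f = pow2C :=
  Tm.subst_of_ren (fun _ => pow2C) (fun _ _ => ren_pow2C) f
@[simp] theorem subst_pairC : (pairC : Tm L Γ _).subst f = pairC :=
  Tm.subst_of_ren (fun _ => pairC) (fun _ _ => ren_pairC) f
@[simp] theorem subst_addQC : (addQC : Tm L Γ _).subst f = addQC :=
  Tm.subst_of_ren (fun _ => addQC) (fun _ _ => ren_addQC) f
@[simp] theorem subst_negQC : (negQC : Tm L Γ _).subst f = negQC :=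
  Tm.subst_of_ren (fun _ => negQC) (fun _ _ => ren_negQC) f
@[simp] theorem subst_absQC : (absQC : Tm L Γ _).subst f = absQC :=
  Tm.subst_of_ren (fun _ => absQC) (fun _ _ => ren_absQC) f
@[simp] theorem subst_ltQC : (ltQC : Tm L Γ _).subst f = ltQC :=
  Tm.subst_of_ren (fun _ => ltQC) (fun _ _ => ren_ltQC) f
@[simp] theorem subst_hatC : (hatC : Tm L Γ _).subst f = hatC :=
  Tm.subst_of_ren (fun _ => hatC) (fun _ _ => ren_hatC) f

end ClosedTerms

/-! ### Defined equality under substitution. -/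

section

variable {L : Lang}

attribute [local simp] O S add mul pred sub ite pow2 dist search bmin pair half numPos
  numNeg den mkQ addQ negQ subQ absQ mulQ invQ maxQ minQ twoNegQ hat

theorem eqX_subst {Γ Δ : Ctx} (s t : Tm L Γ X) (f : Sub L Γ Δ) :
    (eqX s t).subst f = eqX (s.subst f) (t.subst f) := by
  simp [eqX, eqR, Fml.subst, ltQ, Tm.wk_subst_lift, normX, subX, addX, negX, zeroR, natR, ratR,
    Sub.lift]

theorem eqT_subst {Γ Δ : Ctx} {ρ : Ty} (s t : Tm L Γ ρ) (f : Sub L Γ Δ) :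
    (eqT s t).subst f = eqT (s.subst f) (t.subst f) := by
  induction ρ generalizing Γ Δ with
  | nat => rfl
  | X => exact eqX_subst s t f
  | arr ρ τ _ ih =>
    simp only [eqT, Fml.subst, ih, Tm.subst_app, Tm.wk_subst_lift]
    rfl

end

end FinTypeArith

namespace FinTypeArith

/-! ## A fragment of the calculus

`Drv` is `Proves` without the choice schemata and with recursion only at type `0`. -/

/-- Derivability without choice, and with recursion only for a single variable of type `0`. -/
inductive Drv {L : Lang} (T : Set (Fml L [])) : {Γ : Ctx} → Fml L Γ → Prop
  | ax {Γ : Ctx} {A : Fml L []} : A ∈ T → Drv T (A.closed Γ)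
  | mp {Γ : Ctx} {A B : Fml L Γ} : Drv T (A ⟶ₗ B) → Drv T A → Drv T B
  | impK {Γ : Ctx} (A B : Fml L Γ) : Drv T (A ⟶ₗ B ⟶ₗ A)
  | impS {Γ : Ctx} (A B C : Fml L Γ) :
      Drv T ((A ⟶ₗ B ⟶ₗ C) ⟶ₗ (A ⟶ₗ B) ⟶ₗ A ⟶ₗ C)
  | andI {Γ : Ctx} (A B : Fml L Γ) : Drv T (A ⟶ₗ B ⟶ₗ A ⊓ₗ B)
  | andL {Γ : Ctx} (A B : Fml L Γ) : Drv T (A ⊓ₗ B ⟶ₗ A)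
  | andR {Γ : Ctx} (A B : Fml L Γ) : Drv T (A ⊓ₗ B ⟶ₗ B)
  | orL {Γ : Ctx} (A B : Fml L Γ) : Drv T (A ⟶ₗ .or A B)
  | orR {Γ : Ctx} (A B : Fml L Γ) : Drv T (B ⟶ₗ .or A B)
  | orE {Γ : Ctx} (A B C : Fml L Γ) :
      Drv T ((A ⟶ₗ C) ⟶ₗ (B ⟶ₗ C) ⟶ₗ .or A B ⟶ₗ C)
  | efq {Γ : Ctx} (A : Fml L Γ) : Drv T (bot ⟶ₗ A)
  | em {Γ : Ctx} (A : Fml L Γ) : Drv T (.or A (neg A))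
  | allE {Γ : Ctx} {σ : Ty} (A : Fml L (σ :: Γ)) (t : Tm L Γ σ) :
      Drv T (.all σ A ⟶ₗ A.subst (Sub.inst t))
  | exI {Γ : Ctx} {σ : Ty} (A : Fml L (σ :: Γ)) (t : Tm L Γ σ) :
      Drv T (A.subst (Sub.inst t) ⟶ₗ .ex σ A)
  | allI {Γ : Ctx} {σ : Ty} {A : Fml L Γ} {B : Fml L (σ :: Γ)} :
      Drv T (A.wk ⟶ₗ B) → Drv T (A ⟶ₗ .all σ B)
  | exE {Γ : Ctx} {σ : Ty} {A : Fml L (σ :: Γ)} {B : Fml L Γ} :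
      Drv T (A ⟶ₗ B.wk) → Drv T (.ex σ A ⟶ₗ B)
  | eqRefl {Γ : Ctx} (s : Tm L Γ nat) : Drv T (.eq s s)
  | eqSymm {Γ : Ctx} (s t : Tm L Γ nat) : Drv T (.eq s t ⟶ₗ .eq t s)
  | eqTrans {Γ : Ctx} (s t u : Tm L Γ nat) : Drv T (.eq s t ⟶ₗ .eq t u ⟶ₗ .eq s u)
  | succNe {Γ : Ctx} (s : Tm L Γ nat) : Drv T (neg (.eq (S s) O))
  | succInj {Γ : Ctx} (s t : Tm L Γ nat) : Drv T (.eq (S s) (S t) ⟶ₗ .eq s t)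
  | ind {Γ : Ctx} (A : Fml L (nat :: Γ)) :
      Drv T (A.subst (Sub.inst O) ⟶ₗ .all nat (A ⟶ₗ A.subst (succSub Γ)) ⟶ₗ .all nat A)
  | piEq {Γ : Ctx} {ρ τ : Ty} (s : Tm L Γ ρ) (t : Tm L Γ τ) :
      Drv T (eqT (.con (.Pi ρ τ) ⬝ s ⬝ t) s)
  | sigmaEq {Γ : Ctx} {δ ρ τ : Ty} (s : Tm L Γ (δ ⇒ ρ ⇒ τ)) (t : Tm L Γ (δ ⇒ ρ)) (u : Tm L Γ δ) :
      Drv T (eqT (.con (.Sigma δ ρ τ) ⬝ s ⬝ t ⬝ u) (s ⬝ u ⬝ (t ⬝ u)))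
  | recZero {Γ : Ctx} (b : Tm L Γ nat) (f : Tm L Γ (nat ⇒ nat ⇒ nat)) :
      Drv T (.eq (natRec O b f) b)
  | recSucc {Γ : Ctx} (n b : Tm L Γ nat) (f : Tm L Γ (nat ⇒ nat ⇒ nat)) :
      Drv T (.eq (natRec (S n) b f) (f ⬝ natRec n b f ⬝ n))
  | qfER {Γ : Ctx} {ρ τ : Ty} {A : Fml L Γ} {s t : Tm L Γ ρ} (r : Tm L (ρ :: Γ) τ) :
      A.IsQF → Drv T (A ⟶ₗ eqT s t) →
      Drv T (A ⟶ₗ eqT (r.subst (Sub.inst s)) (r.subst (Sub.inst t)))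

namespace Drv

variable {L : Lang} {T : Set (Fml L [])}

theorem proves {Γ : Ctx} {A : Fml L Γ} (h : Drv T A) : Proves T A := by
  induction h with
  | ax h => exact .ax h
  | mp _ _ ih₁ ih₂ => exact .mp ih₁ ih₂
  | impK A B => exact .impK A B
  | impS A B C => exact .impS A B C
  | andI A B => exact .andI A B
  | andL A B => exact .andL A B
  | andR A B => exact .andR A B
  | orL A B => exact .orL A B
  | orR A B => exact .orR A B
  | orE A B C => exact .orE A B C
  | efq A => exact .efq A
  | em A => exact .em A
  | allE A t => exact .allE A t
  | exI A t => exact .exI A t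
  | allI _ ih => exact .allI ih
  | exE _ ih => exact .exE ih
  | eqRefl s => exact .eqRefl s
  | eqSymm s t => exact .eqSymm s t
  | eqTrans s t u => exact .eqTrans s t u
  | succNe s => exact .succNe s
  | succInj s t => exact .succInj s t
  | ind A => exact .ind A
  | piEq s t => exact .piEq s t
  | sigmaEq s t u => exact .sigmaEq s t u
  | recZero b f =>
    exact Proves.recZero [nat] nat .z (fun | _, .z => b) (fun | _, .z => f)
  | recSucc n b f =>
    exact Proves.recSucc [nat] nat .z n (fun | _, .z => b) (fun | _, .z => f)
  | qfER r hA _ ih => exact .qfER r hA ih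

/-- Free variables in a theorem are generic: the axioms are closed, and the schemata and rules, the
quantifier-free rule included, are stable under substitution. This is what allows variables to serve
as Henkin witnesses. -/
theorem subst {Γ : Ctx} {A : Fml L Γ} (h : Drv T A) {Δ : Ctx} (f : Sub L Γ Δ) :
    Drv T (A.subst f) := by
  induction h generalizing Δ with
  | @ax Γ A h =>
    have : (A.closed Γ).subst f = A.closed Δ := by
      rw [Fml.closed, Fml.closed, Fml.subst_subst]
      congr 1; funext τ v; cases v
    rw [this]; exact .ax h
  | mp _ _ ih₁ ih₂ => exact .mp (ih₁ f) (ih₂ f)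
  | impK A B => exact .impK _ _
  | impS A B C => exact .impS _ _ _
  | andI A B => exact .andI _ _
  | andL A B => exact .andL _ _
  | andR A B => exact .andR _ _
  | orL A B => exact .orL _ _
  | orR A B => exact .orR _ _
  | orE A B C => exact .orE _ _ _
  | efq A => exact .efq _
  | em A => exact .em _
  | allE A t =>
    rw [Fml.subst, Fml.subst_inst_subst]; exact .allE _ _
  | exI A t =>
    rw [Fml.subst, Fml.subst_inst_subst]; exact .exI _ _
  | allI _ ih =>
    have := ih (Sub.lift f)
    rw [Fml.subst, Fml.wk_subst_lift] at this
    exact .allI this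
  | exE _ ih =>
    have := ih (Sub.lift f)
    rw [Fml.subst, Fml.wk_subst_lift] at this
    exact .exE this
  | eqRefl s => exact .eqRefl _
  | eqSymm s t => exact .eqSymm _ _
  | eqTrans s t u => exact .eqTrans _ _ _
  | succNe s => exact .succNe _
  | succInj s t => exact .succInj _ _
  | ind A =>
    simp only [Fml.subst]
    rw [Fml.subst_inst_subst, Fml.subst_succSub_subst]
    exact .ind _
  | piEq s t => rw [eqT_subst]; exact .piEq _ _
  | sigmaEq s t u => rw [eqT_subst]; exact .sigmaEq _ _ _
  | recZero b g => exact .recZero _ _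
  | recSucc n b g => exact .recSucc _ _ _
  | qfER r hA _ ih =>
    have := ih f
    simp only [Fml.subst, eqT_subst] at this ⊢
    rw [Tm.subst_inst_subst, Tm.subst_inst_subst]
    exact .qfER _ (hA.subst f) this

variable {Γ : Ctx} {A B C H : Fml L Γ}

theorem imp_refl (A : Fml L Γ) : Drv T (A ⟶ₗ A) :=
  .mp (.mp (.impS A (A ⟶ₗ A) A) (.impK _ _)) (.impK _ _)

theorem const (H : Fml L Γ) (h : Drv T A) : Drv T (H ⟶ₗ A) := .mp (.impK _ _) h

theorem mp₁ (h : Drv T (H ⟶ₗ A ⟶ₗ B)) (h' : Drv T (H ⟶ₗ A)) : Drv T (H ⟶ₗ B) :=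
  .mp (.mp (.impS _ _ _) h) h'

theorem trans (h : Drv T (A ⟶ₗ B)) (h' : Drv T (B ⟶ₗ C)) : Drv T (A ⟶ₗ C) :=
  mp₁ (const A h') h

theorem and_intro (h : Drv T (H ⟶ₗ A)) (h' : Drv T (H ⟶ₗ B)) : Drv T (H ⟶ₗ A ⊓ₗ B) :=
  mp₁ (mp₁ (const H (.andI A B)) h) h'

theorem curry (h : Drv T (H ⊓ₗ A ⟶ₗ B)) : Drv T (H ⟶ₗ A ⟶ₗ B) :=
  trans (.andI H A) (.mp (.impS _ _ _) (const A h))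

/-- Case distinction on `A`. -/
theorem by_cases (A : Fml L Γ) (h₁ : Drv T (H ⊓ₗ A ⟶ₗ B)) (h₂ : Drv T (H ⊓ₗ neg A ⟶ₗ B)) :
    Drv T (H ⟶ₗ B) :=
  mp₁ (mp₁ (mp₁ (const H (.orE A (neg A) B)) (curry h₁)) (curry h₂)) (const H (.em A))

/-- A variable which does not occur in the formula is eliminated by instantiating it; this is where
inhabitedness of the type enters. -/
theorem of_wk {σ : Ty} (t : Tm L Γ σ) (h : Drv T (A.wk : Fml L (σ :: Γ))) : Drv T A := by
  have := h.subst (Sub.inst t)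
  rwa [Fml.wk_subst_inst] at this

end Drv

/-- A closed term of each type. -/
def Tm.default {L : Lang} {Γ : Ctx} : (τ : Ty) → Tm L Γ τ
  | .nat => .con .zero
  | .X => .con .zeroX
  | .arr ρ τ => .con (.Pi τ ρ) ⬝ Tm.default τ

namespace Drv

variable {L : Lang} {T : Set (Fml L [])} {Γ : Ctx}

/-- Adding a witness for an existential formula is conservative. -/
theorem not_henkin {σ : Ty} {H : Fml L Γ} {C : Fml L (σ :: Γ)}
    (h : Drv T (H.wk ⊓ₗ ((Fml.ex σ C).wk ⟶ₗ C) ⟶ₗ bot)) : Drv T (H ⟶ₗ bot) := by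
  -- If `C` holds, then the Henkin implication holds for this value of the variable.
  have hC : Drv T (C ⟶ₗ (H ⟶ₗ bot : Fml L Γ).wk) := by
    refine curry (trans (and_intro (.andR _ _) ?_) h)
    exact curry (trans (.andL _ _) (.andL _ _))
  have hex : Drv T (.ex σ C ⟶ₗ H ⟶ₗ bot) := exE hC
  refine by_cases (.ex σ C) (mp₁ (trans (.andR _ _) hex) (.andL _ _)) ?_
  -- If `∃ x C` fails, the Henkin implication is vacuous for any value, so the witness variable may
  -- be replaced by a closed term.
  refine of_wk (Tm.default σ) ?_
  change Drv T (H.wk ⊓ₗ neg (Fml.ex σ C).wk ⟶ₗ bot)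
  refine trans (and_intro (.andL _ _) (trans (.andR _ _) ?_)) h
  exact curry (trans (mp₁ (.andL _ _) (.andR _ _)) (.efq _))

end Drv

end FinTypeArith

namespace FinTypeArith

/-! ## Countability of the language -/

section Countability

def Ty.code : Ty → ℕ
  | .nat => 0
  | .X => 1
  | .arr ρ τ => Nat.pair ρ.code τ.code + 2

theorem Ty.code_injective : Function.Injective Ty.code := by
  intro ρ
  induction ρ with
  | nat => intro τ h; cases τ <;> simp [Ty.code] at h ⊢
  | X => intro τ h; cases τ <;> simp [Ty.code] at h ⊢
  | arr ρ₁ ρ₂ ih₁ ih₂ =>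
    intro τ h
    cases τ with
    | nat => simp [Ty.code] at h
    | X => simp [Ty.code] at h
    | arr τ₁ τ₂ =>
      simp only [Ty.code, Nat.add_right_cancel_iff, Nat.pair_eq_pair] at h
      rw [ih₁ h.1, ih₂ h.2]

instance : Countable Ty := Ty.code_injective.countable

def Var.index : {Γ : Ctx} → {τ : Ty} → Var Γ τ → ℕ
  | _, _, .z => 0
  | _, _, .s v => v.index + 1

instance {Γ : Ctx} {τ : Ty} : Countable (Var Γ τ) := by
  refine Function.Injective.countable (f := Var.index) fun v w h => ?_
  induction v with
  | z => cases w <;> simp [Var.index] at h ⊢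
  | s v ih =>
    cases w with
    | z => simp [Var.index] at h
    | s w => rw [ih w (by simpa [Var.index] using h)]

instance : Countable Lang :=
  Function.Injective.countable (f := fun L : Lang => match L with | .op => true | .como => false)
    fun L L' h => by cases L <;> cases L' <;> simp at h ⊢

/-- An enumeration of the constants without parameters. -/
def constEnum (L : Lang) : ℕ → Σ p : Lang × Ty, Const p.1 p.2
  | 0 => ⟨(L, _), .zero⟩
  | 1 => ⟨(L, _), .succ⟩
  | 2 => ⟨(L, _), .zeroX⟩
  | 3 => ⟨(L, _), .oneX⟩
  | 4 => ⟨(L, _), .addX⟩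
  | 5 => ⟨(L, _), .negX⟩
  | 6 => ⟨(L, _), .smulX⟩
  | 7 => ⟨(L, _), .normX⟩
  | 8 => ⟨(L, _), .chiA⟩
  | 9 => ⟨(L, _), .resA⟩
  | 10 => ⟨(L, _), .gammaT⟩
  | 11 => ⟨(L, _), .mT⟩
  | 12 => ⟨(L, _), .cX⟩
  | 13 => ⟨(.como, _), .rhoT⟩
  | _ => ⟨(.como, _), .nT⟩

/-- Language and type are both part of the index, so that one family of enumerations covers all
constructors, including those which exist only for `.como`. -/
theorem countable_sigma_const : Countable (Σ p : Lang × Ty, Const p.1 p.2) := by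
  rw [← Set.countable_univ_iff]
  refine Set.Countable.mono ?_ ((((Set.countable_range fun q : Lang × ℕ =>
      constEnum q.1 q.2).union
    (Set.countable_range fun q : Lang × Ty × Ty =>
      (⟨(q.1, _), .Pi q.2.1 q.2.2⟩ : Σ p : Lang × Ty, Const p.1 p.2))).union
    (Set.countable_range fun q : Lang × Ty × Ty × Ty =>
      (⟨(q.1, _), .Sigma q.2.1 q.2.2.1 q.2.2.2⟩ : Σ p : Lang × Ty, Const p.1 p.2))).union
    (Set.countable_range fun q : Lang × Σ ρs : List Ty, Σ τ : Ty, Var ρs τ =>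
      (⟨(q.1, _), .recr q.2.1 q.2.2.1 q.2.2.2⟩ : Σ p : Lang × Ty, Const p.1 p.2)))
  rintro ⟨⟨L, τ⟩, c⟩ -
  cases c with
  | Pi ρ τ => exact .inl (.inl (.inr ⟨(L, ρ, τ), rfl⟩))
  | Sigma δ ρ τ => exact .inl (.inr ⟨(L, δ, ρ, τ), rfl⟩)
  | recr ρs τ i => exact .inr ⟨(L, ⟨ρs, τ, i⟩), rfl⟩
  | zero => exact .inl (.inl (.inl ⟨(L, 0), rfl⟩))
  | succ => exact .inl (.inl (.inl ⟨(L, 1), rfl⟩))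
  | zeroX => exact .inl (.inl (.inl ⟨(L, 2), rfl⟩))
  | oneX => exact .inl (.inl (.inl ⟨(L, 3), rfl⟩))
  | addX => exact .inl (.inl (.inl ⟨(L, 4), rfl⟩))
  | negX => exact .inl (.inl (.inl ⟨(L, 5), rfl⟩))
  | smulX => exact .inl (.inl (.inl ⟨(L, 6), rfl⟩))
  | normX => exact .inl (.inl (.inl ⟨(L, 7), rfl⟩))
  | chiA => exact .inl (.inl (.inl ⟨(L, 8), rfl⟩))
  | resA => exact .inl (.inl (.inl ⟨(L, 9), rfl⟩))
  | gammaT => exact .inl (.inl (.inl ⟨(L, 10), rfl⟩))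
  | mT => exact .inl (.inl (.inl ⟨(L, 11), rfl⟩))
  | cX => exact .inl (.inl (.inl ⟨(L, 12), rfl⟩))
  | rhoT => exact .inl (.inl (.inl ⟨(.como, 13), rfl⟩))
  | nT => exact .inl (.inl (.inl ⟨(.como, 14), rfl⟩))

instance {L : Lang} : Countable (Σ τ, Const L τ) := by
  have := countable_sigma_const
  refine Function.Injective.countable (β := Σ p : Lang × Ty, Const p.1 p.2)
    (f := fun c => ⟨(L, c.1), c.2⟩) ?_
  rintro ⟨τ, c⟩ ⟨τ', c'⟩ h
  simp only [Sigma.mk.injEq, Prod.mk.injEq, true_and] at h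
  obtain ⟨rfl, h⟩ := h
  simp only [heq_eq_eq] at h
  rw [h]

variable {L : Lang}

noncomputable def Tm.code {Γ : Ctx} : {τ : Ty} → Tm L Γ τ → ℕ
  | τ, .var v => Nat.pair 0 ((exists_injective_nat (Σ τ, Var Γ τ)).choose ⟨τ, v⟩)
  | τ, .con c => Nat.pair 1 ((exists_injective_nat (Σ τ, Const L τ)).choose ⟨τ, c⟩)
  | _, .app t u => Nat.pair 2 (Nat.pair t.code u.code)

/-- The two terms may have different types: the type of the argument of an application is not
visible in the type of the result, so the induction has to recover it from the codes. -/
theorem Tm.code_injective {Γ : Ctx} {τ τ' : Ty} (t : Tm L Γ τ) (t' : Tm L Γ τ')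
    (h : t.code = t'.code) : (⟨τ, t⟩ : Σ τ, Tm L Γ τ) = ⟨τ', t'⟩ := by
  induction t generalizing τ' with
  | var v =>
    cases t' <;> simp [Tm.code] at h
    have := (exists_injective_nat (Σ τ, Var Γ τ)).choose_spec h
    simp only [Sigma.mk.injEq] at this
    obtain ⟨rfl, h⟩ := this
    simp only [heq_eq_eq] at h
    rw [h]
  | con c =>
    cases t' <;> simp [Tm.code] at h
    have := (exists_injective_nat (Σ τ, Const L τ)).choose_spec h
    simp only [Sigma.mk.injEq] at this
    obtain ⟨rfl, h⟩ := this
    simp only [heq_eq_eq] at h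
    rw [h]
  | app t u iht ihu =>
    cases t' with
    | var v => simp [Tm.code] at h
    | con c => simp [Tm.code] at h
    | app t' u' =>
      simp only [Tm.code, Nat.pair_eq_pair, true_and] at h
      have h₁ := iht t' h.1
      have h₂ := ihu u' h.2
      simp only [Sigma.mk.injEq] at h₁ h₂
      obtain ⟨rfl, h₂⟩ := h₂
      obtain ⟨h₁, h₃⟩ := h₁
      simp only [Ty.arr.injEq, true_and] at h₁
      subst h₁
      simp only [heq_eq_eq] at h₂ h₃
      rw [h₂, h₃]

instance {Γ : Ctx} {τ : Ty} : Countable (Tm L Γ τ) :=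
  Function.Injective.countable (f := Tm.code) fun t t' h => by
    have := Tm.code_injective t t' h
    simpa using this

noncomputable def Fml.code : {Γ : Ctx} → Fml L Γ → ℕ
  | Γ, .eq s t => Nat.pair 0 ((exists_injective_nat (Tm L Γ nat × Tm L Γ nat)).choose (s, t))
  | _, .and A B => Nat.pair 1 (Nat.pair A.code B.code)
  | _, .or A B => Nat.pair 2 (Nat.pair A.code B.code)
  | _, .imp A B => Nat.pair 3 (Nat.pair A.code B.code)
  | _, .all σ A => Nat.pair 4 (Nat.pair σ.code A.code)
  | _, .ex σ A => Nat.pair 5 (Nat.pair σ.code A.code)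

theorem Fml.code_injective {Γ : Ctx} : Function.Injective (Fml.code : Fml L Γ → ℕ) := by
  intro A
  induction A with
  | @eq Γ s t =>
    intro B h
    cases B <;> simp [Fml.code] at h
    simpa using (exists_injective_nat (Tm L Γ nat × Tm L Γ nat)).choose_spec h
  | and A₁ A₂ ih₁ ih₂ =>
    intro B h
    cases B <;> simp [Fml.code] at h
    rw [ih₁ h.1, ih₂ h.2]
  | or A₁ A₂ ih₁ ih₂ =>
    intro B h
    cases B <;> simp [Fml.code] at h
    rw [ih₁ h.1, ih₂ h.2]
  | imp A₁ A₂ ih₁ ih₂ =>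
    intro B h
    cases B <;> simp [Fml.code] at h
    rw [ih₁ h.1, ih₂ h.2]
  | all σ A ih =>
    intro B h
    cases B <;> simp [Fml.code] at h
    obtain ⟨h₁, h₂⟩ := h
    cases Ty.code_injective h₁
    rw [ih h₂]
  | ex σ A ih =>
    intro B h
    cases B <;> simp [Fml.code] at h
    obtain ⟨h₁, h₂⟩ := h
    cases Ty.code_injective h₁
    rw [ih h₂]

instance {Γ : Ctx} : Countable (Fml L Γ) := Fml.code_injective.countable

instance {Γ : Ctx} : Nonempty (Fml L Γ) := ⟨bot⟩

end Countability

/-! ## The Henkin construction -/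

theorem exists_surjective_ty : ∃ f : ℕ → Ty, Function.Surjective f :=
  haveI : Nonempty Ty := ⟨.nat⟩
  exists_surjective_nat Ty

namespace Henkin

noncomputable def tyEnum : ℕ → Ty := exists_surjective_ty.choose

noncomputable def fmlEnum {L : Lang} (Γ : Ctx) : ℕ → Fml L Γ :=
  (exists_surjective_nat (Fml L Γ)).choose

/-- The type of the witness added at stage `n`. -/
noncomputable def wit (n : ℕ) : Ty := tyEnum n.unpair.2.unpair.1

/-- The context of stage `n`. -/
noncomputable def ctx (Γ : Ctx) : ℕ → Ctx
  | 0 => Γ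
  | n + 1 => wit n :: ctx Γ n

variable {Γ : Ctx}

/-- The variables of stage `n`, in the next stage. -/
noncomputable def nextVar {n : ℕ} {τ : Ty} (v : Var (ctx Γ n) τ) : Var (ctx Γ (n + 1)) τ :=
  (.s v : Var (wit n :: ctx Γ n) τ)

noncomputable def upVar {n m : ℕ} (h : n ≤ m) {τ : Ty} (v : Var (ctx Γ n) τ) : Var (ctx Γ m) τ :=
  Nat.leRecOn (C := fun k => Var (ctx Γ k) τ) h nextVar v

variable {L : Lang}

/-- The inclusion of the terms of stage `n` in those of stage `m`. -/
noncomputable def up {n m : ℕ} (h : n ≤ m) : Sub L (ctx Γ n) (ctx Γ m) :=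
  fun _ v => .var (upVar h v)

theorem up_self (n : ℕ) : (up le_rfl : Sub L (ctx Γ n) (ctx Γ n)) = fun _ v => .var v := by
  funext τ v
  rw [up, upVar, Nat.leRecOn_self]

theorem up_succ (n : ℕ) :
    (up (Nat.le_succ n) : Sub L (ctx Γ n) (ctx Γ (n + 1))) = fun _ v => .var (nextVar v) := by
  funext τ v
  rw [up, upVar, Nat.leRecOn_succ']

theorem up_up {n m k : ℕ} (h : n ≤ m) (h' : m ≤ k) {τ : Ty} (v : Var (ctx Γ n) τ) :
    (up h τ v : Tm L _ _).subst (up h') = up (h.trans h') τ v := by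
  simp only [up, Tm.subst_var]
  rw [upVar, upVar, upVar, Nat.leRecOn_trans h h']

@[simp] theorem tm_up_up {n m k : ℕ} (h : n ≤ m) (h' : m ≤ k) {τ : Ty} (t : Tm L (ctx Γ n) τ) :
    (t.subst (up h)).subst (up h') = t.subst (up (h.trans h')) := by
  rw [Tm.subst_subst]; congr 1; funext τ v; exact up_up h h' v

@[simp] theorem fml_up_up {n m k : ℕ} (h : n ≤ m) (h' : m ≤ k) (A : Fml L (ctx Γ n)) :
    (A.subst (up h)).subst (up h') = A.subst (up (h.trans h')) := by
  rw [Fml.subst_subst]; congr 1; funext τ v; exact up_up h h' v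

/-- Consistency of a formula. -/
def Con (T : Set (Fml L [])) {Γ : Ctx} (H : Fml L Γ) : Prop := ¬ Drv T (H ⟶ₗ bot)

open Classical in
/-- Decides the formula `B`. -/
noncomputable def decided (T : Set (Fml L [])) {Γ : Ctx} (H B : Fml L Γ) : Fml L Γ :=
  if Con T (H ⊓ₗ B) then H ⊓ₗ B else H ⊓ₗ neg B

/-- Adds the innermost variable as a witness for `∃ x C`. -/
def witnessed {Γ : Ctx} {σ : Ty} (D : Fml L Γ) (C : Fml L (σ :: Γ)) : Fml L (σ :: Γ) :=
  D.wk ⊓ₗ ((Fml.ex σ C).wk ⟶ₗ C)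

variable {T : Set (Fml L [])}

theorem con_decided {Γ : Ctx} {H : Fml L Γ} (hH : Con T H) (B : Fml L Γ) :
    Con T (decided T H B) := by
  unfold decided
  split_ifs with h
  · exact h
  · intro h'
    exact hH (.by_cases B (not_not.1 h) h')

theorem decided_imp {Γ : Ctx} (H B : Fml L Γ) : Drv T (decided T H B ⟶ₗ H) := by
  unfold decided
  split_ifs <;> exact .andL _ _

theorem decided_or {Γ : Ctx} (H B : Fml L Γ) :
    Drv T (decided T H B ⟶ₗ B) ∨ Drv T (decided T H B ⟶ₗ neg B) := by
  unfold decided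
  split_ifs
  · exact .inl (.andR _ _)
  · exact .inr (.andR _ _)

variable (T)

/-- The approximation to the complete theory at stage `n`. -/
noncomputable def stage (H : Fml L Γ) : (n : ℕ) → Fml L (ctx Γ n)
  | 0 => H
  -- `n` codes a triple: a stage `n.unpair.1 ≤ n` in whose context the formula lives, a type for the
  -- witness, and a place in the enumeration of formulas. The same triple selects a formula to be
  -- decided and a formula with one more variable to be witnessed.
  | n + 1 => witnessed
      (decided T (stage H n)
        ((fmlEnum (ctx Γ n.unpair.1) n.unpair.2.unpair.2).subst (up n.unpair_left_le)))
      ((fmlEnum (wit n :: ctx Γ n.unpair.1) n.unpair.2.unpair.2).subst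
        (Sub.lift (up n.unpair_left_le)))

variable {T} {H : Fml L Γ}

theorem con_stage (hH : Con T H) (n : ℕ) : Con T (stage T H n) := by
  induction n with
  | zero => exact hH
  | succ n ih => exact fun h => con_decided ih _ (Drv.not_henkin h)

theorem stage_succ_imp (n : ℕ) {A : Fml L (ctx Γ n)}
    (h : Drv T (decided T (stage T H n) ((fmlEnum (ctx Γ n.unpair.1) n.unpair.2.unpair.2).subst
      (up n.unpair_left_le)) ⟶ₗ A)) :
    Drv T (stage T H (n + 1) ⟶ₗ A.subst (up (Nat.le_succ n))) := by
  rw [up_succ]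
  exact Drv.trans (.andL _ _) (h.subst _)

theorem stage_mono {n m : ℕ} (h : n ≤ m) :
    Drv T (stage T H m ⟶ₗ (stage T H n).subst (up h)) := by
  induction m, h using Nat.le_induction with
  | base => rw [up_self, Fml.subst_id]; exact Drv.imp_refl _
  | succ m h ih =>
    have h₁ := stage_succ_imp m (decided_imp (T := T) (stage T H m) _)
    have h₂ := ih.subst (up (Nat.le_succ m))
    rw [Fml.subst, fml_up_up] at h₂
    exact h₁.trans h₂

/-- Membership in the complete theory. -/
def Tr (T : Set (Fml L [])) (H : Fml L Γ) (n : ℕ) (A : Fml L (ctx Γ n)) : Prop :=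
  ∃ (m : ℕ) (h : n ≤ m), Drv T (stage T H m ⟶ₗ A.subst (up h))

theorem Tr.later {n m k : ℕ} {A : Fml L (ctx Γ n)} (h : n ≤ m) (hmk : m ≤ k)
    (hA : Drv T (stage T H m ⟶ₗ A.subst (up h))) :
    Drv T (stage T H k ⟶ₗ A.subst (up (h.trans hmk))) := by
  have := hA.subst (up hmk)
  rw [Fml.subst, fml_up_up] at this
  exact (stage_mono hmk).trans this

/-- `Tr` already looks at all later stages, so the stage at which a formula is read does not matter.
-/
theorem tr_up {n m : ℕ} (h : n ≤ m) (A : Fml L (ctx Γ n)) :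
    Tr T H m (A.subst (up h)) ↔ Tr T H n A := by
  constructor
  · rintro ⟨k, hk, hA⟩
    rw [fml_up_up] at hA
    exact ⟨k, h.trans hk, hA⟩
  · rintro ⟨k, hk, hA⟩
    refine ⟨max m k, le_max_left _ _, ?_⟩
    rw [fml_up_up]
    exact Tr.later hk (le_max_right _ _) hA

theorem tr_of_drv {n : ℕ} {A : Fml L (ctx Γ n)} (h : Drv T A) : Tr T H n A :=
  ⟨n, le_rfl, Drv.const _ (h.subst _)⟩

theorem Tr.mp {n : ℕ} {A B : Fml L (ctx Γ n)} (h : Tr T H n (A ⟶ₗ B)) (hA : Tr T H n A) :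
    Tr T H n B := by
  obtain ⟨m, hm, h⟩ := h
  obtain ⟨k, hk, hA⟩ := hA
  exact ⟨max m k, hm.trans (le_max_left _ _), Drv.mp₁ (Tr.later hm (le_max_left _ _) h)
    (Tr.later hk (le_max_right _ _) hA)⟩

theorem tr_or_tr_neg {n : ℕ} (A : Fml L (ctx Γ n)) : Tr T H n A ∨ Tr T H n (neg A) := by
  obtain ⟨k, hk⟩ := (exists_surjective_nat (Fml L (ctx Γ n))).choose_spec A
  -- The stage is a variable here because `n` and the decoded stage are only propositionally equal,
  -- while the type of the formula depends on it.
  have key : ∀ (N n' : ℕ) (A' : Fml L (ctx Γ n')), n' = N.unpair.1 →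
      fmlEnum (ctx Γ n') N.unpair.2.unpair.2 = A' → Tr T H n' A' ∨ Tr T H n' (neg A') := by
    rintro N n' A' rfl rfl
    rw [← tr_up N.unpair_left_le, ← tr_up N.unpair_left_le]
    exact (decided_or (T := T) (stage T H N) _).imp (fun h => ⟨N + 1, _, stage_succ_imp N h⟩)
      fun h => ⟨N + 1, _, stage_succ_imp N h⟩
  exact key (Nat.pair n (Nat.pair 0 k)) n A (by simp)
    (by simpa [fmlEnum] using hk)

theorem not_tr_bot (hH : Con T H) {n : ℕ} : ¬ Tr T H n bot := by
  rintro ⟨m, _, hm⟩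
  exact con_stage hH m hm

theorem tr_neg (hH : Con T H) {n : ℕ} (A : Fml L (ctx Γ n)) :
    Tr T H n (neg A) ↔ ¬ Tr T H n A :=
  ⟨fun h h' => not_tr_bot hH (h.mp h'), fun h => (tr_or_tr_neg A).resolve_left h⟩

/-- The witness is the variable added at the stage whose number codes this existential formula. The
Henkin implication is part of that stage, and modus ponens inside `Tr` yields the instance. -/
theorem tr_ex {n : ℕ} {σ : Ty} {C : Fml L (σ :: ctx Γ n)} (h : Tr T H n (.ex σ C)) :
    ∃ (m : ℕ) (hm : n ≤ m) (t : Tm L (ctx Γ m) σ),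
      Tr T H m ((C.subst (Sub.lift (up hm))).subst (Sub.inst t)) := by
  obtain ⟨j, rfl⟩ : ∃ j, tyEnum j = σ := exists_surjective_ty.choose_spec σ
  obtain ⟨k, hk⟩ := (exists_surjective_nat (Fml L (tyEnum j :: ctx Γ n))).choose_spec C
  have key : ∀ (N n' : ℕ) (σ' : Ty) (C' : Fml L (σ' :: ctx Γ n')), n' = N.unpair.1 → σ' = wit N →
      fmlEnum (σ' :: ctx Γ n') N.unpair.2.unpair.2 = C' → Tr T H n' (.ex σ' C') →
      ∃ (m : ℕ) (hm : n' ≤ m) (t : Tm L (ctx Γ m) σ'),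
        Tr T H m ((C'.subst (Sub.lift (up hm))).subst (Sub.inst t)) := by
    rintro N n' σ' C' rfl rfl rfl h
    refine ⟨N + 1, N.unpair_left_le.trans (Nat.le_succ N), .var .z, ?_⟩
    have h₁ : Tr T H (N + 1) ((Fml.ex (wit N) ((fmlEnum (wit N :: ctx Γ N.unpair.1)
        N.unpair.2.unpair.2).subst (Sub.lift (up N.unpair_left_le)))).wk ⟶ₗ
        ((fmlEnum (wit N :: ctx Γ N.unpair.1) N.unpair.2.unpair.2).subst
        (Sub.lift (up N.unpair_left_le)))) := by
      refine ⟨N + 1, le_rfl, ?_⟩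
      rw [up_self, Fml.subst_id]
      exact Drv.andR _ _
    have h₂ := (tr_up (N.unpair_left_le.trans (Nat.le_succ N)) _).2 h
    rw [← fml_up_up N.unpair_left_le (Nat.le_succ N), up_succ] at h₂
    have h₃ := h₁.mp h₂
    convert h₃ using 1
    simp only [Fml.subst_subst]
    congr 1; funext τ v
    cases v with
    | z => rfl
    | s v =>
      refine (Tm.wk_subst_inst _ _).trans ?_
      rw [← up_up N.unpair_left_le (Nat.le_succ N), up_succ]
      rfl
  exact key (Nat.pair n (Nat.pair j k)) n _ C (by simp) (by simp [wit])
    (by simpa [fmlEnum] using hk) h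

end Henkin

end FinTypeArith

namespace FinTypeArith

/-! ## Interpretations and models -/

/-- An interpretation of the language, in which equality of type `0` is true equality. -/
structure Interp (L : Lang) where
  carrier : Ty → Type
  app {ρ τ : Ty} : carrier (ρ ⇒ τ) → carrier ρ → carrier τ
  con {τ : Ty} : Const L τ → carrier τ

namespace Interp

variable {L : Lang} (I : Interp L)

/-- Valuations of the variables of a context. -/
abbrev Env (Γ : Ctx) := ∀ τ, Var Γ τ → I.carrier τ

variable {I}

def nil : I.Env [] := fun _ v => nomatch v

/-- Extension of a valuation by a value for the innermost variable. -/
def cons {Γ : Ctx} {σ : Ty} (a : I.carrier σ) (e : I.Env Γ) : I.Env (σ :: Γ)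
  | _, .z => a
  | _, .s v => e _ v

infixr:67 " ∷ " => Interp.cons

variable (I)

def eval {Γ : Ctx} (e : I.Env Γ) : {τ : Ty} → Tm L Γ τ → I.carrier τ
  | _, .var v => e _ v
  | _, .con c => I.con c
  | _, .app t u => I.app (eval e t) (eval e u)

def Sat : {Γ : Ctx} → I.Env Γ → Fml L Γ → Prop
  | _, e, .eq s t => I.eval e s = I.eval e t
  | _, e, .and A B => Sat e A ∧ Sat e B
  | _, e, .or A B => Sat e A ∨ Sat e B
  | _, e, .imp A B => Sat e A → Sat e B
  | _, e, .all _ A => ∀ a, Sat (cons a e) A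
  | _, e, .ex _ A => ∃ a, Sat (cons a e) A

end Interp

theorem Fml.isQF_eq {L : Lang} {Γ : Ctx} (s t : Tm L Γ nat) : (Fml.eq s t).IsQF := trivial

/-- A model of `T`; provable equality under a quantifier-free hypothesis is interpreted by equality
in all types. -/
structure Model {L : Lang} (T : Set (Fml L [])) extends Interp L where
  sound {Γ : Ctx} {A : Fml L Γ} : Drv T A → ∀ e : toInterp.Env Γ, toInterp.Sat e A
  ext {Γ : Ctx} {ρ : Ty} {A : Fml L Γ} {s t : Tm L Γ ρ} : A.IsQF → Drv T (A ⟶ₗ eqT s t) →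
    ∀ e : toInterp.Env Γ, toInterp.Sat e A → toInterp.eval e s = toInterp.eval e t
  zero_ne_one : con .zero ≠ app (con .succ) (con .zero)

/-- Extension of a substitution by a term for the innermost variable. -/
def Sub.cons {L : Lang} {Γ Δ : Ctx} {σ : Ty} (t : Tm L Δ σ) (f : Sub L Γ Δ) : Sub L (σ :: Γ) Δ
  | _, .z => t
  | _, .s v => f _ v

/-! ### The term model of the complete theory. -/

namespace Henkin

variable {L : Lang} {T : Set (Fml L [])} {Γ : Ctx} {H : Fml L Γ}

variable (L Γ) in
/-- The terms of all stages. -/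
abbrev Pre (τ : Ty) := Σ n, Tm L (ctx Γ n) τ

variable (T H) in
/-- Two terms are identified if they are so in all contexts of type `0`. -/
def Rel {τ : Ty} (x y : Pre L Γ τ) : Prop :=
  ∀ (k : ℕ) (hx : x.1 ≤ k) (hy : y.1 ≤ k) (r : Tm L (τ :: ctx Γ k) nat),
    Tr T H k (.eq (r.subst (Sub.inst (x.2.subst (up hx))))
      (r.subst (Sub.inst (y.2.subst (up hy)))))

theorem Tr.eq_trans {n : ℕ} {s t u : Tm L (ctx Γ n) nat} (h : Tr T H n (.eq s t))
    (h' : Tr T H n (.eq t u)) : Tr T H n (.eq s u) :=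
  ((tr_of_drv (.eqTrans s t u)).mp h).mp h'

theorem Tr.eq_symm {n : ℕ} {s t : Tm L (ctx Γ n) nat} (h : Tr T H n (.eq s t)) :
    Tr T H n (.eq t s) := (tr_of_drv (.eqSymm s t)).mp h

/-- A context of stage `k` can be lifted to a later stage. Transitivity needs this, since the middle
term may live beyond the stages of the outer two. -/
theorem rel_of_rel_up {τ : Ty} {x y : Pre L Γ τ} (N : ℕ)
    (h : ∀ (k : ℕ) (hx : x.1 ≤ k) (hy : y.1 ≤ k) (_ : N ≤ k) (r : Tm L (τ :: ctx Γ k) nat),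
      Tr T H k (.eq (r.subst (Sub.inst (x.2.subst (up hx))))
        (r.subst (Sub.inst (y.2.subst (up hy)))))) : Rel T H x y := by
  intro k hx hy r
  have := h (max k N) (hx.trans (le_max_left _ _)) (hy.trans (le_max_left _ _)) (le_max_right _ _)
    (r.subst (Sub.lift (up (le_max_left k N))))
  rw [← tr_up (le_max_left k N), Fml.subst, Tm.subst_inst_subst, Tm.subst_inst_subst, tm_up_up,
    tm_up_up]
  exact this

theorem rel_equivalence {τ : Ty} : Equivalence (Rel T H (τ := τ)) where
  refl _ _ _ _ _ := tr_of_drv (.eqRefl _)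
  symm h k hx hy r := (h k hy hx r).eq_symm
  trans {_ y _} h h' := rel_of_rel_up y.1 fun k hx hz hy r =>
    (h k hx hy r).eq_trans (h' k hy hz r)

variable (T H) in
def preSetoid (τ : Ty) : Setoid (Pre L Γ τ) := ⟨Rel T H, rel_equivalence⟩

noncomputable def preApp {ρ τ : Ty} (x : Pre L Γ (ρ ⇒ τ)) (y : Pre L Γ ρ) : Pre L Γ τ :=
  ⟨max x.1 y.1, x.2.subst (up (le_max_left _ _)) ⬝ y.2.subst (up (le_max_right _ _))⟩

/-- The function is exchanged first and the argument second: `r[a b]` is a context in `a` with `b`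
fixed, and a context in `b` with `a` fixed. -/
theorem preApp_rel {ρ τ : Ty} {x x' : Pre L Γ (ρ ⇒ τ)} {y y' : Pre L Γ ρ} (hx : Rel T H x x')
    (hy : Rel T H y y') : Rel T H (preApp x y) (preApp x' y') := by
  intro k h h' r
  have h₁ : x.1 ≤ k := (le_max_left _ _).trans h
  have h₂ : y.1 ≤ k := (le_max_right _ _).trans h
  have h₃ : x'.1 ≤ k := (le_max_left _ _).trans h'
  have h₄ : y'.1 ≤ k := (le_max_right _ _).trans h'
  have key₁ := hx k h₁ h₃ (r.subst (Sub.cons (.var .z ⬝ (y.2.subst (up h₂)).wk) fun _ v => .var (.s v)))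
  have key₂ := hy k h₂ h₄ (r.subst (Sub.cons ((x'.2.subst (up h₃)).wk ⬝ .var .z) fun _ v => .var (.s v)))
  have e₁ : ∀ (a : Tm L (ctx Γ k) (ρ ⇒ τ)) (b : Tm L (ctx Γ k) ρ), (r.subst
      (Sub.cons (.var .z ⬝ b.wk) fun _ v => .var (.s v))).subst (Sub.inst a) =
      r.subst (Sub.inst (a ⬝ b)) := by
    intro a b
    rw [Tm.subst_subst]; congr 1; funext σ v
    cases v with
    | z => exact congrArg₂ Tm.app rfl (Tm.wk_subst_inst _ _)
    | s v => rfl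
  have e₂ : ∀ (a : Tm L (ctx Γ k) (ρ ⇒ τ)) (b : Tm L (ctx Γ k) ρ), (r.subst
      (Sub.cons (a.wk ⬝ .var .z) fun _ v => .var (.s v))).subst (Sub.inst b) =
      r.subst (Sub.inst (a ⬝ b)) := by
    intro a b
    rw [Tm.subst_subst]; congr 1; funext σ v
    cases v with
    | z => exact congrArg₂ Tm.app (Tm.wk_subst_inst _ _) rfl
    | s v => rfl
  rw [e₁, e₁] at key₁
  rw [e₂, e₂] at key₂
  have key := key₁.eq_trans key₂
  rw [← tm_up_up (le_max_left x.1 y.1) h, ← tm_up_up (le_max_right x.1 y.1) h,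
    ← tm_up_up (le_max_left x'.1 y'.1) h', ← tm_up_up (le_max_right x'.1 y'.1) h'] at key
  exact key

variable (T H) in
/-- The term model of the complete theory. -/
noncomputable def interp : Interp L where
  carrier τ := Quotient (preSetoid T H τ)
  app := Quotient.map₂ preApp fun _ _ hx _ _ hy => preApp_rel hx hy
  con c := Quotient.mk _ ⟨0, .con c⟩

variable (T H) in
noncomputable def mk {n : ℕ} {τ : Ty} (t : Tm L (ctx Γ n) τ) : (interp T H).carrier τ :=
  Quotient.mk (preSetoid T H τ) ⟨n, t⟩

theorem mk_eq_mk {n : ℕ} {τ : Ty} {s t : Tm L (ctx Γ n) τ} :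
    mk T H s = mk T H t ↔ Rel T H ⟨n, s⟩ ⟨n, t⟩ :=
  Quotient.eq (r := preSetoid T H τ)

theorem mk_up {n m : ℕ} (h : n ≤ m) {τ : Ty} (t : Tm L (ctx Γ n) τ) :
    mk T H (t.subst (up h)) = mk T H t :=
  Quotient.sound (s := preSetoid T H τ) fun k hx hy r => by
    simp only [tm_up_up]
    exact tr_of_drv (.eqRefl _)

theorem exists_mk {τ : Ty} (a : (interp T H).carrier τ) :
    ∃ (n : ℕ) (t : Tm L (ctx Γ n) τ), mk T H t = a := by
  obtain ⟨⟨n, t⟩, rfl⟩ := Quotient.exists_rep a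
  exact ⟨n, t, rfl⟩

theorem app_mk {n : ℕ} {ρ τ : Ty} (s : Tm L (ctx Γ n) (ρ ⇒ τ)) (t : Tm L (ctx Γ n) ρ) :
    (interp T H).app (mk T H s) (mk T H t) = mk T H (s ⬝ t) := by
  rw [← mk_up (le_max_left n n) (s ⬝ t)]
  rfl

theorem mk_con {n : ℕ} {τ : Ty} (c : Const L τ) :
    mk T H (.con c : Tm L (ctx Γ n) τ) = (interp T H).con c :=
  mk_up (Nat.zero_le n) (.con c : Tm L (ctx Γ 0) τ)

/-- The valuation given by a substitution. -/
noncomputable def env {Δ : Ctx} {n : ℕ} (f : Sub L Δ (ctx Γ n)) : (interp T H).Env Δ := fun _ v => mk T H (f _ v)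

theorem eval_env {Δ : Ctx} {n : ℕ} (f : Sub L Δ (ctx Γ n)) {τ : Ty} (t : Tm L Δ τ) :
    (interp T H).eval (env f) t = mk T H (t.subst f) := by
  induction t with
  | var v => rfl
  | con c => exact (mk_con c).symm
  | app t u iht ihu => rw [Interp.eval, iht, ihu, app_mk]; rfl

theorem env_up {Δ : Ctx} {n m : ℕ} (h : n ≤ m) (f : Sub L Δ (ctx Γ n)) :
    (env fun _ v => (f _ v).subst (up h) : (interp T H).Env Δ) = env f := by
  funext τ v; exact mk_up h _

theorem exists_env {Δ : Ctx} (e : (interp T H).Env Δ) :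
    ∃ (n : ℕ) (f : Sub L Δ (ctx Γ n)), env f = e := by
  induction Δ with
  | nil => exact ⟨0, Sub.empty, by funext τ v; cases v⟩
  | cons σ Δ ih =>
    obtain ⟨n, f, hf⟩ := ih fun τ v => e τ (.s v)
    obtain ⟨m, t, ht⟩ := exists_mk (e σ .z)
    refine ⟨max n m, fun | _, .z => t.subst (up (le_max_right n m))
                         | _, .s v => (f _ v).subst (up (le_max_left n m)), ?_⟩
    funext τ v
    cases v with
    | z => exact (mk_up _ _).trans ht
    | s v => exact (mk_up _ _).trans (congrFun (congrFun hf τ) v)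

/-- The quantifier-free rule applied to `s = t → s = t` makes equality of type `0` a congruence for
every context of type `0`; hence indiscernibility at this type is no finer than equality in the
complete theory. -/
theorem mk_eq_mk_nat {n : ℕ} {s t : Tm L (ctx Γ n) nat} :
    mk T H s = mk T H t ↔ Tr T H n (.eq s t) := by
  rw [mk_eq_mk]
  constructor
  · intro h
    have := h n le_rfl le_rfl (.var .z)
    simp only [up_self, Tm.subst_id] at this
    exact this
  · intro h k hk _ r
    exact (tr_of_drv (Drv.qfER (τ := nat)
      (A := .eq (s.subst (up hk)) (t.subst (up hk))) r trivial (Drv.imp_refl _))).mp ((tr_up hk _).2 h)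

theorem cons_env {Δ : Ctx} {n : ℕ} {σ : Ty} (f : Sub L Δ (ctx Γ n)) (t : Tm L (ctx Γ n) σ) :
    Interp.cons (mk T H t) (env f) = env fun τ v => (Sub.lift f τ v).subst (Sub.inst t) := by
  funext τ v
  cases v with
  | z => rfl
  | s v => exact congrArg (mk T H) (Tm.wk_subst_inst _ _).symm

theorem lift_up_subst {Δ : Ctx} {n m : ℕ} {σ : Ty} (h : n ≤ m) (f : Sub L Δ (ctx Γ n))
    (A : Fml L (σ :: Δ)) : (A.subst f.lift).subst (Sub.lift (up h)) =
      A.subst (Sub.lift fun _ v => (f _ v).subst (up h)) := by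
  rw [Sub.lift_comp, Fml.subst_subst]

variable (hH : Con T H)
include hH

/-- The truth lemma. Disjunction and implication use that the theory decides every formula and is
consistent; the existential quantifier uses the Henkin witnesses, and the universal one is reduced
to it through `¬ ∀ → ∃ ¬`. -/
theorem sat_env {Δ : Ctx} {n : ℕ} (f : Sub L Δ (ctx Γ n)) (A : Fml L Δ) :
    (interp T H).Sat (env f) A ↔ Tr T H n (A.subst f) := by
  induction A generalizing n with
  | eq s t => rw [Interp.Sat, eval_env, eval_env, mk_eq_mk_nat]; rfl
  | and A B ihA ihB =>
    rw [Interp.Sat, ihA, ihB]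
    exact ⟨fun h => ((tr_of_drv (.andI _ _)).mp h.1).mp h.2, fun h =>
      ⟨(tr_of_drv (.andL _ _)).mp h, (tr_of_drv (.andR _ _)).mp h⟩⟩
  | or A B ihA ihB =>
    rw [Interp.Sat, ihA, ihB]
    refine ⟨fun h => h.elim (tr_of_drv (.orL _ _)).mp (tr_of_drv (.orR _ _)).mp, fun h => ?_⟩
    by_contra! h'
    rw [← tr_neg hH, ← tr_neg hH] at h'
    exact not_tr_bot hH ((((tr_of_drv (.orE _ _ _)).mp h'.1).mp h'.2).mp h)
  | imp A B ihA ihB =>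
    rw [Interp.Sat, ihA, ihB]
    refine ⟨fun h => ?_, fun h h' => h.mp h'⟩
    by_cases hA : Tr T H n (A.subst f)
    · exact (tr_of_drv (.impK _ _)).mp (h hA)
    · rw [← tr_neg hH] at hA
      obtain hd : Drv T (neg (A.subst f) ⟶ₗ A.subst f ⟶ₗ B.subst f) :=
        Drv.curry (Drv.trans (Drv.mp₁ (.andL _ _) (.andR _ _)) (.efq _))
      exact (tr_of_drv hd).mp hA
  | all σ A ih =>
    rw [Interp.Sat]
    constructor
    · intro h
      by_contra h'
      rw [← tr_neg hH] at h'
      have hd : Drv T (neg (.all σ (A.subst f.lift)) ⟶ₗ .ex σ (neg (A.subst f.lift))) := by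
        refine Drv.by_cases (.ex σ (neg (A.subst f.lift))) (.andR _ _) ?_
        refine Drv.trans (Drv.mp₁ (.andL _ _) (Drv.trans (.andR _ _) (Drv.allI ?_))) (.efq _)
        refine Drv.by_cases (A.subst f.lift) (.andR _ _) ?_
        refine Drv.trans (Drv.mp₁ (.andL _ _) ?_) (.efq _)
        refine Drv.trans (.andR _ _) ?_
        have := Drv.exI (T := T) ((neg (A.subst f.lift)).subst
          (Sub.lift fun τ v => .var (.s v))) (.var .z)
        rw [Fml.subst_subst] at this
        simp only [Fml.subst]
        convert this using 2
        rw [← Fml.subst_id (neg (A.subst f.lift))]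
        conv_rhs => rw [Fml.subst_subst]
        congr 1; funext τ v
        cases v <;> rfl
      obtain ⟨m, hm, t, ht⟩ := tr_ex ((tr_of_drv hd).mp h')
      have h₁ := h (mk T H t)
      rw [← env_up hm, cons_env, ih] at h₁
      change Tr T H m (neg _) at ht
      rw [tr_neg hH, lift_up_subst, Fml.subst_subst] at ht
      exact ht h₁
    · intro h a
      obtain ⟨m, t, rfl⟩ := exists_mk a
      rw [← mk_up (le_max_right n m) t, ← env_up (le_max_left n m), cons_env, ih]
      have := (tr_up (le_max_left n m) _).2 h
      simp only [Fml.subst, lift_up_subst] at this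
      have := (tr_of_drv (.allE _ (t.subst (up (le_max_right n m))))).mp this
      rwa [Fml.subst_subst] at this
  | ex σ A ih =>
    rw [Interp.Sat]
    constructor
    · rintro ⟨a, ha⟩
      obtain ⟨m, t, rfl⟩ := exists_mk a
      rw [← mk_up (le_max_right n m) t, ← env_up (le_max_left n m), cons_env, ih] at ha
      rw [← tr_up (le_max_left n m)]
      simp only [Fml.subst, lift_up_subst]
      refine (tr_of_drv (.exI _ (t.subst (up (le_max_right n m))))).mp ?_
      rwa [Fml.subst_subst]
    · intro h
      obtain ⟨m, hm, t, ht⟩ := tr_ex h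
      refine ⟨mk T H t, ?_⟩
      rw [← env_up hm, cons_env, ih]
      rwa [lift_up_subst, Fml.subst_subst] at ht

variable (T H) in
/-- The term model as a model. -/
noncomputable def model : Model T where
  toInterp := interp T H
  sound h e := by
    obtain ⟨n, f, rfl⟩ := exists_env e
    exact (sat_env hH f _).2 (tr_of_drv (h.subst f))
  -- The rule gives `A → r[s] = r[t]` for every context `r` of type `0`. As `A` is true under the
  -- valuation, the two terms are indiscernible and so name the same element.
  ext {Δ ρ A s t} hA h e he := by
    obtain ⟨n, f, rfl⟩ := exists_env e
    rw [sat_env hH] at he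
    rw [eval_env, eval_env, mk_eq_mk]
    intro k hk _ r
    have h₁ := (h.subst f).subst (up hk)
    simp only [Fml.subst, eqT_subst] at h₁
    exact (tr_of_drv (Drv.qfER r ((hA.subst f).subst _) h₁)).mp ((tr_up hk _).2 he)
  zero_ne_one h := not_tr_bot hH (n := 0) (mk_eq_mk_nat.1 (h.trans (app_mk _ _)))

end Henkin

/-- Completeness of `Drv` for models. -/
theorem Drv.of_models {L : Lang} {T : Set (Fml L [])} {Γ : Ctx} {A : Fml L Γ}
    (h : ∀ (M : Model T) (e : M.Env Γ), M.Sat e A) : Drv T A := by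
  by_contra hA
  -- If `neg A` were inconsistent, excluded middle would yield a derivation of `A`.
  have hH : Henkin.Con T (neg A) := fun h' =>
    hA (Drv.mp (Drv.by_cases (H := A ⟶ₗ A) A (.andR _ _)
      (Drv.trans (Drv.trans (.andR _ _) h') (.efq _))) (Drv.imp_refl A))
  -- The free variables of `A` are valuated by themselves, so truth of `A` is its membership in the
  -- complete theory, which also contains `neg A`.
  have h₁ := (Henkin.sat_env hH (n := 0) (fun _ v => .var v) A).1
    (h (Henkin.model T (neg A) hH) (Henkin.env (n := 0) fun _ v => .var v))
  replace h₁ := (congrArg (Henkin.Tr T (neg A) 0) (Fml.subst_id A)).mp h₁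
  refine (Henkin.tr_neg hH (n := 0) A).1 ⟨0, le_rfl, ?_⟩ h₁
  rw [Henkin.up_self, Fml.subst_id]
  exact Drv.imp_refl _

end FinTypeArith

namespace FinTypeArith

/-! ## Arithmetic in a model -/

namespace Interp

variable {L : Lang} (I : Interp L)

@[simp] theorem cons_z {Γ : Ctx} {σ : Ty} (a : I.carrier σ) (e : I.Env Γ) : cons a e σ .z = a := rfl
@[simp] theorem cons_s {Γ : Ctx} {σ τ : Ty} (a : I.carrier σ) (e : I.Env Γ) (v : Var Γ τ) :
    cons a e τ (.s v) = e τ v := rfl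
@[simp] theorem eval_var {Γ : Ctx} {τ : Ty} (e : I.Env Γ) (v : Var Γ τ) :
    I.eval e (.var v) = e τ v := rfl
@[simp] theorem eval_con {Γ : Ctx} {τ : Ty} (e : I.Env Γ) (c : Const L τ) :
    I.eval e (.con c) = I.con c := rfl
@[simp] theorem eval_app {Γ : Ctx} {ρ τ : Ty} (e : I.Env Γ) (t : Tm L Γ (ρ ⇒ τ)) (u : Tm L Γ ρ) :
    I.eval e (t ⬝ u) = I.app (I.eval e t) (I.eval e u) := rfl

theorem eval_subst {Γ Δ : Ctx} {τ : Ty} (e : I.Env Δ) (f : Sub L Γ Δ) (t : Tm L Γ τ) :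
    I.eval e (t.subst f) = I.eval (fun τ v => I.eval e (f τ v)) t := by
  induction t with
  | var v => rfl
  | con c => rfl
  | app t u iht ihu => simp [iht, ihu]

theorem eval_ren {Γ Δ : Ctx} {τ : Ty} (e : I.Env Δ) (r : ∀ τ, Var Γ τ → Var Δ τ) (t : Tm L Γ τ) :
    I.eval e (t.ren r) = I.eval (fun τ v => e τ (r τ v)) t := by
  rw [Tm.ren_eq_subst, eval_subst]; rfl

@[simp] theorem eval_wk {Γ : Ctx} {σ τ : Ty} (e : I.Env Γ) (a : I.carrier σ) (t : Tm L Γ τ) :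
    I.eval (cons a e) t.wk = I.eval e t :=
  I.eval_ren _ _ t

theorem eval_closed {τ : Ty} (C : ∀ Γ, Tm L Γ τ)
    (h : ∀ (Γ Δ : Ctx) (f : ∀ τ, Var Γ τ → Var Δ τ), (C Γ).ren f = C Δ) {Γ : Ctx} (e : I.Env Γ) :
    I.eval e (C Γ) = I.eval nil (C []) := by
  rw [← h [] Γ (fun _ v => nomatch v), eval_ren]
  congr 1; funext τ v; cases v

theorem sat_subst {Γ Δ : Ctx} (e : I.Env Δ) (f : Sub L Γ Δ) (A : Fml L Γ) :
    I.Sat e (A.subst f) ↔ I.Sat (fun τ v => I.eval e (f τ v)) A := by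
  have key : ∀ {Γ Δ : Ctx} {σ : Ty} (e : I.Env Δ) (f : Sub L Γ Δ) (a : I.carrier σ),
      (fun τ v => I.eval (cons a e) (Sub.lift f τ v)) =
        cons a fun τ v => I.eval e (f τ v) := by
    intro Γ Δ σ e f a
    funext τ v
    cases v with
    | z => rfl
    | s v => exact I.eval_wk _ _ _
  induction A generalizing Δ with
  | eq s t => simp [Sat, Fml.subst, eval_subst]
  | and A B ihA ihB => simp [Sat, Fml.subst, ihA, ihB]
  | or A B ihA ihB => simp [Sat, Fml.subst, ihA, ihB]
  | imp A B ihA ihB => simp [Sat, Fml.subst, ihA, ihB]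
  | all σ A ih => simp [Sat, Fml.subst, ih, key]
  | ex σ A ih => simp [Sat, Fml.subst, ih, key]

theorem sat_closed {Γ : Ctx} (e : I.Env Γ) (A : Fml L []) :
    I.Sat e (A.closed Γ) ↔ I.Sat nil A := by
  rw [Fml.closed, sat_subst]
  have : (fun τ v => I.eval e ((Sub.empty : Sub L [] Γ) τ v)) = nil := by
    funext τ v; cases v
  rw [this]

end Interp

namespace Model

variable {L : Lang} {T : Set (Fml L [])} (M : Model T)

theorem sat_ax {A : Fml L []} (h : A ∈ T) : M.Sat Interp.nil A :=
  (M.sat_closed Interp.nil A).1 (M.sound (.ax h) _)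

/-- The case of a trivially true hypothesis. It turns the equations for the combinators into
identities of elements at all types, from which `app_lam` follows. -/
theorem eval_eq_of_drv {Γ : Ctx} {τ : Ty} {s t : Tm L Γ τ} (h : Drv T (eqT s t)) (e : M.Env Γ) :
    M.eval e s = M.eval e t :=
  M.ext (A := .eq O O) (Fml.isQF_eq _ _) (Drv.const _ h) e rfl

@[simp] theorem app_pi {ρ τ : Ty} (a : M.carrier ρ) (b : M.carrier τ) :
    M.app (M.app (M.con (.Pi ρ τ)) a) b = a :=
  M.eval_eq_of_drv (.piEq x1 x0) (b ∷ a ∷ Interp.nil)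

@[simp] theorem app_sigma {δ ρ τ : Ty} (a : M.carrier (δ ⇒ ρ ⇒ τ)) (b : M.carrier (δ ⇒ ρ))
    (c : M.carrier δ) :
    M.app (M.app (M.app (M.con (.Sigma δ ρ τ)) a) b) c = M.app (M.app a c) (M.app b c) :=
  M.eval_eq_of_drv (.sigmaEq x2 x1 x0) (c ∷ b ∷ a ∷ Interp.nil)

@[simp] theorem app_lam {Γ : Ctx} {σ τ : Ty} (e : M.Env Γ) (t : Tm L (σ :: Γ) τ)
    (a : M.carrier σ) : M.app (M.eval e t.lam) a = M.eval (a ∷ e) t := by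
  induction t with
  | var v => cases v <;> simp [Tm.lam]
  | con c => simp [Tm.lam]
  | app t u iht ihu => simp [Tm.lam, iht, ihu]

/-- The natural numbers of the model. -/
abbrev N := M.carrier nat

def succ (n : M.N) : M.N := M.app (M.con .succ) n

instance : Zero M.N := ⟨M.con .zero⟩
instance : One M.N := ⟨M.succ 0⟩

@[simp] theorem eval_O {Γ : Ctx} (e : M.Env Γ) : M.eval e O = 0 := rfl
@[simp] theorem eval_S {Γ : Ctx} (e : M.Env Γ) (t : Tm L Γ nat) :
    M.eval e (S t) = M.succ (M.eval e t) := rfl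

theorem succ_ne_zero (n : M.N) : M.succ n ≠ 0 := fun h =>
  M.zero_ne_one (M.sound (.succNe x0) (n ∷ Interp.nil) h)

theorem succ_inj {m n : M.N} (h : M.succ m = M.succ n) : m = n :=
  M.sound (.succInj x1 x0) (n ∷ m ∷ Interp.nil) h

/-- Induction for properties which are defined by a formula. -/
theorem induct {Γ : Ctx} (A : Fml L (nat :: Γ)) (e : M.Env Γ) {P : M.N → Prop}
    (hP : ∀ n, M.Sat (n ∷ e) A ↔ P n) (h0 : P 0) (hs : ∀ n, P n → P (M.succ n)) (n : M.N) :
    P n := by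
  refine (hP n).1 (M.sound (.ind A) e ?_ ?_ n)
  · rw [Interp.sat_subst]
    convert (hP 0).2 h0
    rename_i v
    cases v <;> rfl
  · intro m hm
    rw [Interp.sat_subst]
    convert (hP _).2 (hs m ((hP m).1 hm))
    rename_i v
    cases v <;> rfl

/-- The recursor of type `0`. -/
def nrec (n b : M.N) (f : M.carrier (nat ⇒ nat ⇒ nat)) : M.N :=
  M.app (M.app (M.app (M.con (.recr [nat] nat .z)) n) b) f

@[simp] theorem eval_natRec {Γ : Ctx} (e : M.Env Γ) (n b : Tm L Γ nat)
    (f : Tm L Γ (nat ⇒ nat ⇒ nat)) :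
    M.eval e (natRec n b f) = M.nrec (M.eval e n) (M.eval e b) (M.eval e f) := rfl

theorem nrec_zero (b : M.N) (f : M.carrier (nat ⇒ nat ⇒ nat)) : M.nrec 0 b f = b :=
  M.sound (.recZero x1 x0) (f ∷ b ∷ Interp.nil)

theorem nrec_succ (n b : M.N) (f : M.carrier (nat ⇒ nat ⇒ nat)) :
    M.nrec (M.succ n) b f = M.app (M.app f (M.nrec n b f)) n :=
  M.sound (.recSucc x2 x1 x0) (f ∷ b ∷ n ∷ Interp.nil)

/-- A model need not be extensional, so pointwise equal step functions may be different elements;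
the recursor still cannot tell them apart. This is needed because the step of a recursion inside
`lam` also depends formally on the recursion argument, which changes between `n` and its successor.
-/
theorem nrec_congr (n b : M.N) {f g : M.carrier (nat ⇒ nat ⇒ nat)}
    (h : ∀ x y, M.app (M.app f x) y = M.app (M.app g x) y) : M.nrec n b f = M.nrec n b g := by
  refine M.induct (.eq (natRec x0 x1 x2) (natRec x0 x1 x3)) (b ∷ f ∷ g ∷ Interp.nil)
    (P := fun n => M.nrec n b f = M.nrec n b g) (fun _ => Iff.rfl) ?_ ?_ n
  · rw [nrec_zero, nrec_zero]
  · intro n ih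
    rw [nrec_succ, nrec_succ, ih, h]

/-! ### The functions given by the closed terms -/

def addS (a : M.N) (b : M.N) : M.N :=
  M.app (M.app (M.eval Interp.nil addC) a) b
@[simp] theorem eval_addC {Γ : Ctx} (e : M.Env Γ) (a : M.N) (b : M.N) :
    M.app (M.app (M.eval e (addC : Tm L Γ _)) a) b = M.addS a b := by
  rw [M.eval_closed (fun _ => addC) (fun _ _ => ren_addC)]; rfl

def mulS (a : M.N) (b : M.N) : M.N :=
  M.app (M.app (M.eval Interp.nil mulC) a) b
@[simp] theorem eval_mulC {Γ : Ctx} (e : M.Env Γ) (a : M.N) (b : M.N) :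
    M.app (M.app (M.eval e (mulC : Tm L Γ _)) a) b = M.mulS a b := by
  rw [M.eval_closed (fun _ => mulC) (fun _ _ => ren_mulC)]; rfl

def predS (a : M.N) : M.N :=
  M.app (M.eval Interp.nil predC) a
@[simp] theorem eval_predC {Γ : Ctx} (e : M.Env Γ) (a : M.N) :
    M.app (M.eval e (predC : Tm L Γ _)) a = M.predS a := by
  rw [M.eval_closed (fun _ => predC) (fun _ _ => ren_predC)]; rfl

def subS (a : M.N) (b : M.N) : M.N :=
  M.app (M.app (M.eval Interp.nil subC) a) b
@[simp] theorem eval_subC {Γ : Ctx} (e : M.Env Γ) (a : M.N) (b : M.N) :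
    M.app (M.app (M.eval e (subC : Tm L Γ _)) a) b = M.subS a b := by
  rw [M.eval_closed (fun _ => subC) (fun _ _ => ren_subC)]; rfl

def iteS (a : M.N) (b : M.N) (c : M.N) : M.N :=
  M.app (M.app (M.app (M.eval Interp.nil iteC) a) b) c
@[simp] theorem eval_iteC {Γ : Ctx} (e : M.Env Γ) (a : M.N) (b : M.N) (c : M.N) :
    M.app (M.app (M.app (M.eval e (iteC : Tm L Γ _)) a) b) c = M.iteS a b c := by
  rw [M.eval_closed (fun _ => iteC) (fun _ _ => ren_iteC)]; rfl

def pow2S (a : M.N) : M.N :=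
  M.app (M.eval Interp.nil pow2C) a
@[simp] theorem eval_pow2C {Γ : Ctx} (e : M.Env Γ) (a : M.N) :
    M.app (M.eval e (pow2C : Tm L Γ _)) a = M.pow2S a := by
  rw [M.eval_closed (fun _ => pow2C) (fun _ _ => ren_pow2C)]; rfl

def distS (a : M.N) (b : M.N) : M.N :=
  M.app (M.app (M.eval Interp.nil distC) a) b
@[simp] theorem eval_distC {Γ : Ctx} (e : M.Env Γ) (a : M.N) (b : M.N) :
    M.app (M.app (M.eval e (distC : Tm L Γ _)) a) b = M.distS a b := by
  rw [M.eval_closed (fun _ => distC) (fun _ _ => ren_distC)]; rfl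

def searchS (a : M.carrier one) (b : M.N) : M.N :=
  M.app (M.app (M.eval Interp.nil searchC) a) b
@[simp] theorem eval_searchC {Γ : Ctx} (e : M.Env Γ) (a : M.carrier one) (b : M.N) :
    M.app (M.app (M.eval e (searchC : Tm L Γ _)) a) b = M.searchS a b := by
  rw [M.eval_closed (fun _ => searchC) (fun _ _ => ren_searchC)]; rfl

def bminS (a : M.carrier one) (b : M.N) : M.N :=
  M.app (M.app (M.eval Interp.nil bminC) a) b
@[simp] theorem eval_bminC {Γ : Ctx} (e : M.Env Γ) (a : M.carrier one) (b : M.N) :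
    M.app (M.app (M.eval e (bminC : Tm L Γ _)) a) b = M.bminS a b := by
  rw [M.eval_closed (fun _ => bminC) (fun _ _ => ren_bminC)]; rfl

def cantorS (a : M.N) (b : M.N) : M.N :=
  M.app (M.app (M.eval Interp.nil cantorC) a) b
@[simp] theorem eval_cantorC {Γ : Ctx} (e : M.Env Γ) (a : M.N) (b : M.N) :
    M.app (M.app (M.eval e (cantorC : Tm L Γ _)) a) b = M.cantorS a b := by
  rw [M.eval_closed (fun _ => cantorC) (fun _ _ => ren_cantorC)]; rfl

def pairS (a : M.N) (b : M.N) : M.N :=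
  M.app (M.app (M.eval Interp.nil pairC) a) b
@[simp] theorem eval_pairC {Γ : Ctx} (e : M.Env Γ) (a : M.N) (b : M.N) :
    M.app (M.app (M.eval e (pairC : Tm L Γ _)) a) b = M.pairS a b := by
  rw [M.eval_closed (fun _ => pairC) (fun _ _ => ren_pairC)]; rfl

def fstS (a : M.N) : M.N :=
  M.app (M.eval Interp.nil fstC) a
@[simp] theorem eval_fstC {Γ : Ctx} (e : M.Env Γ) (a : M.N) :
    M.app (M.eval e (fstC : Tm L Γ _)) a = M.fstS a := by
  rw [M.eval_closed (fun _ => fstC) (fun _ _ => ren_fstC)]; rfl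

def sndS (a : M.N) : M.N :=
  M.app (M.eval Interp.nil sndC) a
@[simp] theorem eval_sndC {Γ : Ctx} (e : M.Env Γ) (a : M.N) :
    M.app (M.eval e (sndC : Tm L Γ _)) a = M.sndS a := by
  rw [M.eval_closed (fun _ => sndC) (fun _ _ => ren_sndC)]; rfl

def halfS (a : M.N) : M.N :=
  M.app (M.eval Interp.nil halfC) a
@[simp] theorem eval_halfC {Γ : Ctx} (e : M.Env Γ) (a : M.N) :
    M.app (M.eval e (halfC : Tm L Γ _)) a = M.halfS a := by
  rw [M.eval_closed (fun _ => halfC) (fun _ _ => ren_halfC)]; rfl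

def oddS (a : M.N) : M.N :=
  M.app (M.eval Interp.nil oddC) a
@[simp] theorem eval_oddC {Γ : Ctx} (e : M.Env Γ) (a : M.N) :
    M.app (M.eval e (oddC : Tm L Γ _)) a = M.oddS a := by
  rw [M.eval_closed (fun _ => oddC) (fun _ _ => ren_oddC)]; rfl

def posS (a : M.N) : M.N :=
  M.app (M.eval Interp.nil posC) a
@[simp] theorem eval_posC {Γ : Ctx} (e : M.Env Γ) (a : M.N) :
    M.app (M.eval e (posC : Tm L Γ _)) a = M.posS a := by
  rw [M.eval_closed (fun _ => posC) (fun _ _ => ren_posC)]; rfl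

def negS (a : M.N) : M.N :=
  M.app (M.eval Interp.nil negC) a
@[simp] theorem eval_negC {Γ : Ctx} (e : M.Env Γ) (a : M.N) :
    M.app (M.eval e (negC : Tm L Γ _)) a = M.negS a := by
  rw [M.eval_closed (fun _ => negC) (fun _ _ => ren_negC)]; rfl

def denS (a : M.N) : M.N :=
  M.app (M.eval Interp.nil denC) a
@[simp] theorem eval_denC {Γ : Ctx} (e : M.Env Γ) (a : M.N) :
    M.app (M.eval e (denC : Tm L Γ _)) a = M.denS a := by
  rw [M.eval_closed (fun _ => denC) (fun _ _ => ren_denC)]; rfl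

def mkQS (a : M.N) (b : M.N) (c : M.N) : M.N :=
  M.app (M.app (M.app (M.eval Interp.nil mkQC) a) b) c
@[simp] theorem eval_mkQC {Γ : Ctx} (e : M.Env Γ) (a : M.N) (b : M.N) (c : M.N) :
    M.app (M.app (M.app (M.eval e (mkQC : Tm L Γ _)) a) b) c = M.mkQS a b c := by
  rw [M.eval_closed (fun _ => mkQC) (fun _ _ => ren_mkQC)]; rfl

def addQS (a : M.N) (b : M.N) : M.N :=
  M.app (M.app (M.eval Interp.nil addQC) a) b
@[simp] theorem eval_addQC {Γ : Ctx} (e : M.Env Γ) (a : M.N) (b : M.N) :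
    M.app (M.app (M.eval e (addQC : Tm L Γ _)) a) b = M.addQS a b := by
  rw [M.eval_closed (fun _ => addQC) (fun _ _ => ren_addQC)]; rfl

def negQS (a : M.N) : M.N :=
  M.app (M.eval Interp.nil negQC) a
@[simp] theorem eval_negQC {Γ : Ctx} (e : M.Env Γ) (a : M.N) :
    M.app (M.eval e (negQC : Tm L Γ _)) a = M.negQS a := by
  rw [M.eval_closed (fun _ => negQC) (fun _ _ => ren_negQC)]; rfl

def absQS (a : M.N) : M.N :=
  M.app (M.eval Interp.nil absQC) a
@[simp] theorem eval_absQC {Γ : Ctx} (e : M.Env Γ) (a : M.N) :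
    M.app (M.eval e (absQC : Tm L Γ _)) a = M.absQS a := by
  rw [M.eval_closed (fun _ => absQC) (fun _ _ => ren_absQC)]; rfl

def mulQS (a : M.N) (b : M.N) : M.N :=
  M.app (M.app (M.eval Interp.nil mulQC) a) b
@[simp] theorem eval_mulQC {Γ : Ctx} (e : M.Env Γ) (a : M.N) (b : M.N) :
    M.app (M.app (M.eval e (mulQC : Tm L Γ _)) a) b = M.mulQS a b := by
  rw [M.eval_closed (fun _ => mulQC) (fun _ _ => ren_mulQC)]; rfl

def invQS (a : M.N) : M.N :=
  M.app (M.eval Interp.nil invQC) a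
@[simp] theorem eval_invQC {Γ : Ctx} (e : M.Env Γ) (a : M.N) :
    M.app (M.eval e (invQC : Tm L Γ _)) a = M.invQS a := by
  rw [M.eval_closed (fun _ => invQC) (fun _ _ => ren_invQC)]; rfl

def leQS (a : M.N) (b : M.N) : M.N :=
  M.app (M.app (M.eval Interp.nil leQC) a) b
@[simp] theorem eval_leQC {Γ : Ctx} (e : M.Env Γ) (a : M.N) (b : M.N) :
    M.app (M.app (M.eval e (leQC : Tm L Γ _)) a) b = M.leQS a b := by
  rw [M.eval_closed (fun _ => leQC) (fun _ _ => ren_leQC)]; rfl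

def ltQS (a : M.N) (b : M.N) : M.N :=
  M.app (M.app (M.eval Interp.nil ltQC) a) b
@[simp] theorem eval_ltQC {Γ : Ctx} (e : M.Env Γ) (a : M.N) (b : M.N) :
    M.app (M.app (M.eval e (ltQC : Tm L Γ _)) a) b = M.ltQS a b := by
  rw [M.eval_closed (fun _ => ltQC) (fun _ _ => ren_ltQC)]; rfl

def hatS (a : M.carrier one) : M.carrier one :=
  M.app (M.eval Interp.nil hatC) a
@[simp] theorem eval_hatC {Γ : Ctx} (e : M.Env Γ) (a : M.carrier one) :
    M.app (M.eval e (hatC : Tm L Γ _)) a = M.hatS a := by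
  rw [M.eval_closed (fun _ => hatC) (fun _ _ => ren_hatC)]; rfl

def addRS (a : M.carrier one) (b : M.carrier one) : M.carrier one :=
  M.app (M.app (M.eval Interp.nil addRC) a) b
@[simp] theorem eval_addRC {Γ : Ctx} (e : M.Env Γ) (a : M.carrier one) (b : M.carrier one) :
    M.app (M.app (M.eval e (addRC : Tm L Γ _)) a) b = M.addRS a b := by
  rw [M.eval_closed (fun _ => addRC) (fun _ _ => ren_addRC)]; rfl

def negRS (a : M.carrier one) : M.carrier one :=
  M.app (M.eval Interp.nil negRC) a
@[simp] theorem eval_negRC {Γ : Ctx} (e : M.Env Γ) (a : M.carrier one) :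
    M.app (M.eval e (negRC : Tm L Γ _)) a = M.negRS a := by
  rw [M.eval_closed (fun _ => negRC) (fun _ _ => ren_negRC)]; rfl

def absRS (a : M.carrier one) : M.carrier one :=
  M.app (M.eval Interp.nil absRC) a
@[simp] theorem eval_absRC {Γ : Ctx} (e : M.Env Γ) (a : M.carrier one) :
    M.app (M.eval e (absRC : Tm L Γ _)) a = M.absRS a := by
  rw [M.eval_closed (fun _ => absRC) (fun _ _ => ren_absRC)]; rfl

def mulShiftS (a : M.carrier one) (b : M.carrier one) : M.N :=
  M.app (M.app (M.eval Interp.nil mulShiftC) a) b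
@[simp] theorem eval_mulShiftC {Γ : Ctx} (e : M.Env Γ) (a : M.carrier one) (b : M.carrier one) :
    M.app (M.app (M.eval e (mulShiftC : Tm L Γ _)) a) b = M.mulShiftS a b := by
  rw [M.eval_closed (fun _ => mulShiftC) (fun _ _ => ren_mulShiftC)]; rfl

def mulRS (a : M.carrier one) (b : M.carrier one) : M.carrier one :=
  M.app (M.app (M.eval Interp.nil mulRC) a) b
@[simp] theorem eval_mulRC {Γ : Ctx} (e : M.Env Γ) (a : M.carrier one) (b : M.carrier one) :
    M.app (M.app (M.eval e (mulRC : Tm L Γ _)) a) b = M.mulRS a b := by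
  rw [M.eval_closed (fun _ => mulRC) (fun _ _ => ren_mulRC)]; rfl

def invRS (a : M.N) (b : M.carrier one) : M.carrier one :=
  M.app (M.app (M.eval Interp.nil invRC) a) b
@[simp] theorem eval_invRC {Γ : Ctx} (e : M.Env Γ) (a : M.N) (b : M.carrier one) :
    M.app (M.app (M.eval e (invRC : Tm L Γ _)) a) b = M.invRS a b := by
  rw [M.eval_closed (fun _ => invRC) (fun _ _ => ren_invRC)]; rfl

end Model

end FinTypeArith

namespace FinTypeArith

namespace Model

variable {L : Lang} {T : Set (Fml L [])} (M : Model T)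

/-! ### Evaluation of the defined arithmetical terms. -/

section Wrappers

variable {Γ : Ctx} (e : M.Env Γ) (s t u : Tm L Γ nat) (f g : Tm L Γ one)

@[simp] theorem eval_pred : M.eval e (pred t) = M.predS (M.eval e t) := by simp [pred]
@[simp] theorem eval_sub : M.eval e (sub s t) = M.subS (M.eval e s) (M.eval e t) := by simp [sub]
@[simp] theorem eval_ite :
    M.eval e (ite s t u) = M.iteS (M.eval e s) (M.eval e t) (M.eval e u) := by simp [ite]
@[simp] theorem eval_pow2 : M.eval e (pow2 t) = M.pow2S (M.eval e t) := by simp [pow2]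
@[simp] theorem eval_dist : M.eval e (dist s t) = M.distS (M.eval e s) (M.eval e t) := by
  simp [dist]
@[simp] theorem eval_search : M.eval e (search f t) = M.searchS (M.eval e f) (M.eval e t) := by
  simp [search]
@[simp] theorem eval_bmin : M.eval e (bmin f t) = M.bminS (M.eval e f) (M.eval e t) := by
  simp [bmin]
@[simp] theorem eval_pair : M.eval e (pair s t) = M.pairS (M.eval e s) (M.eval e t) := by
  simp [pair]
@[simp] theorem eval_half : M.eval e (half t) = M.halfS (M.eval e t) := by simp [half]
@[simp] theorem eval_numPos : M.eval e (numPos t) = M.posS (M.eval e t) := by simp [numPos]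
@[simp] theorem eval_numNeg : M.eval e (numNeg t) = M.negS (M.eval e t) := by simp [numNeg]
@[simp] theorem eval_den : M.eval e (den t) = M.denS (M.eval e t) := by simp [den]
@[simp] theorem eval_mkQ :
    M.eval e (mkQ s t u) = M.mkQS (M.eval e s) (M.eval e t) (M.eval e u) := by simp [mkQ]
@[simp] theorem eval_addQ : M.eval e (addQ s t) = M.addQS (M.eval e s) (M.eval e t) := by
  simp [addQ]
@[simp] theorem eval_negQ : M.eval e (negQ t) = M.negQS (M.eval e t) := by simp [negQ]
@[simp] theorem eval_absQ : M.eval e (absQ t) = M.absQS (M.eval e t) := by simp [absQ]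
@[simp] theorem eval_mulQ : M.eval e (mulQ s t) = M.mulQS (M.eval e s) (M.eval e t) := by
  simp [mulQ]
@[simp] theorem eval_invQ : M.eval e (invQ t) = M.invQS (M.eval e t) := by simp [invQ]
@[simp] theorem eval_hat : M.eval e (hat f t) = M.app (M.hatS (M.eval e f)) (M.eval e t) := by
  simp [hat]
@[simp] theorem eval_addR : M.eval e (addR f g) = M.addRS (M.eval e f) (M.eval e g) := by
  simp [addR]
@[simp] theorem eval_negR : M.eval e (negR f) = M.negRS (M.eval e f) := by simp [negR]
@[simp] theorem eval_absR : M.eval e (absR f) = M.absRS (M.eval e f) := by simp [absR]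
@[simp] theorem eval_mulR : M.eval e (mulR f g) = M.mulRS (M.eval e f) (M.eval e g) := by
  simp [mulR]
@[simp] theorem eval_invR : M.eval e (invR t f) = M.invRS (M.eval e t) (M.eval e f) := by
  simp [invR]

end Wrappers

/-! ### The semiring of natural numbers -/

instance : Add M.N := ⟨M.addS⟩
instance : Mul M.N := ⟨M.mulS⟩

@[simp] theorem eval_add {Γ : Ctx} (e : M.Env Γ) (s t : Tm L Γ nat) :
    M.eval e (add s t) = M.eval e s + M.eval e t := by simp [add]; rfl
@[simp] theorem eval_mul {Γ : Ctx} (e : M.Env Γ) (s t : Tm L Γ nat) :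
    M.eval e (mul s t) = M.eval e s * M.eval e t := by simp [mul]; rfl

theorem addS_eq (a b : M.N) :
    a + b = M.nrec b a (M.eval (b ∷ a ∷ Interp.nil) (S x1).lam.lam) := by
  change M.addS a b = _
  unfold addS addC
  rw [M.app_lam, M.app_lam, M.eval_natRec]
  rfl

theorem add_zero' (a : M.N) : a + 0 = a := by rw [addS_eq, nrec_zero]

theorem add_succ (a b : M.N) : a + M.succ b = M.succ (a + b) := by
  rw [addS_eq, nrec_succ, M.app_lam, M.app_lam, addS_eq]
  exact congrArg M.succ (M.nrec_congr _ _ (by simp))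

theorem zero_add' (a : M.N) : 0 + a = a :=
  M.induct (P := fun a => 0 + a = a) (.eq (add O x0) x0) Interp.nil
    (by simp [Interp.Sat]) (M.add_zero' 0)
    (fun n ih => by rw [add_succ, ih]) a

theorem succ_add (a b : M.N) : M.succ a + b = M.succ (a + b) :=
  M.induct (P := fun b => M.succ a + b = M.succ (a + b)) (.eq (add (S x1) x0) (S (add x1 x0)))
    (a ∷ Interp.nil) (by simp [Interp.Sat]) (by simp only [add_zero'])
    (fun n ih => by rw [add_succ, ih, add_succ]) b

theorem add_comm' (a b : M.N) : a + b = b + a :=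
  M.induct (P := fun b => a + b = b + a) (.eq (add x1 x0) (add x0 x1))
    (a ∷ Interp.nil) (by simp [Interp.Sat]) (by rw [add_zero', zero_add'])
    (fun n ih => by rw [add_succ, ih, succ_add]) b

theorem add_assoc' (a b c : M.N) : a + b + c = a + (b + c) :=
  M.induct (P := fun c => a + b + c = a + (b + c)) (.eq (add (add x1 x2) x0) (add x1 (add x2 x0)))
    (a ∷ b ∷ Interp.nil) (by simp [Interp.Sat]) (by simp only [add_zero'])
    (fun n ih => by rw [add_succ, ih, add_succ, add_succ]) c

theorem mulS_eq (a b : M.N) :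
    a * b = M.nrec b 0 (M.eval (b ∷ a ∷ Interp.nil) (add x1 x3).lam.lam) := by
  change M.mulS a b = _
  unfold mulS mulC
  rw [M.app_lam, M.app_lam, M.eval_natRec]
  rfl

theorem mul_zero' (a : M.N) : a * 0 = 0 := by rw [mulS_eq, nrec_zero]

theorem mul_succ' (a b : M.N) : a * M.succ b = a * b + a := by
  rw [mulS_eq, nrec_succ, M.app_lam, M.app_lam, mulS_eq]
  simp only [eval_add, Interp.eval_var, Interp.cons_z, Interp.cons_s]
  exact congrArg (· + a) (M.nrec_congr _ _ (by simp))

theorem zero_mul' (a : M.N) : 0 * a = 0 :=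
  M.induct (P := fun a => 0 * a = 0) (.eq (mul O x0) O) Interp.nil
    (by simp [Interp.Sat]) (M.mul_zero' 0)
    (fun n ih => by rw [mul_succ', ih, add_zero']) a

theorem succ_mul' (a b : M.N) : M.succ a * b = a * b + b :=
  M.induct (P := fun b => M.succ a * b = a * b + b) (.eq (mul (S x1) x0) (add (mul x1 x0) x0))
    (a ∷ Interp.nil) (by simp [Interp.Sat]) (by simp only [add_zero', mul_zero'])
    (fun n ih => by
      rw [mul_succ', ih, mul_succ', add_succ, add_succ, add_assoc', M.add_comm' n, add_assoc']) b

theorem mul_comm' (a b : M.N) : a * b = b * a :=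
  M.induct (P := fun b => a * b = b * a) (.eq (mul x1 x0) (mul x0 x1))
    (a ∷ Interp.nil) (by simp [Interp.Sat]) (by rw [mul_zero', zero_mul'])
    (fun n ih => by rw [mul_succ', ih, succ_mul']) b

theorem mul_add' (a b c : M.N) : a * (b + c) = a * b + a * c :=
  M.induct (P := fun c => a * (b + c) = a * b + a * c)
    (.eq (mul x1 (add x2 x0)) (add (mul x1 x2) (mul x1 x0)))
    (a ∷ b ∷ Interp.nil) (by simp [Interp.Sat]) (by simp only [add_zero', mul_zero'])
    (fun n ih => by rw [add_succ, mul_succ', ih, mul_succ', add_assoc']) c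

theorem mul_assoc' (a b c : M.N) : a * b * c = a * (b * c) :=
  M.induct (P := fun c => a * b * c = a * (b * c)) (.eq (mul (mul x1 x2) x0) (mul x1 (mul x2 x0)))
    (a ∷ b ∷ Interp.nil) (by simp [Interp.Sat]) (by simp only [mul_zero'])
    (fun n ih => by rw [mul_succ', ih, mul_succ', mul_add']) c

theorem mul_one' (a : M.N) : a * 1 = a := by
  change a * M.succ 0 = a
  rw [mul_succ', mul_zero', zero_add']

instance : CommSemiring M.N where
  add_assoc := M.add_assoc'
  zero_add := M.zero_add'
  add_zero := M.add_zero'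
  add_comm := M.add_comm'
  left_distrib := M.mul_add'
  right_distrib a b c := by rw [M.mul_comm', M.mul_add', M.mul_comm' c, M.mul_comm' c]
  zero_mul := M.zero_mul'
  mul_zero := M.mul_zero'
  mul_assoc := M.mul_assoc'
  one_mul a := by rw [M.mul_comm', M.mul_one']
  mul_one := M.mul_one'
  mul_comm := M.mul_comm'
  nsmul := nsmulRec

theorem succ_eq (n : M.N) : M.succ n = n + 1 := by
  change _ = n + M.succ 0
  rw [add_succ, add_zero]

/-- Induction, in the notation of the semiring. -/
theorem induct' {Γ : Ctx} (A : Fml L (nat :: Γ)) (e : M.Env Γ) {P : M.N → Prop}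
    (hP : ∀ n, M.Sat (n ∷ e) A ↔ P n) (h0 : P 0) (hs : ∀ n, P n → P (n + 1)) (n : M.N) :
    P n :=
  M.induct A e hP h0 (fun n hn => by rw [succ_eq]; exact hs n hn) n

/-! ### Cancellation and the order of the natural numbers. -/

variable {M}

theorem add_one_ne_zero (n : M.N) : n + 1 ≠ 0 := by rw [← succ_eq]; exact M.succ_ne_zero n

theorem eq_zero_or_eq_add_one (n : M.N) : n = 0 ∨ ∃ m, n = m + 1 :=
  M.induct' (P := fun n => n = 0 ∨ ∃ m, n = m + 1) (.or (.eq x0 O) (.ex nat (.eq x1 (S x0))))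
    Interp.nil (by simp [Interp.Sat, succ_eq]) (.inl rfl) (fun n _ => .inr ⟨n, rfl⟩) n

theorem add_right_cancel' {a b c : M.N} (h : a + c = b + c) : a = b := by
  revert h
  refine M.induct' (P := fun c => a + c = b + c → a = b)
    (.eq (add x1 x0) (add x2 x0) ⟶ₗ .eq x1 x2) (a ∷ b ∷ Interp.nil) (by simp [Interp.Sat])
    (by simp) (fun n ih h => ih ?_) c
  rw [← add_assoc, ← add_assoc, ← succ_eq, ← succ_eq] at h
  exact M.succ_inj h

theorem eq_zero_of_add_eq_zero {a b : M.N} (h : a + b = 0) : b = 0 := by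
  obtain rfl | ⟨c, rfl⟩ := eq_zero_or_eq_add_one b
  · rfl
  · rw [← add_assoc] at h
    exact (add_one_ne_zero _ h).elim

theorem le_total' (a b : M.N) : (∃ c, b = a + c) ∨ ∃ c, a = b + c := by
  refine M.induct' (P := fun a => (∃ c, b = a + c) ∨ ∃ c, a = b + c)
    (.or (.ex nat (.eq x2 (add x1 x0))) (.ex nat (.eq x1 (add x2 x0))))
    (b ∷ Interp.nil) (by simp [Interp.Sat]) (.inl ⟨b, (zero_add b).symm⟩) ?_ a
  rintro n (⟨c, rfl⟩ | ⟨c, rfl⟩)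
  · obtain rfl | ⟨c, rfl⟩ := eq_zero_or_eq_add_one c
    · exact .inr ⟨1, by ring⟩
    · exact .inl ⟨c, by ring⟩
  · exact .inr ⟨c + 1, by ring⟩

open Classical in
noncomputable instance : LinearOrder M.N where
  le a b := ∃ c, b = a + c
  le_refl a := ⟨0, (add_zero a).symm⟩
  le_trans := by
    rintro a _ _ ⟨c, rfl⟩ ⟨d, rfl⟩
    exact ⟨c + d, add_assoc _ _ _⟩
  le_antisymm := by
    rintro a _ ⟨c, rfl⟩ ⟨d, hd⟩
    have : d + c = 0 := add_right_cancel' (c := a) (by rw [zero_add]; nth_rw 2 [hd]; ring)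
    rw [eq_zero_of_add_eq_zero this, add_zero]
  le_total := le_total'
  toDecidableLE := Classical.decRel _

theorem le_def {a b : M.N} : a ≤ b ↔ ∃ c, b = a + c := Iff.rfl

instance : IsOrderedAddMonoid M.N where
  add_le_add_left := by
    rintro a _ ⟨c, rfl⟩ d
    exact ⟨c, by ring⟩

instance : CanonicallyOrderedAdd M.N where
  exists_add_of_le h := h
  le_self_add _ b := ⟨b, rfl⟩
  le_add_self _ b := ⟨b, add_comm _ _⟩

instance : IsCancelAdd M.N where
  add_left_cancel a _ _ h := add_right_cancel' (c := a) (by simpa [add_comm] using h)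
  add_right_cancel _ _ _ h := add_right_cancel' h

instance : NoZeroDivisors M.N where
  eq_zero_or_eq_zero_of_mul_eq_zero {a b} h := by
    obtain rfl | ⟨a, rfl⟩ := eq_zero_or_eq_add_one a
    · exact .inl rfl
    obtain rfl | ⟨b, rfl⟩ := eq_zero_or_eq_add_one b
    · exact .inr rfl
    exact (add_one_ne_zero (a * b + a + b) (by rw [← h]; ring)).elim

instance : Nontrivial M.N := ⟨0, 1, fun h => add_one_ne_zero 0 (by rw [zero_add, h])⟩

instance : IsStrictOrderedRing M.N :=
  haveI : IsOrderedCancelAddMonoid M.N :=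
    { le_of_add_le_add_left := by
        rintro a b c ⟨d, hd⟩
        exact ⟨d, add_left_cancel (a := a) (by rw [hd, add_assoc])⟩ }
  have key : ∀ a b c : M.N, 0 < c → a < b → c * a < c * b := by
    intro a b c hc h
    obtain ⟨d, rfl⟩ := le_def.1 h.le
    have hd : d ≠ 0 := fun hd => by simp [hd] at h
    rw [mul_add]
    exact lt_add_of_pos_right _
      (pos_iff_ne_zero.2 (mul_ne_zero (pos_iff_ne_zero.1 hc) hd))
  { zero_le_one := ⟨1, (zero_add 1).symm⟩
    mul_lt_mul_of_pos_left := fun c hc a b h => key a b c hc h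
    mul_lt_mul_of_pos_right := fun c hc a b h => by
      simpa only [mul_comm] using key a b c hc h }

theorem lt_iff_add_one_le {a b : M.N} : a < b ↔ a + 1 ≤ b := by
  constructor
  · intro h
    obtain ⟨c, rfl⟩ := le_def.1 h.le
    obtain rfl | ⟨c, rfl⟩ := eq_zero_or_eq_add_one c
    · simp at h
    · exact ⟨c, by ring⟩
  · exact fun h => lt_of_lt_of_le (lt_add_one a) h

theorem lt_add_one_iff' {a b : M.N} : a < b + 1 ↔ a ≤ b := by
  rw [lt_iff_add_one_le, add_le_add_iff_right]

theorem one_le_of_pos {a : M.N} (h : 0 < a) : 1 ≤ a := by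
  simpa using lt_iff_add_one_le.1 h

end Model
end FinTypeArith

namespace FinTypeArith

/-! ## The ordered field generated by an ordered semiring -/

section OrderedField

variable (S : Type) [CommSemiring S] [LinearOrder S] [IsStrictOrderedRing S]

/-- Pairs with equal differences. -/
def diffSetoid : Setoid (S × S) where
  r p q := p.1 + q.2 = q.1 + p.2
  iseqv :=
    { refl := fun _ => rfl
      symm := fun h => h.symm
      trans := by
        rintro ⟨a, a'⟩ ⟨b, b'⟩ ⟨c, c'⟩ h₁ h₂
        simp only at h₁ h₂ ⊢
        refine add_right_cancel (b := b + b') ?_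
        calc a + c' + (b + b') = (a + b') + (b + c') := by ring
          _ = (b + a') + (c + b') := by rw [h₁, h₂]
          _ = c + a' + (b + b') := by ring }

/-- The ring of differences. -/
def Diff := Quotient (diffSetoid S)

namespace Diff

variable {S}

def mk (a b : S) : Diff S := Quotient.mk (diffSetoid S) (a, b)

theorem mk_eq_mk {a b c d : S} : mk a b = mk c d ↔ a + d = c + b :=
  Quotient.eq (r := diffSetoid S)

theorem ind {P : Diff S → Prop} (h : ∀ a b, P (mk a b)) (z : Diff S) : P z :=
  Quotient.inductionOn z fun p => h p.1 p.2

instance : Zero (Diff S) := ⟨mk 0 0⟩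
instance : One (Diff S) := ⟨mk 1 0⟩
instance : Neg (Diff S) :=
  ⟨Quotient.map (fun p : S × S => (p.2, p.1)) fun p q (h : p.1 + q.2 = q.1 + p.2) => by
    change p.2 + q.1 = q.2 + p.1
    rw [add_comm, ← h, add_comm]⟩
instance : Add (Diff S) :=
  ⟨Quotient.map₂ (fun p q : S × S => (p.1 + q.1, p.2 + q.2)) fun p p'
      (h : p.1 + p'.2 = p'.1 + p.2) q q' (h' : q.1 + q'.2 = q'.1 + q.2) => by
    change p.1 + q.1 + (p'.2 + q'.2) = p'.1 + q'.1 + (p.2 + q.2)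
    calc p.1 + q.1 + (p'.2 + q'.2) = (p.1 + p'.2) + (q.1 + q'.2) := by ring
      _ = p'.1 + q'.1 + (p.2 + q.2) := by rw [h, h']; ring⟩
instance : Mul (Diff S) :=
  ⟨Quotient.map₂ (fun p q : S × S => (p.1 * q.1 + p.2 * q.2, p.1 * q.2 + p.2 * q.1)) fun p p'
      (h : p.1 + p'.2 = p'.1 + p.2) q q' (h' : q.1 + q'.2 = q'.1 + q.2) => by
    change p.1 * q.1 + p.2 * q.2 + (p'.1 * q'.2 + p'.2 * q'.1) =
      p'.1 * q'.1 + p'.2 * q'.2 + (p.1 * q.2 + p.2 * q.1)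
    refine add_right_cancel (b := p'.2 * q.1 + p'.1 * q.2) ?_
    calc p.1 * q.1 + p.2 * q.2 + (p'.1 * q'.2 + p'.2 * q'.1) + (p'.2 * q.1 + p'.1 * q.2)
        = (p.1 + p'.2) * q.1 + (p'.1 + p.2) * q.2 + p'.1 * q'.2 + p'.2 * q'.1 := by ring
      _ = (p'.1 + p.2) * q.1 + (p.1 + p'.2) * q.2 + p'.1 * q'.2 + p'.2 * q'.1 := by rw [h]
      _ = p'.1 * (q.1 + q'.2) + p'.2 * (q'.1 + q.2) + p.2 * q.1 + p.1 * q.2 := by ring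
      _ = p'.1 * (q'.1 + q.2) + p'.2 * (q.1 + q'.2) + p.2 * q.1 + p.1 * q.2 := by rw [h']
      _ = _ := by ring⟩

theorem zero_def : (0 : Diff S) = mk 0 0 := rfl
theorem one_def : (1 : Diff S) = mk 1 0 := rfl
theorem neg_mk (a b : S) : -mk a b = mk b a := rfl
theorem mk_add_mk (a b c d : S) : mk a b + mk c d = mk (a + c) (b + d) := rfl
theorem mk_mul_mk (a b c d : S) : mk a b * mk c d = mk (a * c + b * d) (a * d + b * c) := rfl

instance : CommRing (Diff S) where
  add_assoc x y z := by
    induction x using ind; induction y using ind; induction z using ind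
    simp only [mk_add_mk, mk_eq_mk]; ring
  zero_add x := by
    induction x using ind
    simp only [zero_def, mk_add_mk, mk_eq_mk]; ring
  add_zero x := by
    induction x using ind
    simp only [zero_def, mk_add_mk, mk_eq_mk]; ring
  add_comm x y := by
    induction x using ind; induction y using ind
    simp only [mk_add_mk, mk_eq_mk]; ring
  left_distrib x y z := by
    induction x using ind; induction y using ind; induction z using ind
    simp only [mk_add_mk, mk_mul_mk, mk_eq_mk]; ring
  right_distrib x y z := by
    induction x using ind; induction y using ind; induction z using ind
    simp only [mk_add_mk, mk_mul_mk, mk_eq_mk]; ring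
  zero_mul x := by
    induction x using ind
    simp only [zero_def, mk_mul_mk, mk_eq_mk]; ring
  mul_zero x := by
    induction x using ind
    simp only [zero_def, mk_mul_mk, mk_eq_mk]; ring
  mul_assoc x y z := by
    induction x using ind; induction y using ind; induction z using ind
    simp only [mk_mul_mk, mk_eq_mk]; ring
  one_mul x := by
    induction x using ind
    simp only [one_def, mk_mul_mk, mk_eq_mk]; ring
  mul_one x := by
    induction x using ind
    simp only [one_def, mk_mul_mk, mk_eq_mk]; ring
  mul_comm x y := by
    induction x using ind; induction y using ind
    simp only [mk_mul_mk, mk_eq_mk]; ring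
  neg_add_cancel x := by
    induction x using ind
    simp only [zero_def, neg_mk, mk_add_mk, mk_eq_mk]; ring
  nsmul := nsmulRec
  zsmul := zsmulRec

/-- The inclusion of the semiring. -/
def ofSemiring : S →+* Diff S where
  toFun a := mk a 0
  map_one' := rfl
  map_zero' := rfl
  map_add' a b := by rw [mk_add_mk, add_zero]
  map_mul' a b := by rw [mk_mul_mk]; simp

theorem ofSemiring_injective : Function.Injective (ofSemiring : S → Diff S) := fun a b h => by
  have : mk a 0 = mk b 0 := h
  rw [mk_eq_mk] at this
  simpa using this

theorem mk_eq (a b : S) : mk a b = ofSemiring a - ofSemiring b := by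
  rw [sub_eq_add_neg]
  change _ = mk a 0 + -mk b 0
  rw [neg_mk, mk_add_mk, add_zero, zero_add]

variable [CanonicallyOrderedAdd S]

/-- The smaller component is subtracted from the larger, which canonical order permits. This makes
the order with cone `S` total. -/
theorem mem_or_neg (z : Diff S) : (∃ a, ofSemiring a = z) ∨ ∃ a, ofSemiring a = -z := by
  induction z using ind with | _ a b =>
  rcases le_total a b with h | h
  · obtain ⟨c, rfl⟩ := exists_add_of_le h
    exact .inr ⟨c, by rw [mk_eq, map_add]; ring⟩
  · obtain ⟨c, rfl⟩ := exists_add_of_le h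
    exact .inl ⟨c, by rw [mk_eq, map_add]; ring⟩

instance : Nontrivial (Diff S) := (ofSemiring_injective (S := S)).nontrivial

instance : NoZeroDivisors (Diff S) where
  eq_zero_or_eq_zero_of_mul_eq_zero {x y} h := by
    have key : ∀ a b : S, ofSemiring a * ofSemiring b = 0 →
        ofSemiring a = 0 ∨ ofSemiring b = 0 := by
      intro a b h
      rw [← map_mul, map_eq_zero_iff _ ofSemiring_injective, mul_eq_zero] at h
      exact h.imp (fun h => by rw [h, map_zero]) fun h => by rw [h, map_zero]
    rcases mem_or_neg x with ⟨a, ha⟩ | ⟨a, ha⟩ <;> rcases mem_or_neg y with ⟨b, hb⟩ | ⟨b, hb⟩ <;>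
      simpa [ha, hb, h] using key a b

instance : IsDomain (Diff S) := NoZeroDivisors.to_isDomain _

variable (S) in
/-- The elements of the semiring, as the cone of an order on the ring of differences. -/
def cone : RingCone (Diff S) where
  toSubsemiring := (ofSemiring (S := S)).rangeS
  eq_zero_of_mem_of_neg_mem' := by
    rintro _ ⟨a, rfl⟩ ⟨b, hb⟩
    have : ofSemiring (b + a) = 0 := by rw [map_add, hb, neg_add_cancel]
    rw [map_eq_zero_iff _ ofSemiring_injective] at this
    rw [(add_eq_zero.1 this).2, map_zero]

instance : HasMemOrNegMem (cone S) := ⟨mem_or_neg⟩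

open Classical in
noncomputable instance : LinearOrder (Diff S) := .mkOfAddGroupCone (cone S)

instance : IsOrderedRing (Diff S) := .mkOfCone (cone S)

instance : IsStrictOrderedRing (Diff S) := IsOrderedRing.toIsStrictOrderedRing _

theorem ofSemiring_nonneg (a : S) : 0 ≤ ofSemiring a := by
  change ofSemiring a - 0 ∈ cone S
  rw [sub_zero]
  exact ⟨a, rfl⟩

end Diff

/-! ### The order of the fraction field. -/

section FractionField

variable (R : Type) [CommRing R] [LinearOrder R] [IsStrictOrderedRing R]

/-- Fractions of nonnegative elements. -/
def fractionCone : RingCone (FractionRing R) where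
  carrier := {x | ∃ a b : R, 0 ≤ a ∧ 0 < b ∧ x * algebraMap R _ b = algebraMap R _ a}
  zero_mem' := ⟨0, 1, le_rfl, one_pos, by simp⟩
  one_mem' := ⟨1, 1, zero_le_one, one_pos, by simp⟩
  add_mem' := by
    rintro x y ⟨a, b, ha, hb, h⟩ ⟨c, d, hc, hd, h'⟩
    refine ⟨a * d + c * b, b * d, by positivity, by positivity, ?_⟩
    rw [map_mul, map_add, map_mul, map_mul, ← h, ← h']; ring
  mul_mem' := by
    rintro x y ⟨a, b, ha, hb, h⟩ ⟨c, d, hc, hd, h'⟩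
    refine ⟨a * c, b * d, by positivity, by positivity, ?_⟩
    rw [map_mul, map_mul, ← h, ← h']; ring
  eq_zero_of_mem_of_neg_mem' := by
    rintro x ⟨a, b, ha, hb, h⟩ ⟨c, d, hc, hd, h'⟩
    -- With `x = a/b` and `-x = c/d`, the sum of the nonnegative numbers `a d` and `c b` vanishes,
    -- so both do.
    have h₁ : algebraMap R (FractionRing R) (a * d + c * b) = 0 := by
      rw [map_add, map_mul, map_mul, ← h, ← h']; ring
    rw [map_eq_zero_iff _ (IsFractionRing.injective R (FractionRing R))] at h₁
    have h₂ : a * d = 0 := by nlinarith [mul_nonneg ha hd.le, mul_nonneg hc hb.le]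
    have h₃ : a = 0 := (mul_eq_zero.1 h₂).resolve_right hd.ne'
    rw [h₃, map_zero] at h
    refine (mul_eq_zero.1 h).resolve_right ?_
    change algebraMap R (FractionRing R) b ≠ 0
    rw [map_ne_zero_iff _ (IsFractionRing.injective R (FractionRing R))]
    exact hb.ne'

instance : HasMemOrNegMem (fractionCone R) where
  mem_or_neg_mem x := by
    obtain ⟨a, b, hb, rfl⟩ := IsFractionRing.div_surjective (A := R) x
    have key : ∀ a b : R, 0 < b → algebraMap R (FractionRing R) a / algebraMap R _ b ∈
        fractionCone R ∨ -(algebraMap R (FractionRing R) a / algebraMap R _ b) ∈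
        fractionCone R := by
      intro a b hb
      have hb' : algebraMap R (FractionRing R) b ≠ 0 := by
        rw [map_ne_zero_iff _ (IsFractionRing.injective R (FractionRing R))]
        exact hb.ne'
      rcases le_total 0 a with ha | ha
      · exact .inl ⟨a, b, ha, hb, div_mul_cancel₀ _ hb'⟩
      · refine .inr ⟨-a, b, neg_nonneg.2 ha, hb, ?_⟩
        rw [map_neg, neg_mul, div_mul_cancel₀ _ hb']
    rcases (nonZeroDivisors.ne_zero hb).lt_or_gt with h | h
    · have := key (-a) (-b) (neg_pos.2 h)
      have e : algebraMap R (FractionRing R) (-a) / algebraMap R (FractionRing R) (-b) =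
          algebraMap R (FractionRing R) a / algebraMap R (FractionRing R) b := by
        rw [map_neg, map_neg]
        exact neg_div_neg_eq _ _
      rwa [e] at this
    · exact key a b h

open Classical in
noncomputable instance : LinearOrder (FractionRing R) := .mkOfAddGroupCone (fractionCone R)

instance : IsOrderedRing (FractionRing R) := .mkOfCone (fractionCone R)

instance : IsStrictOrderedRing (FractionRing R) := IsOrderedRing.toIsStrictOrderedRing _

theorem algebraMap_nonneg {a : R} (ha : 0 ≤ a) : 0 ≤ algebraMap R (FractionRing R) a := by
  change algebraMap R (FractionRing R) a - 0 ∈ fractionCone R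
  rw [sub_zero]
  exact ⟨a, 1, ha, one_pos, by simp⟩

end FractionField

end OrderedField

/-! ### The rational numbers of a model. -/

namespace Model

variable {L : Lang} {T : Set (Fml L [])} (M : Model T)

/-- The ordered field of the rational numbers of the model. -/
def Q : Type := FractionRing (Diff M.N)

noncomputable instance : Field M.Q := inferInstanceAs (Field (FractionRing (Diff M.N)))
noncomputable instance : LinearOrder M.Q := inferInstanceAs (LinearOrder (FractionRing (Diff M.N)))
instance : IsStrictOrderedRing M.Q :=
  inferInstanceAs (IsStrictOrderedRing (FractionRing (Diff M.N)))

/-- The inclusion of the integers in the rational numbers. -/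
noncomputable def ofDiff : Diff M.N →+* M.Q :=
  (algebraMap (Diff M.N) (FractionRing (Diff M.N)) : Diff M.N →+* FractionRing (Diff M.N))

/-- The inclusion of the natural numbers in the rational numbers. -/
noncomputable def toQ : M.N →+* M.Q := M.ofDiff.comp Diff.ofSemiring

theorem toQ_nonneg (n : M.N) : 0 ≤ M.toQ n := algebraMap_nonneg _ (Diff.ofSemiring_nonneg n)

theorem ofDiff_injective : Function.Injective M.ofDiff :=
  IsFractionRing.injective (Diff M.N) (FractionRing (Diff M.N))

theorem exists_ofDiff_div (x : M.Q) : ∃ a b, b ≠ 0 ∧ M.ofDiff a / M.ofDiff b = x := by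
  obtain ⟨a, b, hb, h⟩ := IsFractionRing.div_surjective (A := Diff M.N)
    (K := FractionRing (Diff M.N)) x
  exact ⟨a, b, nonZeroDivisors.ne_zero hb, h⟩

theorem toQ_injective : Function.Injective M.toQ :=
  M.ofDiff_injective.comp Diff.ofSemiring_injective

@[simp] theorem toQ_le {a b : M.N} : M.toQ a ≤ M.toQ b ↔ a ≤ b := by
  have key : ∀ {a b : M.N}, a ≤ b → M.toQ a ≤ M.toQ b := by
    intro a b h
    obtain ⟨c, rfl⟩ := le_def.1 h
    rw [map_add]
    exact le_add_of_nonneg_right (M.toQ_nonneg c)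
  refine ⟨fun h => ?_, key⟩
  rcases le_total a b with h' | h'
  · exact h'
  · exact (M.toQ_injective (h.antisymm (key h'))).le

@[simp] theorem toQ_lt {a b : M.N} : M.toQ a < M.toQ b ↔ a < b := by
  rw [← not_le, ← not_le, toQ_le]

end Model
end FinTypeArith

namespace FinTypeArith

namespace Model

variable {L : Lang} {T : Set (Fml L [])} (M : Model T)

/-! ### Bounded search and pairing -/

theorem sat_neg {Γ : Ctx} (e : M.Env Γ) (A : Fml L Γ) : M.Sat e (neg A) ↔ ¬ M.Sat e A :=
  ⟨fun h h' => M.zero_ne_one (h h'), fun h h' => (h h').elim⟩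

@[simp] theorem predS_zero : M.predS 0 = 0 := by
  unfold predS predC
  rw [M.app_lam, M.eval_natRec]
  exact M.nrec_zero _ _

@[simp] theorem predS_add_one (n : M.N) : M.predS (n + 1) = n := by
  rw [← succ_eq]
  unfold predS predC
  rw [M.app_lam, M.eval_natRec]
  change M.nrec (M.succ n) _ _ = n
  rw [nrec_succ, M.app_lam, M.app_lam]
  rfl

theorem subS_eq (a b : M.N) :
    M.subS a b = M.nrec b a (M.eval (b ∷ a ∷ Interp.nil) (pred x1).lam.lam) := by
  unfold subS subC
  rw [M.app_lam, M.app_lam, M.eval_natRec]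
  rfl

@[simp] theorem subS_zero (a : M.N) : M.subS a 0 = a := by rw [subS_eq, nrec_zero]

theorem subS_add_one (a b : M.N) : M.subS a (b + 1) = M.predS (M.subS a b) := by
  rw [← succ_eq, subS_eq, nrec_succ, M.app_lam, M.app_lam, subS_eq]
  simp only [eval_pred, Interp.eval_var, Interp.cons_z, Interp.cons_s]
  exact congrArg M.predS (M.nrec_congr _ _ (by simp))

theorem subS_add_one_add_one (a b : M.N) : M.subS (a + 1) (b + 1) = M.subS a b :=
  M.induct' (P := fun b => M.subS (a + 1) (b + 1) = M.subS a b)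
    (.eq (sub (S x1) (S x0)) (sub x1 x0)) (a ∷ Interp.nil) (by simp [Interp.Sat, succ_eq])
    (by rw [subS_add_one]; simp)
    (fun n ih => by rw [subS_add_one, ih, ← subS_add_one]) b

@[simp] theorem subS_add_self (a b : M.N) : M.subS (a + b) b = a :=
  M.induct' (P := fun b => M.subS (a + b) b = a)
    (.eq (sub (add x1 x0) x0) x1) (a ∷ Interp.nil) (by simp [Interp.Sat])
    (by simp) (fun n ih => by rw [← add_assoc, subS_add_one_add_one, ih]) b

@[simp] theorem subS_self_add (a b : M.N) : M.subS a (a + b) = 0 := by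
  have h0 : ∀ b, M.subS 0 b = 0 := fun b =>
    M.induct' (P := fun b => M.subS 0 b = 0) (.eq (sub O x0) O) Interp.nil
      (by simp [Interp.Sat]) (by simp) (fun n ih => by rw [subS_add_one, ih, predS_zero]) b
  exact M.induct' (P := fun a => M.subS a (a + b) = 0)
    (.eq (sub x0 (add x0 x1)) O) (b ∷ Interp.nil) (by simp [Interp.Sat])
    (by rw [h0]) (fun n ih => by rw [add_right_comm, subS_add_one_add_one, ih]) a

theorem subS_of_le {a b : M.N} (h : a ≤ b) : M.subS a b = 0 := by
  obtain ⟨c, rfl⟩ := le_def.1 h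
  simp

theorem subS_eq_zero {a b : M.N} : M.subS a b = 0 ↔ a ≤ b := by
  refine ⟨fun h => ?_, M.subS_of_le⟩
  rcases le_total a b with h' | h'
  · exact h'
  · obtain ⟨c, rfl⟩ := le_def.1 h'
    rw [add_comm, subS_add_self] at h
    simp [h]

theorem sat_leN {Γ : Ctx} (e : M.Env Γ) (s t : Tm L Γ nat) :
    M.Sat e (leN s t) ↔ M.eval e s ≤ M.eval e t := by
  rw [← subS_eq_zero]; simp [leN, Interp.Sat]

open Classical in
theorem iteS_eq (c a b : M.N) : M.iteS c a b = if c = 0 then a else b := by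
  unfold iteS iteC
  rw [M.app_lam, M.app_lam, M.app_lam, M.eval_natRec]
  obtain rfl | ⟨c, rfl⟩ := eq_zero_or_eq_add_one c
  · rw [if_pos rfl]
    exact M.nrec_zero _ _
  · rw [if_neg (add_one_ne_zero c), ← succ_eq]
    change M.nrec (M.succ c) _ _ = _
    rw [nrec_succ, M.app_lam, M.app_lam]
    rfl

@[simp] theorem pow2S_zero : M.pow2S 0 = 1 := by
  unfold pow2S pow2C
  rw [M.app_lam, M.eval_natRec]
  exact M.nrec_zero _ _

theorem pow2S_add_one (n : M.N) : M.pow2S (n + 1) = M.pow2S n + M.pow2S n := by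
  rw [← succ_eq]
  unfold pow2S pow2C
  simp only [M.app_lam, M.eval_natRec, Interp.eval_var, Interp.cons_z, nrec_succ, eval_add,
    Interp.cons_s]
  exact congrArg₂ (· + ·) (M.nrec_congr _ _ (by simp)) (M.nrec_congr _ _ (by simp))

theorem add_one_le_pow2S (n : M.N) : n + 1 ≤ M.pow2S n :=
  M.induct' (P := fun n => n + 1 ≤ M.pow2S n) (leN (add x0 (S O)) (pow2 x0)) Interp.nil
    (by simp [sat_leN, succ_eq]) (by simp)
    (fun n ih => by
      rw [pow2S_add_one]
      exact add_le_add ih (le_trans (by simp) ih)) n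

theorem pow2S_add (m n : M.N) : M.pow2S (m + n) = M.pow2S m * M.pow2S n :=
  M.induct' (P := fun n => M.pow2S (m + n) = M.pow2S m * M.pow2S n)
    (.eq (pow2 (add x1 x0)) (mul (pow2 x1) (pow2 x0))) (m ∷ Interp.nil)
    (by simp [Interp.Sat]) (by simp)
    (fun n ih => by rw [← add_assoc, pow2S_add_one, ih, pow2S_add_one]; ring) n

theorem distS_eq_zero {a b : M.N} : M.distS a b = 0 ↔ a = b := by
  have : M.distS a b = M.subS a b + M.subS b a := by
    unfold distS distC; simp
  rw [this, add_eq_zero, subS_eq_zero, subS_eq_zero, le_antisymm_iff]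

/-- While no zero of `P` has been met the value is the bound itself; once it is a zero it is kept.
The three clauses form one induction formula, with the bounded quantifier written through `leN`. -/
theorem searchS_spec (P : M.carrier one) (n : M.N) :
    M.searchS P n ≤ n ∧ (∀ k, k < M.searchS P n → M.app P k ≠ 0) ∧
      (n ≤ M.searchS P n ∨ M.app P (M.searchS P n) = 0) := by
  have hS : ∀ n, M.searchS P n = M.nrec n 0 (M.eval (n ∷ P ∷ Interp.nil)
      (ite (x3 ⬝ x1) x1 (S x0)).lam.lam) := by
    intro n
    unfold searchS searchC
    simp
  have h0 : M.searchS P 0 = 0 := by rw [hS, nrec_zero]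
  have hs : ∀ n, M.searchS P (n + 1) =
      M.iteS (M.app P (M.searchS P n)) (M.searchS P n) (n + 1) := by
    intro n
    -- The two step functions differ only in a parameter which they ignore.
    have e : M.nrec n 0 (M.eval (M.succ n ∷ P ∷ Interp.nil)
        (ite (x3 ⬝ x1) x1 (S x0)).lam.lam) = M.searchS P n := by
      rw [hS]
      exact M.nrec_congr _ _ (by simp)
    rw [← succ_eq, hS, nrec_succ, e]
    simp
  refine M.induct' (P := fun n => M.searchS P n ≤ n ∧ (∀ k, k < M.searchS P n → M.app P k ≠ 0) ∧
      (n ≤ M.searchS P n ∨ M.app P (M.searchS P n) = 0))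
    (leN (search x1 x0) x0 ⊓ₗ .all nat (leN (add x0 (S O)) (search x2 x1) ⟶ₗ
      neg (.eq (x2 ⬝ x0) O)) ⊓ₗ .or (leN x0 (search x1 x0)) (.eq (x1 ⬝ search x1 x0) O))
    (P ∷ Interp.nil) ?_ ?_ ?_ n
  · intro n
    simp [Interp.Sat, sat_leN, sat_neg, succ_eq, lt_iff_add_one_le]
  · simp [h0]
  · rintro n ⟨h₁, h₂, h₃⟩
    rw [hs, iteS_eq]
    split_ifs with h
    · exact ⟨h₁.trans (by simp), h₂, .inr h⟩
    · have h₄ : M.searchS P n = n := h₁.antisymm (h₃.resolve_right h)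
      rw [h₄] at h h₂
      refine ⟨le_rfl, fun k hk => ?_, .inl le_rfl⟩
      rcases (lt_add_one_iff'.1 hk).eq_or_lt with rfl | hk
      · exact h
      · exact h₂ k hk

theorem bminS_eq {P : M.carrier one} {b k : M.N} (hk : k ≤ b) (h : M.app P k = 0)
    (h' : ∀ j, j < k → M.app P j ≠ 0) : M.bminS P b = k := by
  have hb : M.bminS P b = M.iteS (M.subS (M.searchS P (b + 1)) b) (M.searchS P (b + 1)) 0 := by
    unfold bminS bminC
    simp [succ_eq]
  obtain ⟨_, h₂, h₃⟩ := M.searchS_spec P (b + 1)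
  have hs : M.searchS P (b + 1) = k := by
    rcases lt_trichotomy (M.searchS P (b + 1)) k with hlt | heq | hgt
    · rcases h₃ with h₃ | h₃
      · exact absurd (h₃.trans (hlt.le.trans hk)) (not_le.2 (lt_add_one b))
      · exact (h' _ hlt h₃).elim
    · exact heq
    · exact (h₂ k hgt h).elim
  rw [hb, hs, subS_of_le M hk, iteS_eq, if_pos rfl]

/-- Evenness of `n² + n` guarantees that the minimisation defining the pairing function succeeds. -/
theorem exists_add_self (n : M.N) : ∃ u, u + u = n * n + n :=
  M.induct' (P := fun n => ∃ u, u + u = n * n + n)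
    (.ex nat (.eq (add x0 x0) (add (mul x1 x1) x1))) Interp.nil
    (by simp [Interp.Sat]) ⟨0, by simp⟩
    (fun n ⟨u, hu⟩ => ⟨u + (n + 1), by
      calc u + (n + 1) + (u + (n + 1)) = u + u + (n + 1 + (n + 1)) := by ring
        _ = _ := by rw [hu]; ring⟩) n

theorem add_self_inj {a b : M.N} (h : a + a = b + b) : a = b := by
  rcases lt_trichotomy a b with h' | h' | h'
  · exact absurd h (add_lt_add h' h').ne
  · exact h'
  · exact absurd h (add_lt_add h' h').ne'

/-- With `s = a + b` the polynomial `cantorC` is `s² + s + 2a`, which is even; its half is the value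
found by the bounded search. -/
theorem pairS_add_pairS (a b : M.N) :
    M.pairS a b + M.pairS a b = (a + b) * (a + b) + (a + b) + (a + a) := by
  obtain ⟨u, hu⟩ := M.exists_add_self (a + b)
  have hc : M.cantorS a b = (u + a) + (u + a) := by
    have : M.cantorS a b = (a + b) * (a + b) + (a + a + a) + b := by
      unfold cantorS cantorC; simp
    rw [this]
    calc (a + b) * (a + b) + (a + a + a) + b = (a + b) * (a + b) + (a + b) + (a + a) := by ring
      _ = _ := by rw [← hu]; ring
  have hp : M.pairS a b = u + a := by
    unfold pairS pairC
    simp only [app_lam, eval_bmin]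
    refine M.bminS_eq ?_ ?_ ?_
    · simp only [eval_cantorC, Interp.eval_app, Interp.eval_var, Interp.cons_z, Interp.cons_s, hc]
      exact le_self_add
    · simp [distS_eq_zero, hc]
    · intro j hj
      simp only [app_lam, eval_dist, eval_add, Interp.eval_app, Interp.eval_var, Interp.cons_z,
        Interp.cons_s, eval_cantorC, hc, ne_eq, distS_eq_zero]
      exact fun h => hj.ne (M.add_self_inj h)
  rw [hp, ← hu]; ring

/-- With `s = a + b`, twice the code is `s² + s + 2a ≤ s² + 3s`, which is less than `(s+1)² +
(s+1)`. So the code determines `s`, then `a`, then `b`. -/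
theorem pairS_inj {a b a' b' : M.N} (h : M.pairS a b = M.pairS a' b') : a = a' ∧ b = b' := by
  have h₁ : (a + b) * (a + b) + (a + b) + (a + a) =
      (a' + b') * (a' + b') + (a' + b') + (a' + a') := by
    rw [← pairS_add_pairS, h, pairS_add_pairS]
  have key : ∀ a b a' b' : M.N, (a + b) * (a + b) + (a + b) + (a + a) =
      (a' + b') * (a' + b') + (a' + b') + (a' + a') → ¬ a + b < a' + b' := by
    intro a b a' b' h hlt
    have h₂ := congrArg M.toQ h
    have h₃ := M.toQ_le.2 (lt_iff_add_one_le.1 hlt)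
    simp only [map_add, map_mul, map_one] at h₂ h₃
    nlinarith [M.toQ_nonneg a, M.toQ_nonneg b, M.toQ_nonneg a', M.toQ_nonneg b']
  have hs : a + b = a' + b' := le_antisymm (not_lt.1 (key _ _ _ _ h₁.symm)) (not_lt.1 (key _ _ _ _ h₁))
  rw [hs] at h₁
  obtain rfl := M.add_self_inj (add_left_cancel h₁)
  exact ⟨rfl, add_left_cancel hs⟩

theorem left_le_pairS (a b : M.N) : a ≤ M.pairS a b := by
  have h₂ := congrArg M.toQ (M.pairS_add_pairS a b)
  rw [← toQ_le]
  simp only [map_add, map_mul] at h₂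
  nlinarith [M.toQ_nonneg a, M.toQ_nonneg b, mul_nonneg (M.toQ_nonneg a) (M.toQ_nonneg b)]

theorem right_le_pairS (a b : M.N) : b ≤ M.pairS a b := by
  have h₂ := congrArg M.toQ (M.pairS_add_pairS a b)
  rw [← toQ_le]
  simp only [map_add, map_mul] at h₂
  obtain rfl | ⟨c, rfl⟩ := eq_zero_or_eq_add_one b
  · simp [M.toQ_nonneg]
  · simp only [map_add, map_one] at h₂ ⊢
    nlinarith [M.toQ_nonneg a, M.toQ_nonneg c, mul_nonneg (M.toQ_nonneg a) (M.toQ_nonneg c),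
      mul_nonneg (M.toQ_nonneg c) (M.toQ_nonneg c)]

@[simp] theorem fstS_pairS (a b : M.N) : M.fstS (M.pairS a b) = a := by
  unfold fstS fstC
  simp only [app_lam, eval_bmin]
  refine M.bminS_eq (M.left_le_pairS a b) ?_ ?_
  · simp only [app_lam, eval_dist, eval_pair, eval_bmin, Interp.eval_var, Interp.cons_z,
      Interp.cons_s, distS_eq_zero]
    congr 1
    refine M.bminS_eq (M.right_le_pairS a b) ?_ ?_
    · simp [distS_eq_zero]
    · intro j hj
      simp only [app_lam, eval_dist, eval_pair, Interp.eval_var, Interp.cons_z,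
        Interp.cons_s, ne_eq, distS_eq_zero]
      exact fun h => hj.ne (M.pairS_inj h).2
  · intro j hj
    simp only [app_lam, eval_dist, eval_pair, Interp.eval_var, Interp.cons_z,
      Interp.cons_s, ne_eq, distS_eq_zero]
    exact fun h => hj.ne (M.pairS_inj h).1

@[simp] theorem sndS_pairS (a b : M.N) : M.sndS (M.pairS a b) = b := by
  unfold sndS sndC
  simp only [app_lam, eval_bmin]
  refine M.bminS_eq (M.right_le_pairS a b) ?_ ?_
  · simp only [app_lam, eval_dist, eval_pair, eval_bmin, Interp.eval_var, Interp.cons_z,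
      Interp.cons_s, distS_eq_zero]
    congr 1
    refine M.bminS_eq (M.left_le_pairS a b) ?_ ?_
    · simp [distS_eq_zero]
    · intro j hj
      simp only [app_lam, eval_dist, eval_pair, Interp.eval_var, Interp.cons_z,
        Interp.cons_s, ne_eq, distS_eq_zero]
      exact fun h => hj.ne (M.pairS_inj h).1
  · intro j hj
    simp only [app_lam, eval_dist, eval_pair, Interp.eval_var, Interp.cons_z,
      Interp.cons_s, ne_eq, distS_eq_zero]
    exact fun h => hj.ne (M.pairS_inj h).2

theorem halfS_spec {a k : M.N} (h : a ≤ k + k + 1) (h' : k + k ≤ a) : M.halfS a = k := by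
  unfold halfS halfC
  simp only [app_lam, eval_bmin]
  refine M.bminS_eq (le_trans le_self_add h') ?_ ?_
  · simpa [subS_eq_zero, succ_eq] using h
  · intro j hj
    simp only [app_lam, eval_sub, eval_S, eval_add, Interp.eval_var, Interp.cons_z,
      Interp.cons_s, ne_eq, subS_eq_zero, succ_eq]
    intro hle
    have h₁ := lt_iff_add_one_le.1 hj
    have h₂ := (add_le_add h₁ h₁).trans (h'.trans hle)
    have h₃ : j + 1 + (j + 1) = j + j + 1 + 1 := by ring
    rw [h₃] at h₂
    exact absurd h₂ (not_le.2 (lt_add_one _))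

theorem oddS_eq (a : M.N) : M.oddS a = M.subS a (M.halfS a + M.halfS a) := by
  unfold oddS oddC; simp

/-! ### Rational numbers -/

theorem posS_eq (q : M.N) :
    M.posS q = M.iteS (M.oddS (M.fstS q)) (M.halfS (M.fstS q)) 0 := by
  unfold posS posC; simp

theorem negS_eq (q : M.N) :
    M.negS q = M.iteS (M.oddS (M.fstS q)) 0 (M.halfS (M.fstS q) + 1) := by
  unfold negS negC; simp [succ_eq]

theorem denS_eq (q : M.N) : M.denS q = M.sndS q + 1 := by
  unfold denS denC; simp [succ_eq]

theorem posS_eq_zero_or (q : M.N) : M.posS q = 0 ∨ M.negS q = 0 := by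
  rw [posS_eq, negS_eq, iteS_eq, iteS_eq]
  split_ifs
  · exact .inr rfl
  · exact .inl rfl

/-- The rational number with a given code. -/
noncomputable def val (q : M.N) : M.Q := (M.toQ (M.posS q) - M.toQ (M.negS q)) / M.toQ (M.denS q)

theorem den_pos (q : M.N) : 0 < M.toQ (M.denS q) := by
  rw [denS_eq, map_add, map_one]
  linarith [M.toQ_nonneg (M.sndS q)]

theorem val_pairS_even (a d : M.N) : M.val (M.pairS (a + a) d) = M.toQ a / (M.toQ d + 1) := by
  have hh : M.halfS (a + a) = a := M.halfS_spec le_self_add le_rfl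
  have ho : M.oddS (a + a) = 0 := by rw [oddS_eq, hh]; exact M.subS_of_le le_rfl
  rw [val, posS_eq, negS_eq, denS_eq, fstS_pairS, sndS_pairS, hh, ho, iteS_eq, iteS_eq,
    if_pos rfl, if_pos rfl]
  simp

theorem val_pairS_odd (a d : M.N) :
    M.val (M.pairS (a + a + 1) d) = -(M.toQ a + 1) / (M.toQ d + 1) := by
  have hh : M.halfS (a + a + 1) = a := M.halfS_spec le_rfl le_self_add
  have ho : M.oddS (a + a + 1) = 1 := by rw [oddS_eq, hh, add_comm, subS_add_self]
  rw [val, posS_eq, negS_eq, denS_eq, fstS_pairS, sndS_pairS, hh, ho, iteS_eq, iteS_eq,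
    if_neg one_ne_zero, if_neg one_ne_zero]
  simp

theorem val_mkQS (p n d : M.N) : M.val (M.mkQS p n d) =
    (M.toQ p - M.toQ n) / (M.toQ (M.predS d) + 1) := by
  have h : M.mkQS p n d = M.pairS (M.subS p n + M.subS p n +
      M.predS (M.subS n p + M.subS n p)) (M.predS d) := by
    unfold mkQS mkQC; simp
  rw [h]
  -- At most one of the truncated differences is nonzero. If `n = p + 1 + m`, the numerator code is
  -- `2m + 1`, which stands for `-(m + 1)`.
  rcases le_or_gt n p with hle | hlt
  · obtain ⟨m, rfl⟩ := le_def.1 hle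
    rw [subS_self_add, add_comm n, subS_add_self, add_zero, predS_zero, add_zero, val_pairS_even,
      map_add, add_sub_cancel_right]
  · obtain ⟨m, hm⟩ := le_def.1 (lt_iff_add_one_le.1 hlt)
    rw [add_assoc] at hm
    subst hm
    rw [subS_self_add, add_comm p, subS_add_self, add_zero, zero_add,
      show 1 + m + (1 + m) = m + m + 1 + 1 by ring, predS_add_one, val_pairS_odd]
    simp only [map_add, map_one]
    ring

theorem val_mkQS' {p n d : M.N} (hd : 0 < M.toQ d) : M.val (M.mkQS p n d) =
    (M.toQ p - M.toQ n) / M.toQ d := by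
  rw [val_mkQS]
  obtain rfl | ⟨c, rfl⟩ := eq_zero_or_eq_add_one d
  · simp at hd
  · rw [predS_add_one, map_add, map_one]

@[simp] theorem val_addQS (q r : M.N) : M.val (M.addQS q r) = M.val q + M.val r := by
  have h : M.addQS q r = M.mkQS (M.posS q * M.denS r + M.posS r * M.denS q)
      (M.negS q * M.denS r + M.negS r * M.denS q) (M.denS q * M.denS r) := by
    unfold addQS addQC; simp
  have hq := M.den_pos q
  have hr := M.den_pos r
  rw [h, val_mkQS' M (by rw [map_mul]; positivity), val, val]
  simp only [map_add, map_mul]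
  field_simp
  ring

@[simp] theorem val_negQS (q : M.N) : M.val (M.negQS q) = -M.val q := by
  have h : M.negQS q = M.mkQS (M.negS q) (M.posS q) (M.denS q) := by
    unfold negQS negQC; simp
  rw [h, val_mkQS' M (M.den_pos q), val]
  ring

@[simp] theorem val_absQS (q : M.N) : M.val (M.absQS q) = |M.val q| := by
  have h : M.absQS q = M.mkQS (M.posS q + M.negS q) 0 (M.denS q) := by
    unfold absQS absQC; simp
  rw [h, val_mkQS' M (M.den_pos q), val, abs_div, abs_of_pos (M.den_pos q), map_zero, sub_zero,
    map_add]
  rcases M.posS_eq_zero_or q with h | h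
  · rw [h, map_zero, zero_add, zero_sub, abs_neg, abs_of_nonneg (M.toQ_nonneg _)]
  · rw [h, map_zero, add_zero, sub_zero, abs_of_nonneg (M.toQ_nonneg _)]

@[simp] theorem val_mulQS (q r : M.N) : M.val (M.mulQS q r) = M.val q * M.val r := by
  have h : M.mulQS q r = M.mkQS (M.posS q * M.posS r + M.negS q * M.negS r)
      (M.posS q * M.negS r + M.negS q * M.posS r) (M.denS q * M.denS r) := by
    unfold mulQS mulQC; simp
  have hq := M.den_pos q
  have hr := M.den_pos r
  rw [h, val_mkQS' M (by rw [map_mul]; positivity), val, val]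
  simp only [map_add, map_mul]
  field_simp
  ring

@[simp] theorem val_invQS (q : M.N) : M.val (M.invQS q) = (M.val q)⁻¹ := by
  have h : M.invQS q = M.mkQS (M.iteS (M.posS q) 0 (M.denS q)) (M.iteS (M.negS q) 0 (M.denS q))
      (M.posS q + M.negS q) := by
    unfold invQS invQC; simp
  have hq := M.den_pos q
  -- For `q = 0` both numerator arguments of `mkQ` vanish, so the term has value `0`, in agreement
  -- with the convention `0⁻¹ = 0`.
  by_cases h0 : M.posS q + M.negS q = 0
  · obtain ⟨h₁, h₂⟩ := add_eq_zero.1 h0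
    rw [h, val_mkQS, val, h₁, h₂, iteS_eq, if_pos rfl]
    simp
  · have hpos : 0 < M.toQ (M.posS q + M.negS q) := by
      rw [← map_zero M.toQ, toQ_lt]; exact pos_iff_ne_zero.2 h0
    rw [h, val_mkQS' M hpos, val, iteS_eq, iteS_eq]
    rcases M.posS_eq_zero_or q with h₁ | h₁
    · have h₂ : M.negS q ≠ 0 := fun h₂ => h0 (by rw [h₁, h₂, add_zero])
      rw [if_pos h₁, if_neg h₂, h₁, map_zero, zero_add, zero_sub, zero_sub, inv_div]
      rw [neg_div, div_neg]
    · have h₂ : M.posS q ≠ 0 := fun h₂ => h0 (by rw [h₁, h₂, add_zero])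
      rw [if_neg h₂, if_pos h₁, h₁, map_zero, add_zero, sub_zero, sub_zero, inv_div]

theorem leQS_eq_zero {q r : M.N} : M.leQS q r = 0 ↔ M.val q ≤ M.val r := by
  have h : M.leQS q r = M.subS (M.posS q * M.denS r + M.negS r * M.denS q)
      (M.posS r * M.denS q + M.negS q * M.denS r) := by
    unfold leQS leQC; simp
  rw [h, subS_eq_zero, ← toQ_le, val, val, div_le_div_iff₀ (M.den_pos q) (M.den_pos r)]
  simp only [map_add, map_mul]
  constructor <;> intro h <;> linarith

theorem ltQS_eq_zero {q r : M.N} : M.ltQS q r = 0 ↔ M.val q < M.val r := by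
  have h : M.ltQS q r = M.subS (M.posS q * M.denS r + M.negS r * M.denS q + 1)
      (M.posS r * M.denS q + M.negS q * M.denS r) := by
    unfold ltQS ltQC; simp [succ_eq]
  rw [h, subS_eq_zero, ← lt_iff_add_one_le, ← toQ_lt, val, val,
    div_lt_div_iff₀ (M.den_pos q) (M.den_pos r)]
  simp only [map_add, map_mul]
  constructor <;> intro h <;> linarith

/-- `O` is the code `j(0, 0)`, and `invRC` uses it as the rational number zero. -/
theorem val_pairS_zero : M.val 0 = 0 := by
  have h : M.pairS 0 0 = 0 := by
    have := M.pairS_add_pairS 0 0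
    simpa using this
  have := M.val_pairS_even 0 0
  rw [add_zero, h] at this
  simpa using this

@[simp] theorem eval_twoNegQ {Γ : Ctx} (e : M.Env Γ) (t : Tm L Γ nat) :
    M.eval e (twoNegQ t) = M.pairS (1 + 1) (M.predS (M.pow2S (M.eval e t))) := by
  simp [twoNegQ, succ_eq]

/-- The rational number `2⁻ⁿ`. -/
noncomputable def eps (n : M.N) : M.Q := (M.toQ (M.pow2S n))⁻¹

theorem pow2_pos (n : M.N) : 0 < M.toQ (M.pow2S n) := by
  have := M.toQ_le.2 (M.add_one_le_pow2S n)
  rw [map_add, map_one] at this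
  linarith [M.toQ_nonneg n]

theorem eps_pos (n : M.N) : 0 < M.eps n := inv_pos.2 (M.pow2_pos n)

@[simp] theorem eps_zero : M.eps 0 = 1 := by simp [eps]

theorem eps_add (m n : M.N) : M.eps (m + n) = M.eps m * M.eps n := by
  simp [eps, pow2S_add, mul_comm]

theorem eps_add_one (n : M.N) : M.eps (n + 1) = M.eps n / 2 := by
  rw [eps, eps, pow2S_add_one, map_add, ← two_mul, mul_inv]; ring

theorem eps_one : M.eps 1 = 1 / 2 := by
  have := M.eps_add_one 0
  rwa [zero_add, eps_zero] at this

@[simp] theorem val_twoNeg (n : M.N) :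
    M.val (M.pairS (1 + 1) (M.predS (M.pow2S n))) = M.eps n := by
  rw [val_pairS_even, map_one, eps]
  obtain h | ⟨c, h⟩ := eq_zero_or_eq_add_one (M.pow2S n)
  · have := M.pow2_pos n
    simp [h] at this
  · rw [h, predS_add_one, map_add, map_one, one_div]

/-- The Archimedean property relative to the numbers of the model: a fraction is bounded by its
numerator, since a nonzero integer of the model has absolute value at least `1`. -/
theorem exists_toQ_ge (x : M.Q) : ∃ n, x ≤ M.toQ n := by
  have key : ∀ z : Diff M.N, ∃ a : M.N,
      |M.ofDiff z| = M.toQ a := by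
    intro z
    rcases Diff.mem_or_neg z with ⟨a, ha⟩ | ⟨a, ha⟩
    · refine ⟨a, ?_⟩
      rw [← ha]
      exact abs_of_nonneg (M.toQ_nonneg a)
    · refine ⟨a, ?_⟩
      rw [← neg_eq_iff_eq_neg] at ha
      rw [← ha, map_neg]
      exact (abs_neg (M.toQ a)).trans (abs_of_nonneg (M.toQ_nonneg a))
  obtain ⟨a, b, hb, h⟩ := M.exists_ofDiff_div x
  obtain ⟨m, hm⟩ := key a
  obtain ⟨k, hk⟩ := key b
  refine ⟨m, (le_abs_self x).trans ?_⟩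
  have hb' : M.ofDiff b ≠ 0 := (map_ne_zero_iff _ M.ofDiff_injective).2 hb
  have hk0 : k ≠ 0 := by
    rintro rfl
    rw [map_zero, abs_eq_zero] at hk
    exact hb' hk
  have hk1 : (1 : M.Q) ≤ M.toQ k := by
    rw [← map_one M.toQ, toQ_le]; exact one_le_of_pos (pos_iff_ne_zero.2 hk0)
  have hx : |x| = M.toQ m / M.toQ k := by
    rw [← hm, ← hk, ← abs_div]
    exact congrArg _ h.symm
  rw [hx]
  exact div_le_self (M.toQ_nonneg m) hk1

theorem exists_eps_lt {x : M.Q} (hx : 0 < x) : ∃ n, M.eps n < x := by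
  obtain ⟨n, hn⟩ := M.exists_toQ_ge x⁻¹
  refine ⟨n, ?_⟩
  have h₁ : x⁻¹ < M.toQ (M.pow2S n) := by
    refine lt_of_le_of_lt hn (M.toQ_lt.2 ?_)
    rw [lt_iff_add_one_le]
    exact M.add_one_le_pow2S n
  rw [eps]
  exact inv_lt_of_inv_lt₀ hx h₁

end Model
end FinTypeArith

namespace FinTypeArith

namespace Model

variable {L : Lang} {T : Set (Fml L [])} (M : Model T)

/-! ### Regular sequences -/

theorem eps_le {m n : M.N} (h : m ≤ n) : M.eps n ≤ M.eps m := by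
  obtain ⟨c, rfl⟩ := le_def.1 h
  rw [eps_add]
  refine mul_le_of_le_one_right (M.eps_pos m).le (inv_le_one_of_one_le₀ ?_)
  rw [← map_one M.toQ, toQ_le]
  exact le_trans (by simp) (M.add_one_le_pow2S c)

/-- The sequence of rational numbers given by a name of a real number. -/
noncomputable def seq (f : M.carrier one) (n : M.N) : M.Q := M.val (M.app (M.hatS f) n)

/-- The jump test in the definition of `hat`. -/
def jump (f : M.carrier one) : M.carrier one :=
  M.eval (f ∷ Interp.nil) (Tm.lam (leQC ⬝ twoNegQ (S x0) ⬝ absQ (subQ (x1 ⬝ x0) (x1 ⬝ S x0))))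

theorem jump_eq_zero (f : M.carrier one) (k : M.N) : M.app (M.jump f) k = 0 ↔
    M.eps (k + 1) ≤ |M.val (M.app f k) - M.val (M.app f (k + 1))| := by
  unfold jump
  rw [app_lam]
  simp only [Interp.eval_app, eval_leQC, eval_twoNegQ, eval_absQ, subQ, eval_addQ, eval_negQ,
    Interp.eval_var, Interp.cons_z, Interp.cons_s, eval_S, succ_eq, leQS_eq_zero, val_twoNeg,
    val_absQS, val_addQS, val_negQS, ← sub_eq_add_neg]

theorem searchS_eq {P : M.carrier one} {n k : M.N} (hk : k ≤ n)
    (h : k = n ∨ M.app P k = 0) (h' : ∀ j, j < k → M.app P j ≠ 0) : M.searchS P n = k := by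
  obtain ⟨h₁, h₂, h₃⟩ := M.searchS_spec P n
  rcases lt_trichotomy (M.searchS P n) k with hlt | heq | hgt
  · rcases h₃ with h₃ | h₃
    · exact absurd (hlt.trans_le (hk.trans h₃)) (lt_irrefl _)
    · exact (h' _ hlt h₃).elim
  · exact heq
  · rcases h with rfl | h
    · exact absurd (hgt.trans_le h₁) (lt_irrefl _)
    · exact (h₂ k hgt h).elim

theorem searchS_congr {P P' : M.carrier one} (h : ∀ k, M.app P k = 0 ↔ M.app P' k = 0) (n : M.N) :
    M.searchS P n = M.searchS P' n := by
  obtain ⟨h₁, h₂, h₃⟩ := M.searchS_spec P' n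
  refine M.searchS_eq h₁ (h₃.imp (fun h₃ => h₁.antisymm h₃) (h _).2) fun j hj h0 => ?_
  exact h₂ j hj ((h j).1 h0)

theorem hatS_app (f : M.carrier one) (n : M.N) :
    M.app (M.hatS f) n = M.app f (M.searchS (M.jump f) n) := by
  have : M.app (M.hatS f) n = M.app f (M.searchS (M.eval (n ∷ f ∷ Interp.nil)
      (Tm.lam (leQC ⬝ twoNegQ (S x0) ⬝ absQ (subQ (x2 ⬝ x0) (x2 ⬝ S x0))))) n) := by
    unfold hatS hatC
    rw [app_lam, app_lam]
    simp only [Interp.eval_app, eval_search, Interp.eval_var, Interp.cons_z, Interp.cons_s]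
  rw [this, M.searchS_congr (P' := M.jump f)]
  intro k
  unfold jump
  rw [app_lam, app_lam]
  simp [subQ]

/-- If there is no jump, the search in `hatC` runs up to `n`, and the correction leaves the sequence
unchanged. -/
theorem seq_of_regular {f : M.carrier one}
    (h : ∀ n, |M.val (M.app f n) - M.val (M.app f (n + 1))| < M.eps (n + 1)) (n : M.N) :
    M.seq f n = M.val (M.app f n) := by
  rw [seq, hatS_app, M.searchS_eq le_rfl (.inl rfl)]
  intro j _
  rw [ne_eq, jump_eq_zero, not_le]
  exact h j

/-- Either no jump occurs before `n + 1`, and the two values are consecutive values of `f` which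
passed the test at `n`; or the search stops at some `k ≤ n`, and the corrected sequence is constant
from there on. -/
theorem seq_regular (f : M.carrier one) (n : M.N) :
    |M.seq f n - M.seq f (n + 1)| < M.eps (n + 1) := by
  obtain ⟨h₁, h₂, h₃⟩ := M.searchS_spec (M.jump f) (n + 1)
  rw [seq, seq, hatS_app, hatS_app]
  rcases h₁.eq_or_lt with heq | hlt
  · rw [heq] at h₂
    have hn : M.searchS (M.jump f) n = n :=
      M.searchS_eq le_rfl (.inl rfl) fun j hj => h₂ j (hj.trans (lt_add_one n))
    rw [heq, hn, ← not_le, ← jump_eq_zero]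
    exact h₂ n (lt_add_one n)
  · have h0 := h₃.resolve_left (not_le.2 hlt)
    rw [M.searchS_eq (lt_add_one_iff'.1 hlt) (.inr h0) h₂, sub_self, abs_zero]
    exact M.eps_pos _

/-- Telescoping of the bounds `2⁻ᵏ⁻¹`. Keeping `-2⁻ᵐ⁻ᵈ` on the right is what lets the induction
close. -/
theorem seq_cauchy_add (f : M.carrier one) (m d : M.N) :
    |M.seq f m - M.seq f (m + d)| ≤ M.eps m - M.eps (m + d) := by
  refine M.induct' (P := fun d => |M.seq f m - M.seq f (m + d)| ≤ M.eps m - M.eps (m + d))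
    (leQ (absQ (subQ (hat x2 x1) (hat x2 (add x1 x0))))
      (subQ (twoNegQ x1) (twoNegQ (add x1 x0)))) (m ∷ f ∷ Interp.nil) ?_ ?_ ?_ d
  · intro n
    simp only [leQ, Interp.Sat, Interp.eval_app, eval_leQC, eval_O, leQS_eq_zero]
    simp only [subQ, eval_absQ, eval_addQ, eval_hat, Interp.eval_var, Interp.cons_s,
      Interp.cons_z, eval_negQ, eval_add, val_absQS, val_addQS, val_negQS, eval_twoNegQ, val_twoNeg,
      seq, sub_eq_add_neg]
  · simp
  · intro n ih
    have h := M.seq_regular f (m + n)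
    have h' := M.eps_add_one (m + n)
    rw [← add_assoc]
    rw [abs_le] at ih ⊢
    rw [abs_lt] at h
    constructor <;> linarith [ih.1, ih.2, h.1, h.2]

theorem seq_cauchy (f : M.carrier one) {m n : M.N} (h : m ≤ n) :
    |M.seq f m - M.seq f n| ≤ M.eps m - M.eps n := by
  obtain ⟨d, rfl⟩ := le_def.1 h
  exact M.seq_cauchy_add f m d

/-- Regularity is strict, so the step from `n` to `n + 1` leaves some room. In `real_lt` this
upgrades a value at least `2⁻ⁿ` at place `n` to a strictly positive limit. -/
theorem exists_seq_gap (f : M.carrier one) (n : M.N) : ∃ δ, 0 < δ ∧ ∀ m, n + 1 ≤ m →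
    |M.seq f n - M.seq f m| ≤ M.eps n - M.eps m - δ := by
  refine ⟨M.eps (n + 1) - |M.seq f n - M.seq f (n + 1)|, sub_pos.2 (M.seq_regular f n), ?_⟩
  intro m hm
  have h₁ := M.seq_cauchy f hm
  have h₂ := abs_sub_le (M.seq f n) (M.seq f (n + 1)) (M.seq f m)
  have h₃ := M.eps_add_one n
  linarith

/-! ### The ring of real numbers -/

/-- Sequences which tend to zero. -/
def Null (s : M.N → M.Q) : Prop := ∀ k, ∃ m₀, ∀ m, m₀ ≤ m → |s m| ≤ M.eps k

variable {M} in
theorem Null.add {s t : M.N → M.Q} (hs : M.Null s) (ht : M.Null t) : M.Null (s + t) := by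
  intro k
  obtain ⟨m₁, h₁⟩ := hs (k + 1)
  obtain ⟨m₂, h₂⟩ := ht (k + 1)
  refine ⟨max m₁ m₂, fun m hm => ?_⟩
  have h := abs_add_le (s m) (t m)
  have := h₁ m ((le_max_left _ _).trans hm)
  have := h₂ m ((le_max_right _ _).trans hm)
  have := M.eps_add_one k
  simp only [Pi.add_apply]
  linarith

variable {M} in
theorem Null.neg {s : M.N → M.Q} (hs : M.Null s) : M.Null (-s) := by
  intro k
  obtain ⟨m₁, h₁⟩ := hs k
  exact ⟨m₁, fun m hm => by simpa using h₁ m hm⟩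

/-- A power of two of the model exceeds `C`, and its exponent is added to `k`. -/
theorem exists_mul_eps_le (C : M.Q) (k : M.N) : ∃ j, C * M.eps j ≤ M.eps k := by
  obtain ⟨n, hn⟩ := M.exists_toQ_ge C
  refine ⟨k + n, ?_⟩
  rw [eps_add]
  have h₁ : C ≤ M.toQ (M.pow2S n) :=
    hn.trans (M.toQ_le.2 (le_trans (by simp) (M.add_one_le_pow2S n)))
  have h₂ : C * M.eps n ≤ 1 := by
    rw [eps, ← div_eq_mul_inv, div_le_one (M.pow2_pos n)]
    exact h₁
  nlinarith [M.eps_pos k]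

variable {M} in
theorem Null.mul {s t : M.N → M.Q} (ht : M.Null t) (hs : ∃ C, ∀ n, |s n| ≤ C) :
    M.Null (s * t) := by
  intro k
  obtain ⟨C, hC⟩ := hs
  obtain ⟨j, hj⟩ := M.exists_mul_eps_le C k
  obtain ⟨m₀, h₀⟩ := ht j
  refine ⟨m₀, fun m hm => le_trans ?_ hj⟩
  rw [Pi.mul_apply, abs_mul]
  exact mul_le_mul (hC m) (h₀ m hm) (abs_nonneg _) ((abs_nonneg _).trans (hC m))

theorem null_zero : M.Null 0 := fun k => ⟨0, fun m _ => by simpa using (M.eps_pos k).le⟩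

theorem null_shift (f : M.carrier one) (d : M.N) :
    M.Null fun n => M.seq f (n + d) - M.seq f n := by
  intro k
  refine ⟨k, fun m hm => ?_⟩
  rw [abs_sub_comm]
  exact (M.seq_cauchy_add f m d).trans (by linarith [M.eps_le hm, M.eps_pos (m + d)])

theorem seq_bounded (f : M.carrier one) : ∃ C, ∀ n, |M.seq f n| ≤ C := by
  refine ⟨|M.seq f 0| + 1, fun n => ?_⟩
  have h₁ := M.seq_cauchy f (zero_le (a := n))
  have h₂ := abs_sub_abs_le_abs_sub (M.seq f n) (M.seq f 0)
  rw [abs_sub_comm] at h₂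
  rw [eps_zero] at h₁
  linarith [M.eps_pos n]

/-- Bounded sequences. -/
def boundedSeq : Subring (M.N → M.Q) where
  carrier := {s | ∃ C, ∀ n, |s n| ≤ C}
  zero_mem' := ⟨0, fun n => by simp⟩
  one_mem' := ⟨1, fun n => by simp⟩
  add_mem' := by
    rintro s t ⟨C, hC⟩ ⟨D, hD⟩
    exact ⟨C + D, fun n => (abs_add_le _ _).trans (add_le_add (hC n) (hD n))⟩
  neg_mem' := by
    rintro s ⟨C, hC⟩
    exact ⟨C, fun n => by simpa using hC n⟩
  mul_mem' := by
    rintro s t ⟨C, hC⟩ ⟨D, hD⟩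
    refine ⟨C * D, fun n => ?_⟩
    rw [Pi.mul_apply, abs_mul]
    exact mul_le_mul (hC n) (hD n) (abs_nonneg _) ((abs_nonneg _).trans (hC n))

/-- Working modulo null sequences gives the ring laws for free and removes the index shifts built
into the names of sums and products. -/
def nullIdeal : Ideal M.boundedSeq where
  carrier := {s | M.Null s}
  zero_mem' := M.null_zero
  add_mem' h h' := Null.add h h'
  smul_mem' c _ hs := Null.mul hs c.2

/-- Names of real numbers as elements of a ring. -/
noncomputable def preReal (f : M.carrier one) : M.boundedSeq ⧸ M.nullIdeal :=
  Ideal.Quotient.mk _ ⟨M.seq f, M.seq_bounded f⟩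

theorem preReal_eq_mk {f : M.carrier one} {s : M.boundedSeq} (h : M.Null (M.seq f - s)) :
    M.preReal f = Ideal.Quotient.mk _ s :=
  Ideal.Quotient.eq.2 h

theorem app_addRS (f g : M.carrier one) (n : M.N) : M.app (M.addRS f g) n =
    M.addQS (M.app (M.hatS f) (n + 1)) (M.app (M.hatS g) (n + 1)) := by
  unfold addRS addRC; simp [succ_eq]

theorem app_negRS (f : M.carrier one) (n : M.N) :
    M.app (M.negRS f) n = M.negQS (M.app (M.hatS f) n) := by
  unfold negRS negRC; simp

theorem app_absRS (f : M.carrier one) (n : M.N) :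
    M.app (M.absRS f) n = M.absQS (M.app (M.hatS f) n) := by
  unfold absRS absRC; simp

theorem app_mulRS (f g : M.carrier one) (n : M.N) : M.app (M.mulRS f g) n =
    M.mulQS (M.app (M.hatS f) (n + M.mulShiftS f g)) (M.app (M.hatS g) (n + M.mulShiftS f g)) := by
  unfold mulRS mulRC; simp

theorem seq_addRS (f g : M.carrier one) (n : M.N) :
    M.seq (M.addRS f g) n = M.seq f (n + 1) + M.seq g (n + 1) := by
  have hv : ∀ n, M.val (M.app (M.addRS f g) n) = M.seq f (n + 1) + M.seq g (n + 1) := by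
    intro n
    rw [app_addRS, val_addQS]; rfl
  rw [M.seq_of_regular, hv]
  intro n
  rw [hv, hv]
  have h₁ := M.seq_regular f (n + 1)
  have h₂ := M.seq_regular g (n + 1)
  have h₃ := M.eps_add_one (n + 1)
  rw [abs_lt] at *
  constructor <;> linarith [h₁.1, h₁.2, h₂.1, h₂.2]

theorem seq_negRS (f : M.carrier one) (n : M.N) : M.seq (M.negRS f) n = -M.seq f n := by
  have hv : ∀ n, M.val (M.app (M.negRS f) n) = -M.seq f n := by
    intro n
    rw [app_negRS, val_negQS]; rfl
  rw [M.seq_of_regular, hv]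
  intro n
  rw [hv, hv, neg_sub_neg, abs_sub_comm]
  exact M.seq_regular f n

theorem seq_absRS (f : M.carrier one) (n : M.N) : M.seq (M.absRS f) n = |M.seq f n| := by
  have hv : ∀ n, M.val (M.app (M.absRS f) n) = |M.seq f n| := by
    intro n
    rw [app_absRS, val_absQS]; rfl
  rw [M.seq_of_regular, hv]
  intro n
  rw [hv, hv]
  exact lt_of_le_of_lt (abs_abs_sub_abs_le _ _) (M.seq_regular f n)

theorem abs_val_le (q : M.N) : |M.val q| ≤ M.toQ (M.posS q + M.negS q) := by
  have hd : (1 : M.Q) ≤ M.toQ (M.denS q) := by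
    rw [denS_eq, map_add, map_one]
    linarith [M.toQ_nonneg (M.sndS q)]
  rw [val, abs_div, abs_of_pos (M.den_pos q), map_add]
  refine (div_le_self (abs_nonneg _) hd).trans ?_
  rw [abs_le]
  constructor <;> linarith [M.toQ_nonneg (M.posS q), M.toQ_nonneg (M.negS q)]

/-- All values of a regular sequence are within `1` of the value at `0`, so this sum bounds the
total size of two factors. Shifting by the exponent therefore compensates the growth of the error in
a product. -/
theorem mulShiftS_spec (f g : M.carrier one) :
    |M.seq f 0| + |M.seq g 0| + 2 ≤ M.toQ (M.pow2S (M.mulShiftS f g)) := by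
  have h : M.mulShiftS f g = M.posS (M.app (M.hatS f) 0) + M.negS (M.app (M.hatS f) 0) +
      (M.posS (M.app (M.hatS g) 0) + M.negS (M.app (M.hatS g) 0)) + 1 + 1 := by
    unfold mulShiftS mulShiftC; simp [succ_eq]
  have h₁ := M.toQ_le.2 (le_trans (by simp) (M.add_one_le_pow2S (M.mulShiftS f g)) :
    M.mulShiftS f g ≤ M.pow2S (M.mulShiftS f g))
  refine le_trans ?_ h₁
  rw [h, map_add, map_add, map_add, map_one]
  have h₂ := M.abs_val_le (M.app (M.hatS f) 0)
  have h₃ := M.abs_val_le (M.app (M.hatS g) 0)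
  change |M.seq f 0| ≤ _ at h₂
  change |M.seq g 0| ≤ _ at h₃
  linarith

theorem seq_mulRS (f g : M.carrier one) (n : M.N) : M.seq (M.mulRS f g) n =
    M.seq f (n + M.mulShiftS f g) * M.seq g (n + M.mulShiftS f g) := by
  set k := M.mulShiftS f g with hk
  have hv : ∀ n, M.val (M.app (M.mulRS f g) n) = M.seq f (n + k) * M.seq g (n + k) := by
    intro n
    rw [app_mulRS, val_mulQS]; rfl
  rw [M.seq_of_regular, hv]
  intro n
  rw [hv, hv]
  have hb : ∀ (f : M.carrier one) n, |M.seq f n| ≤ |M.seq f 0| + 1 := by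
    intro f n
    have h₁ := M.seq_cauchy f (zero_le (a := n))
    have h₂ := abs_sub_abs_le_abs_sub (M.seq f n) (M.seq f 0)
    rw [abs_sub_comm] at h₂
    rw [eps_zero] at h₁
    linarith [M.eps_pos n]
  have e : n + 1 + k = n + k + 1 := by ring
  rw [e]
  have h₁ := M.seq_regular f (n + k)
  have h₂ := M.seq_regular g (n + k)
  have h₃ := hb f (n + k + 1)
  have h₄ := hb g (n + k)
  have h₅ := M.mulShiftS_spec f g
  rw [← hk] at h₅
  have h₆ : M.toQ (M.pow2S k) * M.eps (n + k + 1) = M.eps (n + 1) := by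
    rw [← e, eps_add, eps, eps, mul_comm, mul_assoc, inv_mul_cancel₀ (M.pow2_pos k).ne', mul_one]
  -- The product rule: one factor changes at a time, and `|ĝ| ≤ |ĝ(0)| + 1`, `|f̂| ≤ |f̂(0)| + 1`
  -- bound the other.
  have h₇ : M.seq f (n + k) * M.seq g (n + k) - M.seq f (n + k + 1) * M.seq g (n + k + 1) =
      (M.seq f (n + k) - M.seq f (n + k + 1)) * M.seq g (n + k) +
        M.seq f (n + k + 1) * (M.seq g (n + k) - M.seq g (n + k + 1)) := by ring
  rw [h₇]
  refine (abs_add_le _ _).trans_lt ?_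
  rw [abs_mul, abs_mul]
  have h₈ : |M.seq f (n + k) - M.seq f (n + k + 1)| * |M.seq g (n + k)| ≤
      |M.seq f (n + k) - M.seq f (n + k + 1)| * (|M.seq g 0| + 1) :=
    mul_le_mul_of_nonneg_left h₄ (abs_nonneg _)
  have h₉ : |M.seq f (n + k) - M.seq f (n + k + 1)| * (|M.seq g 0| + 1) <
      M.eps (n + k + 1) * (|M.seq g 0| + 1) :=
    mul_lt_mul_of_pos_right h₁ (by positivity)
  have h₁₀ : |M.seq f (n + k + 1)| * |M.seq g (n + k) - M.seq g (n + k + 1)| ≤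
      (|M.seq f 0| + 1) * M.eps (n + k + 1) :=
    mul_le_mul h₃ h₂.le (abs_nonneg _) (by positivity)
  have h₁₁ := mul_le_mul_of_nonneg_right h₅ (M.eps_pos (n + k + 1)).le
  rw [h₆] at h₁₁
  linarith

theorem preReal_addRS (f g : M.carrier one) :
    M.preReal (M.addRS f g) = M.preReal f + M.preReal g := by
  refine M.preReal_eq_mk (s := ⟨M.seq f, M.seq_bounded f⟩ + ⟨M.seq g, M.seq_bounded g⟩) ?_
  convert (M.null_shift f 1).add (M.null_shift g 1) using 1
  funext n
  change M.seq (M.addRS f g) n - (M.seq f n + M.seq g n) =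
    M.seq f (n + 1) - M.seq f n + (M.seq g (n + 1) - M.seq g n)
  rw [seq_addRS]
  ring

theorem preReal_negRS (f : M.carrier one) : M.preReal (M.negRS f) = -M.preReal f := by
  refine M.preReal_eq_mk (s := -⟨M.seq f, M.seq_bounded f⟩) ?_
  convert M.null_zero using 1
  funext n
  change M.seq (M.negRS f) n - -M.seq f n = 0
  rw [seq_negRS]
  ring

theorem preReal_mulRS (f g : M.carrier one) :
    M.preReal (M.mulRS f g) = M.preReal f * M.preReal g := by
  refine M.preReal_eq_mk (s := ⟨M.seq f, M.seq_bounded f⟩ * ⟨M.seq g, M.seq_bounded g⟩) ?_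
  set k := M.mulShiftS f g with hk
  have hb : ∃ C, ∀ n, |M.seq f (n + k)| ≤ C := (M.seq_bounded f).imp fun C hC n => hC _
  convert ((M.null_shift g k).mul hb).add ((M.null_shift f k).mul (M.seq_bounded g)) using 1
  funext n
  change M.seq (M.mulRS f g) n - M.seq f n * M.seq g n =
    M.seq f (n + k) * (M.seq g (n + k) - M.seq g n) + M.seq g n * (M.seq f (n + k) - M.seq f n)
  rw [seq_mulRS, ← hk]
  ring

/-- The constant sequence. -/
def ratS (q : M.N) : M.carrier one := M.app (M.con (.Pi nat nat)) q

@[simp] theorem eval_ratR {Γ : Ctx} (e : M.Env Γ) (t : Tm L Γ nat) :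
    M.eval e (ratR t) = M.ratS (M.eval e t) := rfl

theorem seq_ratS (q n : M.N) : M.seq (M.ratS q) n = M.val q := by
  have h : ∀ n, M.val (M.app (M.ratS q) n) = M.val q := fun n => by rw [ratS, app_pi]
  rw [M.seq_of_regular, h]
  intro n
  rw [h, h, sub_self, abs_zero]
  exact M.eps_pos _

def natS (n : M.N) : M.carrier one := M.ratS (M.pairS (n + n) 0)

@[simp] theorem eval_natR {Γ : Ctx} (e : M.Env Γ) (t : Tm L Γ nat) :
    M.eval e (natR t) = M.natS (M.eval e t) := by simp [natR, natS]

theorem val_natS (n : M.N) : M.val (M.pairS (n + n) 0) = M.toQ n := by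
  rw [val_pairS_even]; simp

theorem preReal_natS_zero : M.preReal (M.natS 0) = 0 := by
  refine M.preReal_eq_mk (s := 0) ?_
  convert M.null_zero using 1
  funext n
  change M.seq (M.natS 0) n - 0 = 0
  rw [natS, seq_ratS, val_natS, map_zero, sub_zero]

theorem preReal_natS_one : M.preReal (M.natS 1) = 1 := by
  refine M.preReal_eq_mk (s := 1) ?_
  convert M.null_zero using 1
  funext n
  change M.seq (M.natS 1) n - 1 = 0
  rw [natS, seq_ratS, val_natS, map_one, sub_self]

/-- The ring of the real numbers of the model. -/
def realRing : Subring (M.boundedSeq ⧸ M.nullIdeal) where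
  carrier := Set.range M.preReal
  zero_mem' := ⟨_, M.preReal_natS_zero⟩
  one_mem' := ⟨_, M.preReal_natS_one⟩
  add_mem' := by
    rintro _ _ ⟨f, rfl⟩ ⟨g, rfl⟩
    exact ⟨_, M.preReal_addRS f g⟩
  neg_mem' := by
    rintro _ ⟨f, rfl⟩
    exact ⟨_, M.preReal_negRS f⟩
  mul_mem' := by
    rintro _ _ ⟨f, rfl⟩ ⟨g, rfl⟩
    exact ⟨_, M.preReal_mulRS f g⟩

/-- The real numbers of the model. -/
def R : Type := M.realRing

noncomputable instance : CommRing M.R := inferInstanceAs (CommRing M.realRing)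

/-- The real number with a given name. -/
noncomputable def real (f : M.carrier one) : M.R := (⟨M.preReal f, f, rfl⟩ : M.realRing)

theorem exists_real (x : M.R) : ∃ f, M.real f = x := by
  obtain ⟨_, f, rfl⟩ := x
  exact ⟨f, rfl⟩

@[simp] theorem real_addRS (f g : M.carrier one) : M.real (M.addRS f g) = M.real f + M.real g :=
  Subtype.ext (M.preReal_addRS f g)
@[simp] theorem real_negRS (f : M.carrier one) : M.real (M.negRS f) = -M.real f :=
  Subtype.ext (M.preReal_negRS f)
@[simp] theorem real_mulRS (f g : M.carrier one) : M.real (M.mulRS f g) = M.real f * M.real g :=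
  Subtype.ext (M.preReal_mulRS f g)

theorem real_eq_real {f g : M.carrier one} :
    M.real f = M.real g ↔ M.Null (M.seq f - M.seq g) := by
  refine Iff.trans Subtype.ext_iff ?_
  exact Ideal.Quotient.eq

end Model
end FinTypeArith

namespace FinTypeArith

namespace Model

variable {L : Lang} {T : Set (Fml L [])} (M : Model T)

/-! ### The ordered field of real numbers -/

/-- Sequences whose limit is nonnegative. -/
def Nonneg (s : M.N → M.Q) : Prop := ∀ k, ∃ m₀, ∀ m, m₀ ≤ m → -M.eps k ≤ s m

variable {M} in
theorem Nonneg.add {s t : M.N → M.Q} (hs : M.Nonneg s) (ht : M.Nonneg t) : M.Nonneg (s + t) := by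
  intro k
  obtain ⟨m₁, h₁⟩ := hs (k + 1)
  obtain ⟨m₂, h₂⟩ := ht (k + 1)
  refine ⟨max m₁ m₂, fun m hm => ?_⟩
  have := h₁ m ((le_max_left _ _).trans hm)
  have := h₂ m ((le_max_right _ _).trans hm)
  have := M.eps_add_one k
  simp only [Pi.add_apply]
  linarith

variable {M} in
theorem Null.nonneg {s : M.N → M.Q} (hs : M.Null s) : M.Nonneg s := by
  intro k
  obtain ⟨m₁, h₁⟩ := hs k
  exact ⟨m₁, fun m hm => (abs_le.1 (h₁ m hm)).1⟩

variable {M} in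
theorem Nonneg.null {s : M.N → M.Q} (hs : M.Nonneg s) (hs' : M.Nonneg (-s)) : M.Null s := by
  intro k
  obtain ⟨m₁, h₁⟩ := hs k
  obtain ⟨m₂, h₂⟩ := hs' k
  refine ⟨max m₁ m₂, fun m hm => abs_le.2 ⟨h₁ m ((le_max_left _ _).trans hm), ?_⟩⟩
  have := h₂ m ((le_max_right _ _).trans hm)
  simp only [Pi.neg_apply] at this
  linarith

variable {M} in
-- If `s, t ≥ -ε` with `|s| ≤ C` and `|t| ≤ D`, then `s t ≥ -(C + D) ε`, by cases on the signs; `ε`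
-- is chosen accordingly.
theorem Nonneg.mul {s t : M.N → M.Q} (hs : M.Nonneg s) (ht : M.Nonneg t)
    (hs' : ∃ C, ∀ n, |s n| ≤ C) (ht' : ∃ C, ∀ n, |t n| ≤ C) : M.Nonneg (s * t) := by
  intro k
  obtain ⟨C, hC⟩ := hs'
  obtain ⟨D, hD⟩ := ht'
  obtain ⟨j, hj⟩ := M.exists_mul_eps_le (C + D) k
  obtain ⟨m₁, h₁⟩ := hs j
  obtain ⟨m₂, h₂⟩ := ht j
  refine ⟨max m₁ m₂, fun m hm => ?_⟩
  have h₁ := h₁ m ((le_max_left _ _).trans hm)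
  have h₂ := h₂ m ((le_max_right _ _).trans hm)
  have h₃ := abs_le.1 (hC m)
  have h₄ := abs_le.1 (hD m)
  have h₅ := M.eps_pos j
  have hC0 := (abs_nonneg _).trans (hC m)
  have hD0 := (abs_nonneg _).trans (hD m)
  rw [Pi.mul_apply]
  refine le_trans (neg_le_neg hj) ?_
  rcases le_total 0 (s m) with hs0 | hs0 <;> rcases le_total 0 (t m) with ht0 | ht0
  · have := mul_nonneg hs0 ht0
    have := mul_nonneg (add_nonneg hC0 hD0) h₅.le
    linarith
  · have h₆ := mul_le_mul_of_nonneg_left h₂ hs0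
    have h₇ := mul_le_mul_of_nonneg_right h₃.2 h₅.le
    have h₈ := mul_nonneg hD0 h₅.le
    linarith
  · have h₆ := mul_le_mul_of_nonneg_right h₁ ht0
    have h₇ := mul_le_mul_of_nonneg_right h₄.2 h₅.le
    have h₈ := mul_nonneg hC0 h₅.le
    linarith
  · have := mul_nonneg_of_nonpos_of_nonpos hs0 ht0
    have := mul_nonneg (add_nonneg hC0 hD0) h₅.le
    linarith

/-- Later terms differ from the `n`-th by less than `2⁻ⁿ`, so a term below `-2⁻ⁿ` keeps all later
ones below a fixed negative bound. -/
theorem nonneg_seq {f : M.carrier one} : M.Nonneg (M.seq f) ↔ ∀ n, -M.eps n ≤ M.seq f n := by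
  constructor
  · intro h n
    by_contra! hn
    obtain ⟨k, hk⟩ := M.exists_eps_lt (sub_pos.2 hn)
    obtain ⟨m₀, h₀⟩ := h k
    have h₁ := h₀ (max m₀ n) (le_max_left _ _)
    have h₂ := abs_le.1 (M.seq_cauchy f (le_max_right m₀ n))
    linarith [h₂.1, M.eps_pos (max m₀ n)]
  · intro h k
    exact ⟨k, fun m hm => (neg_le_neg (M.eps_le hm)).trans (h m)⟩

/-- If some term is below `-2⁻ⁿ`, all later terms are negative. This is totality of the order on the
reals. -/
theorem nonneg_seq_or (f : M.carrier one) : M.Nonneg (M.seq f) ∨ M.Nonneg (-M.seq f) := by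
  rw [nonneg_seq]
  by_contra! h
  obtain ⟨⟨n, hn⟩, h⟩ := h
  refine h fun k => ⟨n, fun m hm => ?_⟩
  have h₂ := abs_le.1 (M.seq_cauchy f hm)
  rw [Pi.neg_apply]
  linarith [h₂.1, M.eps_pos m, M.eps_pos k]

/-- The nonnegative real numbers. -/
def realCone : RingCone M.R where
  carrier := {x | ∃ s : M.boundedSeq, x.1 = Ideal.Quotient.mk _ s ∧ M.Nonneg s}
  zero_mem' := ⟨0, rfl, M.null_zero.nonneg⟩
  one_mem' := ⟨1, rfl, fun k => ⟨0, fun m _ => by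
    have := M.eps_pos k
    change -M.eps k ≤ 1
    linarith⟩⟩
  add_mem' := by
    rintro x y ⟨s, hs, hs'⟩ ⟨t, ht, ht'⟩
    exact ⟨s + t, by rw [map_add, ← hs, ← ht]; rfl, hs'.add ht'⟩
  mul_mem' := by
    rintro x y ⟨s, hs, hs'⟩ ⟨t, ht, ht'⟩
    exact ⟨s * t, by rw [map_mul, ← hs, ← ht]; rfl, hs'.mul ht' s.2 t.2⟩
  eq_zero_of_mem_of_neg_mem' := by
    rintro x ⟨s, hs, hs'⟩ ⟨t, ht, ht'⟩
    have h : M.Null (-(s : M.N → M.Q) - t) := by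
      have : Ideal.Quotient.mk M.nullIdeal (-s) = Ideal.Quotient.mk _ t := by
        rw [map_neg, ← hs, ← ht]; rfl
      exact Ideal.Quotient.eq.1 this
    have h₁ : M.Nonneg (-(s : M.N → M.Q)) := by
      convert h.nonneg.add ht' using 1
      abel
    refine Subtype.ext (hs.trans ?_)
    exact Ideal.Quotient.eq_zero_iff_mem.2 (hs'.null h₁)

theorem mem_realCone {x : M.R} {s : M.boundedSeq} (h : x.1 = Ideal.Quotient.mk _ s) :
    x ∈ M.realCone ↔ M.Nonneg s := by
  refine ⟨?_, fun h' => ⟨s, h, h'⟩⟩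
  rintro ⟨t, ht, ht'⟩
  have : M.Null ((s : M.N → M.Q) - t) := Ideal.Quotient.eq.1 (h.symm.trans ht)
  simpa using this.nonneg.add ht'

instance : HasMemOrNegMem M.realCone where
  mem_or_neg_mem x := by
    obtain ⟨f, rfl⟩ := M.exists_real x
    rw [M.mem_realCone (x := M.real f) (s := ⟨M.seq f, M.seq_bounded f⟩) rfl,
      M.mem_realCone (x := -M.real f) (s := -⟨M.seq f, M.seq_bounded f⟩) rfl]
    exact M.nonneg_seq_or f

open Classical in
noncomputable instance : LinearOrder M.R := .mkOfAddGroupCone M.realCone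

instance : IsOrderedRing M.R := .mkOfCone M.realCone

theorem real_nonneg_iff {x : M.R} {s : M.boundedSeq} (h : x.1 = Ideal.Quotient.mk _ s) :
    0 ≤ x ↔ M.Nonneg s := by
  rw [← M.mem_realCone h]
  change x - 0 ∈ M.realCone ↔ _
  rw [sub_zero]

theorem real_nonneg {f : M.carrier one} : 0 ≤ M.real f ↔ ∀ n, -M.eps n ≤ M.seq f n := by
  rw [M.real_nonneg_iff (x := M.real f) (s := ⟨M.seq f, M.seq_bounded f⟩) rfl]
  exact M.nonneg_seq

theorem val_surjective (x : M.Q) : ∃ q, M.val q = x := by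
  have key : ∀ a d : M.N, M.toQ d ≠ 0 → ∀ z : M.Q, z = M.toQ a / M.toQ d → ∃ q, M.val q = z := by
    rintro a d hd z rfl
    refine ⟨M.mkQS a 0 d, ?_⟩
    rw [val_mkQS' _ ((M.toQ_nonneg d).lt_of_ne' hd), map_zero, sub_zero]
  obtain ⟨a, b, hb, rfl⟩ := M.exists_ofDiff_div x
  have hb' : M.ofDiff b ≠ 0 := fun h => hb (M.ofDiff_injective (by rw [h, map_zero]))
  have key' : ∀ d : M.N, M.toQ d ≠ 0 → ∃ q, M.val q = M.ofDiff a / M.toQ d := by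
    intro d hd
    rcases Diff.mem_or_neg a with ⟨c, rfl⟩ | ⟨c, hc⟩
    · exact key c d hd _ rfl
    · obtain ⟨q, hq⟩ := key c d hd _ rfl
      refine ⟨M.negQS q, ?_⟩
      have : M.toQ c = -M.ofDiff a := by rw [← map_neg, ← hc]; rfl
      rw [val_negQS, hq, this]
      ring
  rcases Diff.mem_or_neg b with ⟨d, rfl⟩ | ⟨d, hd⟩
  · exact key' d hb'
  · have hd' : M.toQ d = -M.ofDiff b := by rw [← map_neg, ← hd]; rfl
    obtain ⟨q, hq⟩ := key' d (by rw [hd']; exact neg_ne_zero.2 hb')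
    refine ⟨M.negQS q, ?_⟩
    rw [val_negQS, hq, hd', div_neg, neg_neg]

/-- Constant sequences. -/
noncomputable def constSeq : M.Q →+* M.boundedSeq :=
  (Pi.constRingHom M.N M.Q).codRestrict M.boundedSeq fun x => ⟨|x|, fun _ => le_rfl⟩

/-- The embedding of the rational numbers into the real numbers. -/
noncomputable def ofQ : M.Q →+* M.R :=
  ((Ideal.Quotient.mk M.nullIdeal).comp M.constSeq).codRestrict M.realRing fun x => by
    obtain ⟨q, rfl⟩ := M.val_surjective x
    refine ⟨M.ratS q, M.preReal_eq_mk ?_⟩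
    convert M.null_zero using 1
    funext n
    change M.seq (M.ratS q) n - M.val q = 0
    rw [seq_ratS, sub_self]

@[simp] theorem real_ratS (q : M.N) : M.real (M.ratS q) = M.ofQ (M.val q) := by
  refine Subtype.ext (M.preReal_eq_mk ?_)
  convert M.null_zero using 1
  funext n
  change M.seq (M.ratS q) n - M.val q = 0
  rw [seq_ratS, sub_self]

@[simp] theorem real_natS (n : M.N) : M.real (M.natS n) = M.ofQ (M.toQ n) := by
  rw [natS, real_ratS, val_natS]

theorem ofQ_nonneg {x : M.Q} : 0 ≤ M.ofQ x ↔ 0 ≤ x := by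
  rw [M.real_nonneg_iff (x := M.ofQ x) (s := M.constSeq x) rfl]
  constructor
  · intro h
    by_contra! hx
    obtain ⟨k, hk⟩ := M.exists_eps_lt (neg_pos.2 hx)
    obtain ⟨m, hm⟩ := h k
    have : -M.eps k ≤ x := hm m le_rfl
    linarith
  · intro h k
    refine ⟨0, fun m _ => ?_⟩
    have := M.eps_pos k
    change -M.eps k ≤ x
    linarith

theorem ofQ_le {x y : M.Q} : M.ofQ x ≤ M.ofQ y ↔ x ≤ y := by
  rw [← sub_nonneg, ← map_sub, ofQ_nonneg, sub_nonneg]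

theorem ofQ_lt {x y : M.Q} : M.ofQ x < M.ofQ y ↔ x < y := by
  rw [← not_le, ofQ_le, not_le]

theorem ofQ_pos {x : M.Q} : 0 < M.ofQ x ↔ 0 < x := by rw [← map_zero M.ofQ, ofQ_lt]

theorem abs_real_sub_le (f : M.carrier one) (n : M.N) :
    |M.real f - M.ofQ (M.seq f n)| ≤ M.ofQ (M.eps n) := by
  rw [abs_sub_le_iff]
  constructor
  · rw [← sub_nonneg]
    refine (M.real_nonneg_iff (x := M.ofQ (M.eps n) - (M.real f - M.ofQ (M.seq f n)))
      (s := M.constSeq (M.eps n) - (⟨M.seq f, M.seq_bounded f⟩ - M.constSeq (M.seq f n))) rfl).2 ?_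
    refine fun k => ⟨n, fun m hm => ?_⟩
    change -M.eps k ≤ M.eps n - (M.seq f m - M.seq f n)
    have h₂ := abs_le.1 (M.seq_cauchy f hm)
    linarith [h₂.1, h₂.2, M.eps_pos m, M.eps_pos k]
  · rw [← sub_nonneg]
    refine (M.real_nonneg_iff (x := M.ofQ (M.eps n) - (M.ofQ (M.seq f n) - M.real f))
      (s := M.constSeq (M.eps n) - (M.constSeq (M.seq f n) - ⟨M.seq f, M.seq_bounded f⟩)) rfl).2 ?_
    refine fun k => ⟨n, fun m hm => ?_⟩
    change -M.eps k ≤ M.eps n - (M.seq f n - M.seq f m)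
    have h₂ := abs_le.1 (M.seq_cauchy f hm)
    linarith [h₂.1, h₂.2, M.eps_pos m, M.eps_pos k]

theorem exists_ofQ_eps_lt {x : M.R} (hx : 0 < x) : ∃ n, M.ofQ (M.eps n) < x := by
  obtain ⟨f, rfl⟩ := M.exists_real x
  have h : ¬ 0 ≤ M.real (M.negRS f) := by
    rw [real_negRS, not_le]
    exact neg_neg_of_pos hx
  rw [real_nonneg] at h
  push Not at h
  obtain ⟨n, hn⟩ := h
  rw [seq_negRS, neg_lt_neg_iff] at hn
  obtain ⟨k, hk⟩ := M.exists_eps_lt (sub_pos.2 hn)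
  refine ⟨k, (M.ofQ_lt.2 hk).trans_le ?_⟩
  have := (abs_le.1 (M.abs_real_sub_le f n)).1
  rw [map_sub, ← neg_add_eq_sub]
  exact le_sub_iff_add_le.1 this

/-- The right side speaks of the name of `g - f` at place `n`, because addition shifts the index by
one. If the difference exceeds `2⁻ᵏ`, place `k + 1` works: `2⁻ᵏ` is twice `2⁻ᵏ⁻¹`, and one half
absorbs the approximation error. The converse is the gap of `exists_seq_gap`. -/
theorem real_lt {f g : M.carrier one} :
    M.real f < M.real g ↔ ∃ n, M.eps n ≤ M.seq g (n + 1) - M.seq f (n + 1) := by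
  have e : ∀ n, M.seq (M.addRS g (M.negRS f)) n = M.seq g (n + 1) - M.seq f (n + 1) := by
    intro n
    rw [seq_addRS, seq_negRS, sub_eq_add_neg]
  have e' : M.real (M.addRS g (M.negRS f)) = M.real g - M.real f := by simp [sub_eq_add_neg]
  rw [← sub_pos, ← e']
  simp only [← e]
  generalize M.addRS g (M.negRS f) = h
  constructor
  · intro hh
    obtain ⟨k, hk⟩ := M.exists_ofQ_eps_lt hh
    refine ⟨k + 1, ?_⟩
    have := (abs_le.1 (M.abs_real_sub_le h (k + 1))).2
    rw [← M.ofQ_le]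
    have h₂ : M.ofQ (M.eps k) = M.ofQ (M.eps (k + 1)) + M.ofQ (M.eps (k + 1)) := by
      rw [← map_add, M.eps_add_one k]; ring_nf
    rw [h₂] at hk
    exact le_of_add_le_add_left (hk.le.trans (sub_le_iff_le_add.1 this))
  · rintro ⟨n, hn⟩
    obtain ⟨δ, hδ, hgap⟩ := M.exists_seq_gap h n
    refine (M.ofQ_pos.2 hδ).trans_le ?_
    rw [← sub_nonneg]
    refine (M.real_nonneg_iff (x := M.real h - M.ofQ δ)
      (s := ⟨M.seq h, M.seq_bounded h⟩ - M.constSeq δ) rfl).2 ?_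
    refine fun k => ⟨n + 1, fun m hm => ?_⟩
    change -M.eps k ≤ M.seq h m - δ
    have h₂ := abs_le.1 (hgap m hm)
    linarith [h₂.1, h₂.2, M.eps_pos m, M.eps_pos k]

theorem sat_ltR {Γ : Ctx} (e : M.Env Γ) (f g : Tm L Γ one) :
    M.Sat e (ltR f g) ↔ M.real (M.eval e f) < M.real (M.eval e g) := by
  rw [real_lt]
  simp only [ltR, leQ, subQ, Interp.Sat, Interp.eval_app, eval_leQC, eval_O, leQS_eq_zero,
    eval_twoNegQ, eval_addQ, eval_negQ, eval_hat, eval_S, succ_eq, Interp.eval_wk,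
    Interp.eval_var, Interp.cons_z, val_twoNeg, val_addQS, val_negQS, seq, sub_eq_add_neg]

theorem sat_leR {Γ : Ctx} (e : M.Env Γ) (f g : Tm L Γ one) :
    M.Sat e (leR f g) ↔ M.real (M.eval e f) ≤ M.real (M.eval e g) := by
  rw [leR, sat_neg, sat_ltR, not_lt]

/-- The formula at `n` denies precisely that `n` witnesses either strict inequality in the sense of
`real_lt`. -/
theorem sat_eqR {Γ : Ctx} (e : M.Env Γ) (f g : Tm L Γ one) :
    M.Sat e (eqR f g) ↔ M.real (M.eval e f) = M.real (M.eval e g) := by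
  have : M.Sat e (eqR f g) ↔
      ∀ n, |M.seq (M.eval e f) (n + 1) - M.seq (M.eval e g) (n + 1)| < M.eps n := by
    simp only [eqR, ltQ, subQ, Interp.Sat, Interp.eval_app, eval_ltQC, eval_O, ltQS_eq_zero,
      eval_twoNegQ, eval_absQ, eval_addQ, eval_negQ, eval_hat, eval_S, succ_eq, Interp.eval_wk,
      Interp.eval_var, Interp.cons_z, val_twoNeg, val_absQS, val_addQS, val_negQS, seq,
      sub_eq_add_neg]
  rw [this]
  constructor
  · intro h
    refine le_antisymm ?_ ?_ <;> rw [← not_lt, real_lt] <;> rintro ⟨n, hn⟩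
    · exact absurd (hn.trans (le_abs_self _)) (not_le.2 (h n))
    · rw [← neg_sub] at hn
      exact absurd (hn.trans (neg_le_abs _)) (not_le.2 (h n))
  · intro h n
    rw [abs_lt]
    have h₁ := h.le
    have h₂ := h.ge
    rw [← not_lt, real_lt, not_exists] at h₁ h₂
    have h₁ := h₁ n
    have h₂ := h₂ n
    constructor <;> linarith

/-- A name of a nonnegative number has terms at least `-2⁻ᵐ`, so they differ from their absolute
values by at most `2·2⁻ᵐ`; taking `m ≥ k + 1` makes this at most `2⁻ᵏ`. -/
theorem real_absRS (f : M.carrier one) : M.real (M.absRS f) = |M.real f| := by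
  rcases le_total 0 (M.real f) with h | h
  · rw [abs_of_nonneg h, real_eq_real]
    rw [real_nonneg] at h
    intro k
    refine ⟨k + 1, fun m hm => ?_⟩
    rw [Pi.sub_apply, seq_absRS]
    have h₁ := h m
    have h₂ := M.eps_le hm
    have h₃ := M.eps_add_one k
    have h₄ := M.eps_pos k
    rw [abs_le]
    rcases abs_cases (M.seq f m) with ⟨h₅, h₆⟩ | ⟨h₅, h₆⟩ <;> rw [h₅] <;> constructor <;> linarith
  · rw [abs_of_nonpos h, ← real_negRS, real_eq_real]
    rw [← neg_nonneg, ← real_negRS, real_nonneg] at h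
    intro k
    refine ⟨k + 1, fun m hm => ?_⟩
    rw [Pi.sub_apply, seq_absRS, seq_negRS]
    have h₁ := h m
    rw [seq_negRS] at h₁
    have h₂ := M.eps_le hm
    have h₃ := M.eps_add_one k
    have h₄ := M.eps_pos k
    rw [abs_le]
    rcases abs_cases (M.seq f m) with ⟨h₅, h₆⟩ | ⟨h₅, h₆⟩ <;> rw [h₅] <;> constructor <;> linarith

/-! ### Reciprocals -/

theorem app_invRS (l : M.N) (f : M.carrier one) (n : M.N) : M.app (M.invRS l f) n =
    M.iteS (M.leQS (M.app (M.hatS f) (l + 1)) 0)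
      (M.invQS (M.iteS (M.leQS (M.app (M.hatS f) (n + (l + l)))
        (M.negQS (M.pairS (1 + 1) (M.predS (M.pow2S l)))))
        (M.app (M.hatS f) (n + (l + l))) (M.negQS (M.pairS (1 + 1) (M.predS (M.pow2S l))))))
      (M.invQS (M.iteS (M.leQS (M.app (M.hatS f) (n + (l + l)))
        (M.pairS (1 + 1) (M.predS (M.pow2S l))))
        (M.pairS (1 + 1) (M.predS (M.pow2S l))) (M.app (M.hatS f) (n + (l + l))))) := by
  unfold invRS invRC; simp [succ_eq, minQ, maxQ]

/-- The sign test at place `l + 1` comes out positive because the error there is only `2⁻ˡ⁻¹`.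
Truncation from below by `2⁻ˡ` keeps the reciprocal under control at every place and is eventually
inactive, as the limit exceeds `2⁻ˡ`. -/
theorem real_invRS_mul {l : M.N} {f : M.carrier one} (h : M.ofQ (M.eps l) < M.real f) :
    M.real (M.invRS l f) * M.real f = 1 := by
  have hl := M.eps_pos l
  have hpos : 0 < M.seq f (l + 1) := by
    have h₁ := (abs_le.1 (M.abs_real_sub_le f (l + 1))).2
    have h₂ : M.ofQ (M.eps l - M.eps (l + 1)) < M.ofQ (M.seq f (l + 1)) := by
      rw [map_sub, sub_lt_iff_lt_add]
      exact h.trans_le ((sub_le_iff_le_add.1 h₁).trans (add_comm _ _).le)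
    rw [ofQ_lt, eps_add_one] at h₂
    linarith
  have hev : ∃ m₀, ∀ m, m₀ ≤ m → M.eps l ≤ M.seq f m := by
    obtain ⟨k, hk⟩ := M.exists_ofQ_eps_lt (sub_pos.2 h)
    refine ⟨k, fun m hm => ?_⟩
    have h₁ := (abs_le.1 (M.abs_real_sub_le f m)).2
    have h₂ := M.ofQ_le.2 (M.eps_le hm)
    rw [← ofQ_le]
    exact (lt_sub_comm.1 hk).le.trans (sub_le_comm.1 (h₁.trans h₂))
  have hv : ∀ n, M.val (M.app (M.invRS l f) n) = (max (M.seq f (n + (l + l))) (M.eps l))⁻¹ := by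
    intro n
    have h₀ : M.leQS (M.app (M.hatS f) (l + 1)) 0 ≠ 0 := by
      rw [ne_eq, leQS_eq_zero, val_pairS_zero, not_le]
      exact hpos
    rw [app_invRS, iteS_eq, if_neg h₀, val_invQS, iteS_eq]
    congr 1
    split_ifs with hc <;> rw [leQS_eq_zero, val_twoNeg] at hc
    · rw [val_twoNeg]
      exact (max_eq_right hc).symm
    · exact (max_eq_left (not_le.1 hc).le).symm
  have hinv : ∀ n, M.seq (M.invRS l f) n = (max (M.seq f (n + (l + l))) (M.eps l))⁻¹ := by
    intro n
    rw [M.seq_of_regular, hv]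
    intro n
    rw [hv, hv]
    have e : n + 1 + (l + l) = n + (l + l) + 1 := by ring
    rw [e]
    have ha : M.eps l ≤ max (M.seq f (n + (l + l))) (M.eps l) := le_max_right _ _
    have hb : M.eps l ≤ max (M.seq f (n + (l + l) + 1)) (M.eps l) := le_max_right _ _
    have hab := (abs_max_sub_max_le_abs (M.seq f (n + (l + l) + 1)) (M.seq f (n + (l + l)))
      (M.eps l)).trans_lt ((abs_sub_comm _ _).trans_lt (M.seq_regular f (n + (l + l))))
    revert ha hb hab
    generalize max (M.seq f (n + (l + l))) (M.eps l) = a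
    generalize max (M.seq f (n + (l + l) + 1)) (M.eps l) = b
    intro ha hb hab
    have ha0 := hl.trans_le ha
    have hb0 := hl.trans_le hb
    -- On numbers at least `2⁻ˡ`, inversion is Lipschitz with constant `2²ˡ`; the index shift by `l
    -- + l` pays for this factor and keeps the sequence regular.
    rw [inv_sub_inv ha0.ne' hb0.ne', abs_div, abs_of_pos (mul_pos ha0 hb0),
      div_lt_iff₀ (mul_pos ha0 hb0)]
    refine hab.trans_le ?_
    rw [← e, M.eps_add (n + 1), M.eps_add l]
    exact mul_le_mul_of_nonneg_left (mul_le_mul ha hb hl.le ha0.le) (M.eps_pos _).le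
  refine Subtype.ext ?_
  change M.preReal _ * M.preReal _ = 1
  rw [preReal, preReal, ← map_mul, ← map_one (Ideal.Quotient.mk M.nullIdeal), Ideal.Quotient.eq]
  change M.Null fun n => M.seq (M.invRS l f) n * M.seq f n - 1
  have h₁ := (M.null_shift f (l + l)).neg.mul (M.seq_bounded (M.invRS l f))
  intro k
  obtain ⟨m₁, h₁⟩ := h₁ k
  obtain ⟨m₂, h₂⟩ := hev
  refine ⟨max m₁ m₂, fun m hm => ?_⟩
  have h₁ := h₁ m ((le_max_left _ _).trans hm)
  have h₂ := h₂ (m + (l + l)) (((le_max_right _ _).trans hm).trans (by simp))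
  convert h₁ using 2
  simp only [Pi.mul_apply, Pi.neg_apply]
  rw [hinv, max_eq_left h₂]
  have := (hl.trans_le h₂).ne'
  field_simp
  ring

theorem exists_mul_eq_one {x : M.R} (hx : x ≠ 0) : ∃ y, x * y = 1 := by
  have key : ∀ x : M.R, 0 < x → ∃ y, x * y = 1 := by
    intro x hx
    obtain ⟨n, hn⟩ := M.exists_ofQ_eps_lt hx
    obtain ⟨f, rfl⟩ := M.exists_real x
    exact ⟨_, (mul_comm _ _).trans (M.real_invRS_mul hn)⟩
  rcases hx.lt_or_gt with h | h
  · obtain ⟨y, hy⟩ := key (-x) (neg_pos.2 h)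
    exact ⟨-y, by rw [mul_neg, ← neg_mul, hy]⟩
  · exact key x h

instance : Nontrivial M.R := ⟨0, 1, by
  rw [← map_zero M.ofQ, ← map_one M.ofQ]
  exact (M.ofQ_lt.2 zero_lt_one).ne⟩

open Classical in
noncomputable instance : Field M.R where
  inv x := if h : x = 0 then 0 else (M.exists_mul_eq_one h).choose
  mul_inv_cancel x h := by
    rw [dif_neg h]
    exact (M.exists_mul_eq_one h).choose_spec
  inv_zero := dif_pos rfl
  nnqsmul := _
  nnqsmul_def := fun _ _ => rfl
  qsmul := _
  qsmul_def := fun _ _ => rfl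

instance : IsStrictOrderedRing M.R := IsOrderedRing.toIsStrictOrderedRing _

theorem real_invRS {l : M.N} {f : M.carrier one} (h : M.ofQ (M.eps l) < M.real f) :
    M.real (M.invRS l f) = (M.real f)⁻¹ :=
  eq_inv_of_mul_eq_one_left (M.real_invRS_mul h)

section
variable {Γ : Ctx} (e : M.Env Γ) (t : Tm L Γ nat) (f g : Tm L Γ one)

@[simp] theorem real_zeroR : M.real (M.eval e zeroR) = 0 := by simp [zeroR]
@[simp] theorem real_oneR : M.real (M.eval e oneR) = 1 := by simp [oneR, succ_eq]
@[simp] theorem real_twoR : M.real (M.eval e twoR) = 2 := by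
  simp [twoR, succ_eq]; norm_num
@[simp] theorem real_twoNegR : M.real (M.eval e (twoNegR t)) = M.ofQ (M.eps (M.eval e t)) := by
  simp [twoNegR]
@[simp] theorem real_halfR : M.real (M.eval e (halfR f)) = M.real (M.eval e f) / 2 := by
  rw [halfR, eval_mulR, real_mulRS, real_twoNegR, eval_S, eval_O, succ_eq, zero_add, eps_one,
    map_div₀, map_one, map_ofNat]
  ring
@[simp] theorem real_subR :
    M.real (M.eval e (subR f g)) = M.real (M.eval e f) - M.real (M.eval e g) := by
  simp [subR, sub_eq_add_neg]
@[simp] theorem real_sqR : M.real (M.eval e (sqR f)) = M.real (M.eval e f) ^ 2 := by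
  simp [sqR, sq]

end

end Model
end FinTypeArith

namespace FinTypeArith

/-- Theories which contain the axioms of normed spaces. -/
class IsNormedTheory {L : Lang} (T : Set (Fml L [])) : Prop where
  subset : normedAx ⊆ T

/-- Theories which contain the axioms of inner product spaces. -/
class IsInnerTheory {L : Lang} (T : Set (Fml L [])) : Prop where
  subset : innerAx ⊆ T

instance {L : Lang} (T : Set (Fml L [])) [h : IsInnerTheory T] : IsNormedTheory T :=
  ⟨Set.subset_union_left.trans h.subset⟩

namespace Model

variable {L : Lang} {T : Set (Fml L [])} (M : Model T)

/-! ### The normed space -/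

def addXS (x y : M.carrier X) : M.carrier X := M.app (M.app (M.con .addX) x) y
def negXS (x : M.carrier X) : M.carrier X := M.app (M.con .negX) x
def subXS (x y : M.carrier X) : M.carrier X := M.addXS x (M.negXS y)
def smulXS (a : M.carrier one) (x : M.carrier X) : M.carrier X := M.app (M.app (M.con .smulX) a) x
/-- The norm of a point. -/
noncomputable def nrm (x : M.carrier X) : M.R := M.real (M.app (M.con .normX) x)

section
variable {Γ : Ctx} (e : M.Env Γ) (x y : Tm L Γ X) (a : Tm L Γ one)

@[simp] theorem eval_addX : M.eval e (addX x y) = M.addXS (M.eval e x) (M.eval e y) := rfl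
@[simp] theorem eval_negX : M.eval e (negX x) = M.negXS (M.eval e x) := rfl
@[simp] theorem eval_subX : M.eval e (subX x y) = M.subXS (M.eval e x) (M.eval e y) := rfl
@[simp] theorem eval_smulX : M.eval e (smulX a x) = M.smulXS (M.eval e a) (M.eval e x) := rfl
@[simp] theorem real_normX : M.real (M.eval e (normX x)) = M.nrm (M.eval e x) := rfl

theorem sat_eqX : M.Sat e (eqX x y) ↔ M.nrm (M.subXS (M.eval e x) (M.eval e y)) = 0 := by
  rw [eqX, sat_eqR]; simp

end

section Normed

variable [hT : IsNormedTheory T]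

theorem nrm_sub_self (x : M.carrier X) : M.nrm (M.subXS x x) = 0 := by
  have h := M.sat_ax (hT.subset (.inr (by simp [normAx]) :
    .all X (eqR (normX (subX x0 x0)) zeroR) ∈ normedAx)) x
  rw [sat_eqR] at h
  simpa using h

theorem nrm_sub_comm (x y : M.carrier X) : M.nrm (M.subXS x y) = M.nrm (M.subXS y x) := by
  have h := M.sat_ax (hT.subset (.inr (by simp [normAx]) :
    .all X (.all X (eqR (normX (subX x1 x0)) (normX (subX x0 x1)))) ∈ normedAx)) x y
  rw [sat_eqR] at h
  simpa using h

theorem nrm_sub_triangle (x y z : M.carrier X) :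
    M.nrm (M.subXS x z) ≤ M.nrm (M.subXS x y) + M.nrm (M.subXS y z) := by
  have h := M.sat_ax (hT.subset (.inr (by simp [normAx]) :
    .all X (.all X (.all X (leR (normX (subX x2 x0))
      (addR (normX (subX x2 x1)) (normX (subX x1 x0)))))) ∈ normedAx)) x y z
  rw [sat_leR] at h
  simpa using h

theorem nrm_smul_sub_smul (a : M.carrier one) (x y : M.carrier X) :
    M.nrm (M.subXS (M.smulXS a x) (M.smulXS a y)) = |M.real a| * M.nrm (M.subXS x y) := by
  have h := M.sat_ax (hT.subset (.inr (by simp [normAx]) :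
    .all one (.all X (.all X (eqR (normX (subX (smulX x2 x1) (smulX x2 x0)))
      (mulR (absR x2) (normX (subX x1 x0)))))) ∈ normedAx)) a x y
  rw [sat_eqR] at h
  simpa [real_absRS] using h

theorem nrm_smul_sub_smul' (a b : M.carrier one) (x : M.carrier X) :
    M.nrm (M.subXS (M.smulXS a x) (M.smulXS b x)) = |M.real a - M.real b| * M.nrm x := by
  have h := M.sat_ax (hT.subset (.inr (by simp [normAx]) :
    .all one (.all one (.all X (eqR (normX (subX (smulX x2 x0) (smulX x1 x0)))
      (mulR (absR (subR x2 x1)) (normX x0))))) ∈ normedAx)) a b x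
  rw [sat_eqR] at h
  simpa [real_absRS] using h

theorem nrm_add_sub_add (x y u v : M.carrier X) :
    M.nrm (M.subXS (M.addXS x y) (M.addXS u v)) ≤
      M.nrm (M.subXS x u) + M.nrm (M.subXS y v) := by
  have h := M.sat_ax (hT.subset (.inr (by simp [normAx]) :
    .all X (.all X (.all X (.all X (leR (normX (subX (addX x3 x2) (addX x1 x0)))
      (addR (normX (subX x3 x1)) (normX (subX x2 x0))))))) ∈ normedAx)) x y u v
  rw [sat_leR] at h
  simpa using h

theorem nrm_neg_sub_neg (x y : M.carrier X) :
    M.nrm (M.subXS (M.negXS x) (M.negXS y)) = M.nrm (M.subXS x y) := by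
  have h := M.sat_ax (hT.subset (.inr (by simp [normAx]) :
    .all X (.all X (eqR (normX (subX (negX x1) (negX x0))) (normX (subX x1 x0)))) ∈ normedAx)) x y
  rw [sat_eqR] at h
  simpa using h

theorem abs_nrm_sub_nrm_le (x y : M.carrier X) :
    |M.nrm x - M.nrm y| ≤ M.nrm (M.subXS x y) := by
  have h := M.sat_ax (hT.subset (.inr (by simp [normAx]) :
    .all X (.all X (leR (absR (subR (normX x1) (normX x0))) (normX (subX x1 x0)))) ∈ normedAx)) x y
  rw [sat_leR] at h
  simpa [real_absRS] using h

theorem nrm_sub_nonneg (x y : M.carrier X) : 0 ≤ M.nrm (M.subXS x y) :=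
  (abs_nonneg _).trans (M.abs_nrm_sub_nrm_le x y)

/-- Equality of points. -/
def pointSetoid : Setoid (M.carrier X) where
  r x y := M.nrm (M.subXS x y) = 0
  iseqv :=
    { refl := M.nrm_sub_self
      symm := fun h => (M.nrm_sub_comm _ _).trans h
      trans := fun {x y z} h h' => le_antisymm
        ((M.nrm_sub_triangle x y z).trans (by rw [h, h', add_zero])) (M.nrm_sub_nonneg x z) }

/-- The normed space of the model. -/
def V : Type := Quotient M.pointSetoid

/-- The vector given by a point. -/
def vec (x : M.carrier X) : M.V := Quotient.mk M.pointSetoid x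

theorem vec_eq_vec {x y : M.carrier X} : M.vec x = M.vec y ↔ M.nrm (M.subXS x y) = 0 :=
  Quotient.eq (r := M.pointSetoid)

theorem sat_eqX_iff {Γ : Ctx} (e : M.Env Γ) (x y : Tm L Γ X) :
    M.Sat e (eqX x y) ↔ M.vec (M.eval e x) = M.vec (M.eval e y) := by
  rw [vec_eq_vec, sat_eqX]

theorem vec_ind {P : M.V → Prop} (h : ∀ x, P (M.vec x)) (v : M.V) : P v := Quotient.ind h v

instance : Zero M.V := ⟨M.vec (M.con .zeroX)⟩
instance : Add M.V := ⟨Quotient.map₂ M.addXS fun x x' hx y y' hy => le_antisymm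
  ((M.nrm_add_sub_add x y x' y').trans (by rw [hx, hy, add_zero])) (M.nrm_sub_nonneg _ _)⟩
instance : Neg M.V := ⟨Quotient.map M.negXS fun x y h => (M.nrm_neg_sub_neg x y).trans h⟩
noncomputable instance : SMul M.R M.V :=
  ⟨fun a => Quotient.map (M.smulXS (M.exists_real a).choose) fun x y h => by
    refine (M.nrm_smul_sub_smul _ x y).trans ?_
    rw [h, mul_zero]⟩
/-- The norm of a vector. -/
noncomputable def norm (v : M.V) : M.R := Quotient.lift M.nrm (fun x y h => by
  have := M.abs_nrm_sub_nrm_le x y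
  rw [h, abs_le] at this
  linarith [this.1, this.2]) v

theorem vec_zero : M.vec (M.con .zeroX) = 0 := rfl
@[simp] theorem vec_add (x y : M.carrier X) : M.vec (M.addXS x y) = M.vec x + M.vec y := rfl
@[simp] theorem vec_neg (x : M.carrier X) : M.vec (M.negXS x) = -M.vec x := rfl
-- The scalar action picks an arbitrary name of the scalar; the norm axiom for a difference of two
-- scalars shows that the choice does not matter.
@[simp] theorem vec_smul (a : M.carrier one) (x : M.carrier X) :
    M.vec (M.smulXS a x) = M.real a • M.vec x := by
  refine M.vec_eq_vec.2 ((M.nrm_smul_sub_smul' _ _ x).trans ?_)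
  rw [(M.exists_real (M.real a)).choose_spec, sub_self, abs_zero, zero_mul]

theorem add_assoc_vec (x y z : M.V) : x + y + z = x + (y + z) := by
  induction x using M.vec_ind with | _ x =>
  induction y using M.vec_ind with | _ y =>
  induction z using M.vec_ind with | _ z =>
  exact (M.sat_eqX_iff _ _ _).1 (M.sat_ax (hT.subset (.inl (by simp [vectorSpaceAx]) :
    .all X (.all X (.all X (eqX (addX (addX x2 x1) x0) (addX x2 (addX x1 x0))))) ∈ normedAx)) x y z)

theorem add_comm_vec (x y : M.V) : x + y = y + x := by
  induction x using M.vec_ind with | _ x =>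
  induction y using M.vec_ind with | _ y =>
  exact (M.sat_eqX_iff _ _ _).1 (M.sat_ax (hT.subset (.inl (by simp [vectorSpaceAx]) :
    .all X (.all X (eqX (addX x1 x0) (addX x0 x1))) ∈ normedAx)) x y)

theorem add_zero_vec (x : M.V) : x + 0 = x := by
  induction x using M.vec_ind with | _ x =>
  exact (M.sat_eqX_iff _ _ _).1 (M.sat_ax (hT.subset (.inl (by simp [vectorSpaceAx]) :
    .all X (eqX (addX x0 zeroX) x0) ∈ normedAx)) x)

theorem add_neg_vec (x : M.V) : x + -x = 0 := by
  induction x using M.vec_ind with | _ x =>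
  exact (M.sat_eqX_iff _ _ _).1 (M.sat_ax (hT.subset (.inl (by simp [vectorSpaceAx]) :
    .all X (eqX (addX x0 (negX x0)) zeroX) ∈ normedAx)) x)

theorem one_smul_vec (x : M.V) : (1 : M.R) • x = x := by
  induction x using M.vec_ind with | _ x =>
  have h := (M.sat_eqX_iff _ _ _).1 (M.sat_ax (hT.subset (.inl (by simp [vectorSpaceAx]) :
    .all X (eqX (smulX oneR x0) x0) ∈ normedAx)) x)
  rwa [eval_smulX, vec_smul, real_oneR] at h

theorem smul_smul_vec (a b : M.R) (x : M.V) : a • b • x = (a * b) • x := by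
  obtain ⟨a, rfl⟩ := M.exists_real a
  obtain ⟨b, rfl⟩ := M.exists_real b
  induction x using M.vec_ind with | _ x =>
  have h := (M.sat_eqX_iff _ _ _).1 (M.sat_ax (hT.subset (.inl (by simp [vectorSpaceAx]) :
    .all one (.all one (.all X (eqX (smulX x2 (smulX x1 x0)) (smulX (mulR x2 x1) x0))))
      ∈ normedAx)) a b x)
  simpa using h

theorem smul_add_vec (a : M.R) (x y : M.V) : a • (x + y) = a • x + a • y := by
  obtain ⟨a, rfl⟩ := M.exists_real a
  induction x using M.vec_ind with | _ x =>
  induction y using M.vec_ind with | _ y =>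
  have h := (M.sat_eqX_iff _ _ _).1 (M.sat_ax (hT.subset (.inl (by simp [vectorSpaceAx]) :
    .all one (.all X (.all X (eqX (smulX x2 (addX x1 x0)) (addX (smulX x2 x1) (smulX x2 x0)))))
      ∈ normedAx)) a x y)
  simpa using h

theorem add_smul_vec (a b : M.R) (x : M.V) : (a + b) • x = a • x + b • x := by
  obtain ⟨a, rfl⟩ := M.exists_real a
  obtain ⟨b, rfl⟩ := M.exists_real b
  induction x using M.vec_ind with | _ x =>
  have h := (M.sat_eqX_iff _ _ _).1 (M.sat_ax (hT.subset (.inl (by simp [vectorSpaceAx]) :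
    .all one (.all one (.all X (eqX (smulX (addR x2 x1) x0) (addX (smulX x2 x0) (smulX x1 x0)))))
      ∈ normedAx)) a b x)
  simpa using h

noncomputable instance : AddCommGroup M.V where
  add_assoc := M.add_assoc_vec
  zero_add x := by rw [add_comm_vec, add_zero_vec]
  add_zero := M.add_zero_vec
  neg_add_cancel x := by rw [add_comm_vec, add_neg_vec]
  add_comm := M.add_comm_vec
  nsmul := nsmulRec
  zsmul := zsmulRec

noncomputable instance : Module M.R M.V :=
  .ofMinimalAxioms M.smul_add_vec M.add_smul_vec (fun a b x => (M.smul_smul_vec a b x).symm)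
    M.one_smul_vec

@[simp] theorem vec_sub (x y : M.carrier X) : M.vec (M.subXS x y) = M.vec x - M.vec y := by
  rw [subXS, vec_add, vec_neg, sub_eq_add_neg]

theorem nrm_eq (x : M.carrier X) : M.nrm x = M.norm (M.vec x) := rfl

theorem norm_zero : M.norm 0 = 0 := by
  have h := M.nrm_sub_self (M.con .zeroX)
  rwa [nrm_eq, vec_sub, sub_self] at h

theorem norm_nonneg (x : M.V) : 0 ≤ M.norm x := by
  induction x using M.vec_ind with | _ x =>
  have h := M.nrm_sub_nonneg x (M.con .zeroX)
  rwa [nrm_eq, vec_sub, vec_zero, sub_zero] at h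

theorem eq_zero_of_norm_eq_zero {x : M.V} (h : M.norm x = 0) : x = 0 := by
  induction x using M.vec_ind with | _ x =>
  rw [← vec_zero, vec_eq_vec, nrm_eq, vec_sub, vec_zero, sub_zero, h]

theorem norm_smul (a : M.R) (x : M.V) : M.norm (a • x) = |a| * M.norm x := by
  obtain ⟨a, rfl⟩ := M.exists_real a
  induction x using M.vec_ind with | _ x =>
  have h := M.nrm_smul_sub_smul a x (M.con .zeroX)
  simpa [nrm_eq, vec_zero] using h

theorem norm_add_le (x y : M.V) : M.norm (x + y) ≤ M.norm x + M.norm y := by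
  induction x using M.vec_ind with | _ x =>
  induction y using M.vec_ind with | _ y =>
  have h := M.nrm_sub_triangle x (M.con .zeroX) (M.negXS y)
  simpa [nrm_eq, vec_zero] using h

end Normed

/-- No nonzero element of `R` is infinitesimal with respect to the powers `2⁻ⁿ` of the model,
nonstandard `n` included. -/
theorem eq_zero_of_abs_le_eps {x C : M.R} (h : ∀ n, |x| ≤ M.ofQ (M.eps n) * C) : x = 0 := by
  by_contra hx
  have hx' := abs_pos.2 hx
  have hC : 0 < C := pos_of_mul_pos_right (hx'.trans_le (h 0)) (M.ofQ_pos.2 (M.eps_pos 0)).le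
  obtain ⟨n, hn⟩ := M.exists_ofQ_eps_lt (div_pos hx' hC)
  rw [lt_div_iff₀ hC] at hn
  exact absurd (h n) (not_le.2 hn)

/-! ### The inner product: the Jordan–von Neumann argument inside a model. -/

section Inner

variable [hT : IsInnerTheory T]

theorem parallelogram_law (x y : M.V) :
    M.norm (x + y) ^ 2 + M.norm (x - y) ^ 2 = 2 * (M.norm x ^ 2 + M.norm y ^ 2) := by
  induction x using M.vec_ind with | _ x =>
  induction y using M.vec_ind with | _ y =>
  have h := M.sat_ax (hT.subset (.inr rfl : parallelogram ∈ innerAx)) x y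
  rw [sat_eqR] at h
  simpa [nrm_eq] using h

/-- The deviation of `t ↦ ‖e + t d‖²` from `‖e‖² + t² ‖d‖²`. -/
noncomputable def cross (e d : M.V) (t : M.R) : M.R :=
  M.norm (e + t • d) ^ 2 - M.norm e ^ 2 - t ^ 2 * M.norm d ^ 2

/-- The parallelogram law for `e + s d` and `t d`; the quadratic terms cancel by the choice of
`cross`, leaving Jensen's functional equation. -/
theorem cross_add_cross_sub (e d : M.V) (s t : M.R) :
    M.cross e d (s + t) + M.cross e d (s - t) = 2 * M.cross e d s := by
  have h := M.parallelogram_law (e + s • d) (t • d)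
  rw [show e + s • d + t • d = e + (s + t) • d by module,
    show e + s • d - t • d = e + (s - t) • d by module, norm_smul, mul_pow, sq_abs] at h
  unfold cross
  linear_combination h

theorem cross_zero (e d : M.V) : M.cross e d 0 = 0 := by simp [cross]

/-- Jensen's equation at the midpoint of `s` and `t`, once with the half-sum and once with the
half-difference as increment. -/
theorem cross_add (e d : M.V) (s t : M.R) :
    M.cross e d (s + t) = M.cross e d s + M.cross e d t := by
  have h₁ := M.cross_add_cross_sub e d ((s + t) / 2) ((s + t) / 2)
  have h₂ := M.cross_add_cross_sub e d ((s + t) / 2) ((s - t) / 2)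
  rw [sub_self, cross_zero, add_zero, add_halves] at h₁
  rw [show (s + t) / 2 + (s - t) / 2 = s by ring, show (s + t) / 2 - (s - t) / 2 = t by ring] at h₂
  rw [h₁, h₂]

theorem cross_neg (e d : M.V) (t : M.R) : M.cross e d (-t) = -M.cross e d t := by
  have h := M.cross_add e d t (-t)
  rw [add_neg_cancel, cross_zero] at h
  linear_combination -h

/-- The triangle inequality, squared, bounds `cross` from above, and oddness gives the bound from
below. This is the continuity needed to pass from rational to real multiples. -/
theorem abs_cross_le (e d : M.V) (t : M.R) :
    |M.cross e d t| ≤ |t| * (2 * M.norm e * M.norm d) := by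
  have key : ∀ t, M.cross e d t ≤ |t| * (2 * M.norm e * M.norm d) := by
    intro t
    have h₁ := M.norm_add_le e (t • d)
    rw [norm_smul] at h₁
    have h₂ := pow_le_pow_left₀ (M.norm_nonneg _) h₁ 2
    rw [add_sq, mul_pow, sq_abs] at h₂
    unfold cross
    linarith
  rw [abs_le']
  refine ⟨key t, ?_⟩
  rw [← cross_neg, ← abs_neg t]
  exact key (-t)

/-- The number `n` may be nonstandard, so iterating additivity is not enough: homogeneity is spelled
out as a formula with names for `t`, `d`, `e` and proved by induction in the model. -/
theorem cross_nat_mul (e d : M.V) (n : M.N) (t : M.R) :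
    M.cross e d (M.ofQ (M.toQ n) * t) = M.ofQ (M.toQ n) * M.cross e d t := by
  obtain ⟨t, rfl⟩ := M.exists_real t
  induction e using M.vec_ind with | _ e =>
  induction d using M.vec_ind with | _ d =>
  refine M.induct' (P := fun n => M.cross (M.vec e) (M.vec d) (M.ofQ (M.toQ n) * M.real t) =
      M.ofQ (M.toQ n) * M.cross (M.vec e) (M.vec d) (M.real t))
    (eqR (subR (subR (sqR (normX (addX x3 (smulX (mulR (natR x0) x1) x2)))) (sqR (normX x3)))
        (mulR (sqR (mulR (natR x0) x1)) (sqR (normX x2))))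
      (mulR (natR x0) (subR (subR (sqR (normX (addX x3 (smulX x1 x2)))) (sqR (normX x3)))
        (mulR (sqR x1) (sqR (normX x2)))))) (t ∷ d ∷ e ∷ Interp.nil) ?_ ?_ ?_ n
  · intro n
    rw [sat_eqR]
    simp [cross, nrm_eq]
  · simp [cross_zero]
  · intro n ih
    rw [map_add, map_add, map_one, map_one, add_mul, cross_add, ih, one_mul, add_mul, one_mul]

theorem cross_rat (e d : M.V) (q : M.N) :
    M.cross e d (M.ofQ (M.val q)) = M.ofQ (M.val q) * M.cross e d 1 := by
  have hd : M.ofQ (M.toQ (M.denS q)) ≠ 0 := (M.ofQ_pos.2 (M.den_pos q)).ne'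
  have h₁ := M.cross_nat_mul e d (M.denS q) (M.ofQ (M.val q))
  have h₂ := M.cross_nat_mul e d (M.posS q) 1
  have h₃ := M.cross_nat_mul e d (M.negS q) 1
  have h₄ : M.ofQ (M.toQ (M.denS q)) * M.ofQ (M.val q) =
      M.ofQ (M.toQ (M.posS q)) + -M.ofQ (M.toQ (M.negS q)) := by
    rw [val, map_div₀, mul_div_cancel₀ _ hd, map_sub, sub_eq_add_neg]
  rw [mul_one] at h₂ h₃
  rw [h₄, cross_add, cross_neg, h₂, h₃] at h₁
  refine mul_left_cancel₀ hd ?_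
  rw [← h₁]
  linear_combination -M.cross e d 1 * h₄

/-- `t` is approximated by the terms of a name. By additivity the error is `cross` of the remainder
minus the remainder times `cross e d 1`, and both are at most a constant times `2⁻ⁿ`. -/
theorem cross_eq (e d : M.V) (t : M.R) : M.cross e d t = t * M.cross e d 1 := by
  obtain ⟨f, rfl⟩ := M.exists_real t
  rw [← sub_eq_zero]
  refine M.eq_zero_of_abs_le_eps (C := 2 * M.norm e * M.norm d + |M.cross e d 1|) fun n => ?_
  have h₁ := M.cross_rat e d (M.app (M.hatS f) n)
  have h₂ := M.abs_real_sub_le f n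
  change M.cross e d (M.ofQ (M.seq f n)) = M.ofQ (M.seq f n) * _ at h₁
  have h₃ := M.cross_add e d (M.ofQ (M.seq f n)) (M.real f - M.ofQ (M.seq f n))
  rw [add_sub_cancel, h₁] at h₃
  rw [show M.cross e d (M.real f) - M.real f * M.cross e d 1 =
    M.cross e d (M.real f - M.ofQ (M.seq f n)) +
      -((M.real f - M.ofQ (M.seq f n)) * M.cross e d 1) by linear_combination h₃]
  refine (abs_add_le _ _).trans ?_
  rw [abs_neg, abs_mul, mul_add]
  have h₅ := mul_nonneg (mul_nonneg zero_le_two (M.norm_nonneg e)) (M.norm_nonneg d)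
  exact add_le_add ((M.abs_cross_le e d _).trans (mul_le_mul_of_nonneg_right h₂ h₅))
    (mul_le_mul_of_nonneg_right h₂ (abs_nonneg _))

/-- The inner product. -/
noncomputable def inner (x y : M.V) : M.R := (M.norm (x + y) ^ 2 - M.norm (x - y) ^ 2) / 4

/-- Linearity of `cross` at `t` and at `-1`: the latter gives `cross e d 1 = 2 ⟨e, d⟩`. -/
theorem norm_add_smul_sq (e d : M.V) (t : M.R) :
    M.norm (e + t • d) ^ 2 = M.norm e ^ 2 + 2 * t * M.inner e d + t ^ 2 * M.norm d ^ 2 := by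
  have h₁ := M.cross_eq e d t
  have h₂ := M.cross_eq e d (-1)
  unfold cross at h₁ h₂
  rw [one_smul] at h₁ h₂
  rw [neg_one_smul, ← sub_eq_add_neg] at h₂
  unfold inner
  linear_combination h₁ + t / 2 * h₂

@[simp] theorem real_innerX {Γ : Ctx} (e : M.Env Γ) (x y : Tm L Γ X) :
    M.real (M.eval e (innerX x y)) = M.inner (M.vec (M.eval e x)) (M.vec (M.eval e y)) := by
  have h : M.ofQ (M.eps (1 + 1)) = 1 / 4 := by
    rw [eps_add_one, eps_one, map_div₀, map_div₀, map_ofNat, map_one]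
    norm_num
  simp only [innerX, eval_mulR, real_mulRS, real_twoNegR, eval_S, eval_O, succ_eq, zero_add, h,
    real_subR, real_sqR, real_normX, eval_addX, eval_subX, nrm_eq, vec_add, vec_sub, inner]
  ring

end Inner

end Model
end FinTypeArith

namespace FinTypeArith

namespace Model

variable {L : Lang} {T : Set (Fml L [])} (M : Model T)

/-! ### Resolvents -/

/-- The resolvent. -/
def JS (f : M.carrier one) (x : M.carrier X) : M.carrier X := M.app (M.app (M.con .resA) f) x

/-- `u ∈ A x`. -/
def Mem (u x : M.carrier X) : Prop := M.app (M.app (M.con .chiA) x) u = 0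

/-- `f⁻¹ (x - p) ∈ A p`, where the reciprocal is formed with the number `l`. -/
def Incl (l : M.N) (f : M.carrier one) (x p : M.carrier X) : Prop :=
  M.Mem (M.smulXS (M.invRS l f) (M.subXS x p)) p

/-- `(g / f) x + (1 - g / f) b`, where the reciprocal of `f` is formed with the number `l`. -/
def combXS (l : M.N) (g f : M.carrier one) (x b : M.carrier X) : M.carrier X :=
  M.eval (b ∷ x ∷ f ∷ g ∷ l ∷ Interp.nil)
    (addX (smulX (divR x4 x3 x2) x1) (smulX (subR oneR (divR x4 x3 x2)) x0))

section
variable {Γ : Ctx} (e : M.Env Γ) (l : Tm L Γ nat) (f g : Tm L Γ one) (x p : Tm L Γ X)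

@[simp] theorem eval_J : M.eval e (J f x) = M.JS (M.eval e f) (M.eval e x) := rfl

theorem sat_memA : M.Sat e (memA x p) ↔ M.Mem (M.eval e x) (M.eval e p) := Iff.rfl

theorem sat_resIncl : M.Sat e (resIncl l f x p) ↔
    M.Incl (M.eval e l) (M.eval e f) (M.eval e x) (M.eval e p) := by
  rw [resIncl, sat_memA]; simp [Incl]

theorem sat_domJ : M.Sat e (domJ l f x) ↔
    ∃ p, M.Incl (M.eval e l) (M.eval e f) (M.eval e x) p := by
  simp only [domJ, Interp.Sat, sat_resIncl, Interp.eval_wk, Interp.eval_var, Interp.cons_z]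

theorem eval_comb : M.eval e (addX (smulX (divR l g f) x) (smulX (subR oneR (divR l g f)) p)) =
    M.combXS (M.eval e l) (M.eval e g) (M.eval e f) (M.eval e x) (M.eval e p) := by
  simp [combXS, divR, subR, oneR]

end

theorem pos_of_eps_lt {l : M.N} {x : M.R} (h : M.ofQ (M.eps l) < x) : 0 < x :=
  (M.ofQ_pos.2 (M.eps_pos l)).trans h

theorem exists_eps_lt_real {Γ : Ctx} {e : M.Env Γ} {f : Tm L Γ one} (h : M.Sat e (ltR zeroR f)) :
    ∃ k, M.ofQ (M.eps k) < M.real (M.eval e f) := by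
  rw [sat_ltR, real_zeroR] at h
  exact M.exists_ofQ_eps_lt h

theorem sat_ltR_twoNegR {Γ : Ctx} {e : M.Env Γ} {l : Tm L Γ nat} {f : Tm L Γ one} :
    M.Sat e (ltR (twoNegR l) f) ↔ M.ofQ (M.eps (M.eval e l)) < M.real (M.eval e f) := by
  rw [sat_ltR, real_twoNegR]

theorem incl_of_totalRes (hA : totalRes ∈ T) {k : M.N} {f : M.carrier one}
    (hf : M.ofQ (M.eps k) < M.real f) (x : M.carrier X) : M.Incl k f x (M.JS f x) :=
  (M.sat_resIncl _ _ _ _ _).1 (M.sat_ax hA f x k (M.sat_ltR_twoNegR.2 hf))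

theorem incl_of_partialRes (hA : partialRes ∈ T) {k : M.N} {f : M.carrier one}
    (hf : M.ofQ (M.eps k) < M.real f) {x p : M.carrier X} (hp : M.Incl k f x p) :
    M.Incl k f x (M.JS f x) :=
  (M.sat_resIncl _ _ _ _ _).1 (M.sat_ax hA f x k ⟨M.sat_ltR_twoNegR.2 hf,
    (M.sat_domJ _ _ _ _).2 ⟨p, hp⟩⟩)

section Normed

variable [hT : IsNormedTheory T]

theorem sat_resIdentity {Γ : Ctx} (e : M.Env Γ) (l : Tm L Γ nat) (g f : Tm L Γ one)
    (x : Tm L Γ X) : M.Sat e (resIdentity l g f x) ↔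
      M.vec (M.JS (M.eval e f) (M.eval e x)) = M.vec (M.JS (M.eval e g)
        (M.combXS (M.eval e l) (M.eval e g) (M.eval e f) (M.eval e x)
          (M.JS (M.eval e f) (M.eval e x)))) := by
  rw [resIdentity, sat_eqX_iff, eval_J, eval_J, eval_comb, eval_J]

theorem sat_resBound {Γ : Ctx} (e : M.Env Γ) (l : Tm L Γ nat) (g f : Tm L Γ one)
    (x : Tm L Γ X) (hf : M.ofQ (M.eps (M.eval e l)) < M.real (M.eval e f)) :
    M.Sat e (resBound l g f x) ↔
      M.norm (M.vec (M.eval e x) - M.vec (M.JS (M.eval e g) (M.eval e x))) ≤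
        (2 + M.real (M.eval e g) / M.real (M.eval e f)) *
          M.norm (M.vec (M.eval e x) - M.vec (M.JS (M.eval e f) (M.eval e x))) := by
  rw [resBound, sat_leR]
  simp [nrm_eq, divR, M.real_invRS hf, div_eq_mul_inv]

theorem vec_combXS {l : M.N} {f : M.carrier one} (g : M.carrier one) (x b : M.carrier X)
    (hf : M.ofQ (M.eps l) < M.real f) : M.vec (M.combXS l g f x b) =
      (M.real g / M.real f) • M.vec x + (1 - M.real g / M.real f) • M.vec b := by
  simp [combXS, divR, M.real_invRS hf, div_eq_mul_inv]

theorem vec_smul_inv {l : M.N} {f : M.carrier one} (x p : M.carrier X)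
    (hf : M.ofQ (M.eps l) < M.real f) :
    M.vec (M.smulXS (M.invRS l f) (M.subXS x p)) = (M.real f)⁻¹ • (M.vec x - M.vec p) := by
  simp [M.real_invRS hf]

theorem inv_smul_comb {a b : M.R} (ha : 0 < a) (x p : M.V) :
    a⁻¹ • ((a / b) • x + (1 - a / b) • p - p) = b⁻¹ • (x - p) := by
  rw [show (a / b) • x + (1 - a / b) • p - p = (a / b) • (x - p) by module, smul_smul,
    ← mul_div_assoc, inv_mul_cancel₀ ha.ne', one_div]

/-- `γ⁻¹ (w - b)` and `λ⁻¹ (x - b)` are the same object if `w = (γ/λ) x + (1 - γ/λ) b`. -/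
theorem smul_inv_combXS {k l : M.N} {g f : M.carrier one} (x b : M.carrier X)
    (hg : M.ofQ (M.eps k) < M.real g) (hf : M.ofQ (M.eps l) < M.real f) :
    M.smulXS (M.invRS k g) (M.subXS (M.combXS l g f x b) b) =
      M.smulXS (M.invRS l f) (M.subXS x b) := by
  -- Stated for all models, because it serves both in the given model and in the arbitrary ones of
  -- the completeness argument below.
  have sat_lt : ∀ (M : Model T) {Γ : Ctx} (e : M.Env Γ) (f g : Tm L Γ one) (n : Tm L Γ nat),
      M.Sat e (leQ (twoNegQ n) (subQ (hat g (S n)) (hat f (S n)))) ↔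
        M.eps (M.eval e n) ≤ M.seq (M.eval e g) (M.eval e n + 1) -
          M.seq (M.eval e f) (M.eval e n + 1) := by
    intro M Γ e f g n
    simp only [leQ, subQ, Interp.Sat, Interp.eval_app, eval_leQC, eval_O, leQS_eq_zero,
      eval_twoNegQ, eval_addQ, eval_negQ, eval_hat, eval_S, succ_eq, val_twoNeg, val_addQS,
      val_negQS, seq, sub_eq_add_neg]
  have eval_two : ∀ (M : Model T) {Γ : Ctx} (e : M.Env Γ) (n : Tm L Γ nat),
      M.eval e (twoNegR n) = M.ratS (M.pairS (1 + 1) (M.predS (M.pow2S (M.eval e n)))) := by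
    intro M Γ e n
    simp [twoNegR]
  have real_two : ∀ (M : Model T) (n : M.N),
      M.real (M.ratS (M.pairS (1 + 1) (M.predS (M.pow2S n)))) = M.ofQ (M.eps n) := by
    intro M n
    simp
  -- The witnesses `n₁`, `n₂` of the strict inequalities are extracted in order to become values of
  -- free variables.
  rw [← real_two, real_lt] at hg hf
  obtain ⟨n₁, hg⟩ := hg
  obtain ⟨n₂, hf⟩ := hf
  let s : Tm L [X, X, one, one, nat, nat, nat, nat] X :=
    smulX (invR (.var (.s (.s (.s (.s (.s .z)))))) x3) (subX (addX (smulX (divR x4 x3 x2) x1) (smulX (subR oneR (divR x4 x3 x2)) x0)) x0)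
  let t : Tm L [X, X, one, one, nat, nat, nat, nat] X := smulX (invR x4 x2) (subX x1 x0)
  let v₁ : Tm L [X, X, one, one, nat, nat, nat, nat] nat := .var (.s (.s (.s (.s (.s (.s .z))))))
  let v₂ : Tm L [X, X, one, one, nat, nat, nat, nat] nat :=
    .var (.s (.s (.s (.s (.s (.s (.s .z)))))))
  -- The conditions `γ > 2⁻ᵏ` and `λ > 2⁻ˡ` with their existential witnesses replaced by variables:
  -- a quantifier-free hypothesis, as the extensionality rule demands.
  let A : Fml L [X, X, one, one, nat, nat, nat, nat] :=
    leQ (twoNegQ v₁) (subQ (hat x3 (S v₁)) (hat (twoNegR (.var (.s (.s (.s (.s (.s .z)))))))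
      (S v₁))) ⊓ₗ
    leQ (twoNegQ v₂) (subQ (hat x2 (S v₂)) (hat (twoNegR x4) (S v₂)))
  -- The vectors agree in every model of the hypothesis, so by completeness the equation is
  -- derivable from it.
  have hA : Drv T (A ⟶ₗ eqT s t) := by
    refine Drv.of_models fun M e => ?_
    rintro ⟨h₁, h₂⟩
    rw [sat_lt, eval_two] at h₁ h₂
    have h₁ := M.real_lt.2 ⟨_, h₁⟩
    have h₂ := M.real_lt.2 ⟨_, h₂⟩
    rw [real_two] at h₁ h₂
    refine (M.sat_eqX_iff _ _ _).2 ?_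
    simp only [s, t, eval_smulX, eval_invR, eval_subX, eval_comb]
    rw [M.vec_smul_inv _ _ h₁, M.vec_smul_inv _ _ h₂, M.vec_combXS _ _ _ h₂,
      M.inv_smul_comb (M.pos_of_eps_lt h₁)]
  -- A derivable equation under a true quantifier-free hypothesis is an identity of elements, not
  -- merely `=_X`.
  have h := M.ext (A := A) ⟨trivial, trivial⟩ hA
    (b ∷ x ∷ f ∷ g ∷ l ∷ k ∷ n₁ ∷ n₂ ∷ Interp.nil) ?_
  · simpa only [s, t, eval_smulX, eval_invR, eval_subX, eval_comb, Interp.eval_var,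
      Interp.cons_z, Interp.cons_s] using h
  · refine ⟨?_, ?_⟩ <;> rw [sat_lt, eval_two]
    · exact hg
    · exact hf

/-- The graph of the operator. -/
def Graph (a u : M.V) : Prop := ∃ x y, M.vec x = a ∧ M.vec y = u ∧ M.Mem y x

theorem Incl.graph {M : Model T} {l : M.N} {f : M.carrier one} {x p : M.carrier X}
    (h : M.Incl l f x p) (hf : M.ofQ (M.eps l) < M.real f) :
    M.Graph (M.vec p) ((M.real f)⁻¹ • (M.vec x - M.vec p)) :=
  ⟨_, _, rfl, M.vec_smul_inv x p hf, h⟩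

/-- The resolvent of index `c` is single-valued. -/
def UniqueRes (c : M.R) : Prop :=
  ∀ a b u v, M.Graph a u → M.Graph b v → a + c • u = b + c • v → a = b

/-- The resolvent of index `c` is nonexpansive. -/
def NonexpRes (c : M.R) : Prop := ∀ a b u v, M.Graph a u → M.Graph b v →
  M.norm (a - b) ≤ M.norm (a - b + c • (u - v))

/-- Both `b` and `J_γ w`, with `w` the combination, solve `p + γ u = w` with `u ∈ A p`: for `b` one
has `b + γ λ⁻¹ (x - b) = w`. -/
theorem identity {l k : M.N} {g f : M.carrier one} {x b : M.carrier X}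
    (hg : M.ofQ (M.eps k) < M.real g) (hf : M.ofQ (M.eps l) < M.real f)
    (hu : M.UniqueRes (M.real g)) (h₁ : M.Incl l f x b)
    (h₂ : M.Incl k g (M.combXS l g f x b) (M.JS g (M.combXS l g f x b))) :
    M.vec b = M.vec (M.JS g (M.combXS l g f x b)) := by
  refine hu _ _ _ _ (h₁.graph hf) (h₂.graph hg) ?_
  have hg0 := (M.pos_of_eps_lt hg).ne'
  rw [smul_inv_smul₀ hg0, M.vec_combXS _ _ _ hf, smul_smul, div_eq_mul_inv]
  module

/-- With `u = γ⁻¹ (x - a)` and `v = λ⁻¹ (x - b)`, the vector `a - b + γ (u - v)` collapses to `(1 -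
γ/λ)(x - b)`. So `‖a - b‖ ≤ (1 + γ/λ) ‖x - b‖`, and the triangle inequality through `b` adds one
more `‖x - b‖`. -/
theorem bound {l k : M.N} {g f : M.carrier one} {x a b : M.carrier X}
    (hg : M.ofQ (M.eps k) < M.real g) (hf : M.ofQ (M.eps l) < M.real f)
    (hn : M.NonexpRes (M.real g)) (h₁ : M.Incl l f x b) (h₂ : M.Incl k g x a) :
    M.norm (M.vec x - M.vec a) ≤ (2 + M.real g / M.real f) * M.norm (M.vec x - M.vec b) := by
  have h := hn _ _ _ _ (h₂.graph hg) (h₁.graph hf)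
  have hg0 := M.pos_of_eps_lt hg
  have hf0 := M.pos_of_eps_lt hf
  rw [smul_sub, smul_inv_smul₀ hg0.ne', smul_smul, ← div_eq_mul_inv,
    show M.vec a - M.vec b + (M.vec x - M.vec a - (M.real g / M.real f) • (M.vec x - M.vec b)) =
      (1 - M.real g / M.real f) • (M.vec x - M.vec b) by module, norm_smul] at h
  have h' := M.norm_add_le (M.vec x - M.vec b) ((-1 : M.R) • (M.vec a - M.vec b))
  rw [norm_smul, abs_neg, abs_one, one_mul,
    show M.vec x - M.vec b + (-1 : M.R) • (M.vec a - M.vec b) = M.vec x - M.vec a by module] at h'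
  have hq := div_pos hg0 hf0
  have hq' : |1 - M.real g / M.real f| ≤ 1 + M.real g / M.real f := by
    rw [abs_le]; constructor <;> linarith
  have := mul_le_mul_of_nonneg_right hq' (M.norm_nonneg (M.vec x - M.vec b))
  linarith

theorem uniqueRes_of_nonexpRes {c : M.R} (h : M.NonexpRes c) : M.UniqueRes c := by
  intro a b u v hu hv hab
  have h' := h a b u v hu hv
  rw [show a - b + c • (u - v) = a + c • u - (b + c • v) by module, hab, sub_self, norm_zero] at h'
  exact sub_eq_zero.1 (M.eq_zero_of_norm_eq_zero (h'.antisymm (M.norm_nonneg _)))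

theorem nonexpRes_of_accretive (hA : accretive ∈ T) {c : M.R} (hc : 0 < c) : M.NonexpRes c := by
  rintro _ _ _ _ ⟨a, u, rfl, rfl, hu⟩ ⟨b, v, rfl, rfl, hv⟩
  obtain ⟨f, rfl⟩ := M.exists_real c
  have h := M.sat_ax hA a b u v f ⟨hu, hv⟩
  rw [sat_leR] at h
  simpa [nrm_eq, real_absRS, abs_of_pos hc] using h

/-- `b` itself witnesses that `w` is in the domain of the resolvent of index `γ`. The membership can
be transported because `smul_inv_combXS` is an identity of objects; equality in `V` would not do. -/
theorem incl_combXS {k l : M.N} {g f : M.carrier one} {x b : M.carrier X}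
    (hg : M.ofQ (M.eps k) < M.real g) (hf : M.ofQ (M.eps l) < M.real f) (h : M.Incl l f x b) :
    M.Incl k g (M.combXS l g f x b) b := by
  unfold Incl
  rw [M.smul_inv_combXS x b hg hf]
  exact h

end Normed

end Model

/-! ### Comonotone operators. -/

namespace Model

variable {T : Set (Fml .como [])} (M : Model T)

/-- The comonotonicity parameter. -/
noncomputable def rho : M.R := M.real (M.con .rhoT)

@[simp] theorem real_rhoT {Γ : Ctx} (e : M.Env Γ) : M.real (M.eval e rhoT) = M.rho := rfl

theorem sat_rhoGtHalf {Γ : Ctx} (e : M.Env Γ) (f : Tm .como Γ one) :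
    M.Sat e (rhoGtHalf f) ↔ -(M.real (M.eval e f) / 2) < M.rho := by
  rw [rhoGtHalf, sat_ltR]; simp

theorem incl_of_totalResStar (hA : totalResStar ∈ T) {k : M.N} {f : M.carrier one}
    (hr : -(M.real f / 2) < M.rho) (hf : M.ofQ (M.eps k) < M.real f) (x : M.carrier X) :
    M.Incl k f x (M.JS f x) :=
  (M.sat_resIncl _ _ _ _ _).1 (M.sat_ax hA f x k ⟨(M.sat_rhoGtHalf _ _).2 hr,
    M.sat_ltR_twoNegR.2 hf⟩)

theorem incl_of_partialResStar (hA : partialResStar ∈ T) {k : M.N} {f : M.carrier one}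
    (hr : -(M.real f / 2) < M.rho) (hf : M.ofQ (M.eps k) < M.real f) {x p : M.carrier X}
    (hp : M.Incl k f x p) : M.Incl k f x (M.JS f x) :=
  (M.sat_resIncl _ _ _ _ _).1 (M.sat_ax hA f x k ⟨(M.sat_rhoGtHalf _ _).2 hr,
    M.sat_ltR_twoNegR.2 hf, (M.sat_domJ _ _ _ _).2 ⟨p, hp⟩⟩)

variable [hT : IsInnerTheory T]

theorem le_inner_of_comonotone (hA : comonotone ∈ T) {a b u v : M.V} (hu : M.Graph a u)
    (hv : M.Graph b v) : M.rho * M.norm (u - v) ^ 2 ≤ M.inner (a - b) (u - v) := by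
  obtain ⟨a, u, rfl, rfl, hu⟩ := hu
  obtain ⟨b, v, rfl, rfl, hv⟩ := hv
  have h := M.sat_ax hA a b u v ⟨hu, hv⟩
  rw [sat_leR] at h
  simpa [nrm_eq] using h

/-- If `a + c u = b + c v`, then `a - b = -c (u - v)`, so `⟨a - b, u - v⟩ = -c ‖u - v‖²`.
Comonotonicity with `ρ̃ > -c` forces `u = v` and hence `a = b`. Homogeneity of the norm suffices to
compute this inner product. -/
theorem uniqueRes_of_comonotone (hA : comonotone ∈ T) {c : M.R} (hc : -c < M.rho) :
    M.UniqueRes c := by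
  intro a b u v hu hv hab
  have h := M.le_inner_of_comonotone hA hu hv
  have hab' : a - b = (-c) • (u - v) := by
    rw [show a - b = a + c • u - (b + c • v) + (-c) • (u - v) by module, hab, sub_self, zero_add]
  have h₁ : M.inner (a - b) (u - v) = -c * M.norm (u - v) ^ 2 := by
    unfold inner
    rw [hab', show (-c) • (u - v) + (u - v) = (1 - c) • (u - v) by module,
      show (-c) • (u - v) - (u - v) = (-c - 1) • (u - v) by module, norm_smul, norm_smul, mul_pow,
      mul_pow, sq_abs, sq_abs]
    ring
  rw [h₁] at h
  have h₂ : M.norm (u - v) ^ 2 = 0 := by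
    by_contra h0
    have := mul_pos (sub_pos.2 hc) (lt_of_le_of_ne (sq_nonneg _) (Ne.symm h0))
    linarith
  rw [M.eq_zero_of_norm_eq_zero (pow_eq_zero_iff two_ne_zero |>.1 h₂), smul_zero] at hab'
  exact sub_eq_zero.1 hab'

/-- Expanding the square, `‖a - b + c (u - v)‖²` exceeds `‖a - b‖²` by `2c ⟨a - b, u - v⟩ + c² ‖u -
v‖² ≥ c (2 ρ̃ + c) ‖u - v‖² ≥ 0`. -/
theorem nonexpRes_of_comonotone (hA : comonotone ∈ T) {c : M.R} (hc : 0 < c)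
    (hr : -(c / 2) ≤ M.rho) : M.NonexpRes c := by
  intro a b u v hu hv
  have h := M.le_inner_of_comonotone hA hu hv
  have h₁ := M.norm_add_smul_sq (a - b) (u - v) c
  have h₂ := mul_le_mul_of_nonneg_right hr (sq_nonneg (M.norm (u - v)))
  have h₃ := mul_le_mul_of_nonneg_left (h₂.trans h) (by linarith : 0 ≤ 2 * c)
  refine (pow_le_pow_iff_left₀ (M.norm_nonneg _) (M.norm_nonneg _) two_ne_zero).1 ?_
  linarith

end Model
end FinTypeArith

namespace FinTypeArith

/-! ### Derivability in the individual systems. -/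

section Deriv

instance : IsNormedTheory sysV := ⟨Set.subset_union_left⟩
instance : IsNormedTheory sysVp := ⟨Set.subset_union_left⟩
instance : IsInnerTheory sysT := ⟨Set.subset_union_left⟩
instance : IsInnerTheory sysTp := ⟨Set.subset_union_left⟩
instance : IsInnerTheory sysU := ⟨Set.subset_union_left⟩
instance : IsInnerTheory sysUp := ⟨Set.subset_union_left⟩
instance : IsInnerTheory sysUStar := ⟨Set.subset_union_left⟩
instance : IsInnerTheory sysUpStar := ⟨Set.subset_union_left⟩

variable {L : Lang} {T : Set (Fml L [])}

/-- Derivability of the resolvent identity from a condition `H` on `γ`, `λ`, `x`, `l`. -/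
theorem Drv.identity [IsNormedTheory T] {H : Fml L [nat, X, one, one]}
    (h : ∀ (M : Model T) (g f : M.carrier one) (x : M.carrier X) (l : M.N),
      M.Sat (l ∷ x ∷ f ∷ g ∷ Interp.nil) H → ∃ k, M.ofQ (M.eps k) < M.real g ∧
        M.ofQ (M.eps l) < M.real f ∧ M.UniqueRes (M.real g) ∧ M.Incl l f x (M.JS f x) ∧
        M.Incl k g (M.combXS l g f x (M.JS f x)) (M.JS g (M.combXS l g f x (M.JS f x)))) :
    Proves T (Γ := []) (.all one (.all one (.all X (.all nat
      (H ⟶ₗ resIdentity x0 x3 x2 x1))))) := by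
  refine Drv.proves (Drv.of_models fun M e g f x l hH => ?_)
  obtain rfl : e = Interp.nil := by funext τ v; cases v
  obtain ⟨k, hg, hf, hu, h₁, h₂⟩ := h M g f x l hH
  exact (M.sat_resIdentity _ _ _ _ _).2 (M.identity hg hf hu h₁ h₂)

/-- Derivability of the resolvent bound from a condition `H` on `γ`, `λ`, `x`, `l`. -/
theorem Drv.bound [IsNormedTheory T] {H : Fml L [nat, X, one, one]}
    (h : ∀ (M : Model T) (g f : M.carrier one) (x : M.carrier X) (l : M.N),
      M.Sat (l ∷ x ∷ f ∷ g ∷ Interp.nil) H → ∃ k, M.ofQ (M.eps k) < M.real g ∧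
        M.ofQ (M.eps l) < M.real f ∧ M.NonexpRes (M.real g) ∧ M.Incl l f x (M.JS f x) ∧
        M.Incl k g x (M.JS g x)) :
    Proves T (Γ := []) (.all one (.all one (.all X (.all nat
      (H ⟶ₗ resBound x0 x3 x2 x1))))) := by
  refine Drv.proves (Drv.of_models fun M e g f x l hH => ?_)
  obtain rfl : e = Interp.nil := by funext τ v; cases v
  obtain ⟨k, hg, hf, hu, h₁, h₂⟩ := h M g f x l hH
  refine (M.sat_resBound (l ∷ x ∷ f ∷ g ∷ Interp.nil) x0 x3 x2 x1 hf).2 ?_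
  exact M.bound hg hf hu h₁ h₂

/-- Derivability of the resolvent bound from a condition `H` on `γ`, `λ`, `x`, `k`, `l`. -/
theorem Drv.bound_of_dom [IsNormedTheory T] {H : Fml L [nat, nat, X, one, one]}
    (h : ∀ (M : Model T) (g f : M.carrier one) (x : M.carrier X) (k l : M.N),
      M.Sat (l ∷ k ∷ x ∷ f ∷ g ∷ Interp.nil) H → M.ofQ (M.eps k) < M.real g ∧
        M.ofQ (M.eps l) < M.real f ∧ M.NonexpRes (M.real g) ∧ M.Incl l f x (M.JS f x) ∧
        M.Incl k g x (M.JS g x)) :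
    Proves T (Γ := []) (.all one (.all one (.all X (.all nat (.all nat
      (H ⟶ₗ resBound x0 x4 x3 x2)))))) := by
  refine Drv.proves (Drv.of_models fun M e g f x k l hH => ?_)
  obtain rfl : e = Interp.nil := by funext τ v; cases v
  obtain ⟨hg, hf, hu, h₁, h₂⟩ := h M g f x k l hH
  refine (M.sat_resBound (l ∷ k ∷ x ∷ f ∷ g ∷ Interp.nil) x0 x4 x3 x2 hf).2 ?_
  exact M.bound hg hf hu h₁ h₂

theorem Drv.identity_of_accretive [IsNormedTheory T] (hA : accretive ∈ T) (hJ : totalRes ∈ T) :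
    Proves T (Γ := []) (.all one (.all one (.all X (.all nat
      (ltR zeroR x3 ⊓ₗ ltR (twoNegR x0) x2 ⟶ₗ resIdentity x0 x3 x2 x1))))) := by
  refine Drv.identity fun M g f x l ⟨hg, hf⟩ => ?_
  -- The hypothesis `γ > 0` comes without a number `k`; one with `γ > 2⁻ᵏ` is found in the model,
  -- since the resolvent axiom needs it to form the reciprocal.
  obtain ⟨k, hk⟩ := M.exists_eps_lt_real hg
  have hf := M.sat_ltR_twoNegR.1 hf
  exact ⟨k, hk, hf, M.uniqueRes_of_nonexpRes (M.nonexpRes_of_accretive hA (M.pos_of_eps_lt hk)),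
    M.incl_of_totalRes hJ hf _, M.incl_of_totalRes hJ hk _⟩

theorem Drv.bound_of_accretive [IsNormedTheory T] (hA : accretive ∈ T) (hJ : totalRes ∈ T) :
    Proves T (Γ := []) (.all one (.all one (.all X (.all nat
      (ltR zeroR x3 ⊓ₗ ltR (twoNegR x0) x2 ⟶ₗ resBound x0 x3 x2 x1))))) := by
  refine Drv.bound fun M g f x l ⟨hg, hf⟩ => ?_
  obtain ⟨k, hk⟩ := M.exists_eps_lt_real hg
  have hf := M.sat_ltR_twoNegR.1 hf
  exact ⟨k, hk, hf, M.nonexpRes_of_accretive hA (M.pos_of_eps_lt hk),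
    M.incl_of_totalRes hJ hf _, M.incl_of_totalRes hJ hk _⟩

theorem Drv.identity_of_accretive_of_dom [IsNormedTheory T] (hA : accretive ∈ T)
    (hJ : partialRes ∈ T) : Proves T (Γ := []) (.all one (.all one (.all X (.all nat
      (ltR zeroR x3 ⊓ₗ ltR (twoNegR x0) x2 ⊓ₗ domJ x0 x2 x1 ⟶ₗ
        resIdentity x0 x3 x2 x1))))) := by
  refine Drv.identity fun M g f x l ⟨hg, hf, hd⟩ => ?_
  obtain ⟨k, hk⟩ := M.exists_eps_lt_real hg
  have hf := M.sat_ltR_twoNegR.1 hf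
  obtain ⟨p, hp⟩ := (M.sat_domJ _ _ _ _).1 hd
  -- The domain hypothesis is used only for `λ`; the domain condition at `γ` for the combination
  -- follows from the inclusion obtained here.
  have hJf := M.incl_of_partialRes hJ hf hp
  exact ⟨k, hk, hf, M.uniqueRes_of_nonexpRes (M.nonexpRes_of_accretive hA (M.pos_of_eps_lt hk)),
    hJf, M.incl_of_partialRes hJ hk (M.incl_combXS hk hf hJf)⟩

theorem Drv.bound_of_accretive_of_dom [IsNormedTheory T] (hA : accretive ∈ T)
    (hJ : partialRes ∈ T) : Proves T (Γ := []) (.all one (.all one (.all X (.all nat (.all nat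
      (ltR (twoNegR x1) x4 ⊓ₗ ltR (twoNegR x0) x3 ⊓ₗ domJ x1 x4 x2 ⊓ₗ domJ x0 x3 x2 ⟶ₗ
        resBound x0 x4 x3 x2)))))) := by
  refine Drv.bound_of_dom fun M g f x k l ⟨hg, hf, hdg, hdf⟩ => ?_
  have hg := M.sat_ltR_twoNegR.1 hg
  have hf := M.sat_ltR_twoNegR.1 hf
  obtain ⟨p, hp⟩ := (M.sat_domJ _ _ _ _).1 hdf
  obtain ⟨q, hq⟩ := (M.sat_domJ _ _ _ _).1 hdg
  exact ⟨hg, hf, M.nonexpRes_of_accretive hA (M.pos_of_eps_lt hg),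
    M.incl_of_partialRes hJ hf hp, M.incl_of_partialRes hJ hg hq⟩

theorem proves_sysU_identity : Proves sysU (Γ := []) (.all one (.all one (.all X (.all nat
    (ltR zeroR x3 ⊓ₗ ltR (twoNegR x0) x2 ⊓ₗ ltR (negR x3) rhoT ⟶ₗ
      resIdentity x0 x3 x2 x1))))) := by
  have hJ : totalRes ∈ sysU := by simp [sysU]
  have hA : comonotone ∈ sysU := by simp [sysU]
  refine Drv.identity fun M g f x l ⟨hg, hf, hr⟩ => ?_
  obtain ⟨k, hk⟩ := M.exists_eps_lt_real hg
  have hf := M.sat_ltR_twoNegR.1 hf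
  rw [Model.sat_ltR, Model.eval_negR, Model.real_negRS, Model.real_rhoT] at hr
  exact ⟨k, hk, hf, M.uniqueRes_of_comonotone hA hr,
    M.incl_of_totalRes hJ hf _, M.incl_of_totalRes hJ hk _⟩

theorem proves_sysU_bound : Proves sysU (Γ := []) (.all one (.all one (.all X (.all nat
    (ltR zeroR x3 ⊓ₗ ltR (twoNegR x0) x2 ⊓ₗ leR (negR (halfR x3)) rhoT ⟶ₗ
      resBound x0 x3 x2 x1))))) := by
  have hJ : totalRes ∈ sysU := by simp [sysU]
  have hA : comonotone ∈ sysU := by simp [sysU]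
  refine Drv.bound fun M g f x l ⟨hg, hf, hr⟩ => ?_
  obtain ⟨k, hk⟩ := M.exists_eps_lt_real hg
  have hf := M.sat_ltR_twoNegR.1 hf
  rw [Model.sat_leR, Model.eval_negR, Model.real_negRS, Model.real_halfR, Model.real_rhoT] at hr
  exact ⟨k, hk, hf, M.nonexpRes_of_comonotone hA (M.pos_of_eps_lt hk) hr,
    M.incl_of_totalRes hJ hf _, M.incl_of_totalRes hJ hk _⟩

theorem Model.uniqueRes_of_half {T : Set (Fml .como [])} (M : Model T) [IsInnerTheory T]
    (hA : comonotone ∈ T) {c : M.R} (hc : 0 < c) (hr : -(c / 2) < M.rho) : M.UniqueRes c :=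
  M.uniqueRes_of_nonexpRes (M.nonexpRes_of_comonotone hA hc hr.le)

theorem proves_sysUStar_identity : Proves sysUStar (Γ := []) (.all one (.all one (.all X (.all nat
    (ltR zeroR x3 ⊓ₗ ltR (twoNegR x0) x2 ⊓ₗ rhoGtHalf x2 ⊓ₗ rhoGtHalf x3 ⟶ₗ
      resIdentity x0 x3 x2 x1))))) := by
  have hJ : totalResStar ∈ sysUStar := by simp [sysUStar]
  have hA : comonotone ∈ sysUStar := by simp [sysUStar]
  refine Drv.identity fun M g f x l ⟨hg, hf, hrf, hrg⟩ => ?_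
  obtain ⟨k, hk⟩ := M.exists_eps_lt_real hg
  have hf := M.sat_ltR_twoNegR.1 hf
  have hrf := (M.sat_rhoGtHalf _ _).1 hrf
  have hrg := (M.sat_rhoGtHalf _ _).1 hrg
  exact ⟨k, hk, hf, M.uniqueRes_of_half hA (M.pos_of_eps_lt hk) hrg,
    M.incl_of_totalResStar hJ hrf hf _, M.incl_of_totalResStar hJ hrg hk _⟩

theorem proves_sysUStar_bound : Proves sysUStar (Γ := []) (.all one (.all one (.all X (.all nat
    (ltR zeroR x3 ⊓ₗ ltR (twoNegR x0) x2 ⊓ₗ rhoGtHalf x2 ⊓ₗ rhoGtHalf x3 ⟶ₗ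
      resBound x0 x3 x2 x1))))) := by
  have hJ : totalResStar ∈ sysUStar := by simp [sysUStar]
  have hA : comonotone ∈ sysUStar := by simp [sysUStar]
  refine Drv.bound fun M g f x l ⟨hg, hf, hrf, hrg⟩ => ?_
  obtain ⟨k, hk⟩ := M.exists_eps_lt_real hg
  have hf := M.sat_ltR_twoNegR.1 hf
  have hrf := (M.sat_rhoGtHalf _ _).1 hrf
  have hrg := (M.sat_rhoGtHalf _ _).1 hrg
  exact ⟨k, hk, hf, M.nonexpRes_of_comonotone hA (M.pos_of_eps_lt hk) hrg.le,
    M.incl_of_totalResStar hJ hrf hf _, M.incl_of_totalResStar hJ hrg hk _⟩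

theorem proves_sysUp_identity : Proves sysUp (Γ := []) (.all one (.all one (.all X (.all nat
    (ltR zeroR x3 ⊓ₗ ltR (twoNegR x0) x2 ⊓ₗ ltR (negR x3) rhoT ⊓ₗ domJ x0 x2 x1 ⟶ₗ
      resIdentity x0 x3 x2 x1))))) := by
  have hJ : partialRes ∈ sysUp := by simp [sysUp]
  have hA : comonotone ∈ sysUp := by simp [sysUp]
  refine Drv.identity fun M g f x l ⟨hg, hf, hr, hd⟩ => ?_
  obtain ⟨k, hk⟩ := M.exists_eps_lt_real hg
  have hf := M.sat_ltR_twoNegR.1 hf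
  rw [Model.sat_ltR, Model.eval_negR, Model.real_negRS, Model.real_rhoT] at hr
  obtain ⟨p, hp⟩ := (M.sat_domJ _ _ _ _).1 hd
  have hJf := M.incl_of_partialRes hJ hf hp
  exact ⟨k, hk, hf, M.uniqueRes_of_comonotone hA hr, hJf,
    M.incl_of_partialRes hJ hk (M.incl_combXS hk hf hJf)⟩

theorem proves_sysUp_bound :
    Proves sysUp (Γ := []) (.all one (.all one (.all X (.all nat (.all nat
      (ltR (twoNegR x1) x4 ⊓ₗ ltR (twoNegR x0) x3 ⊓ₗ leR (negR (halfR x4)) rhoT ⊓ₗ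
        domJ x1 x4 x2 ⊓ₗ domJ x0 x3 x2 ⟶ₗ resBound x0 x4 x3 x2)))))) := by
  have hJ : partialRes ∈ sysUp := by simp [sysUp]
  have hA : comonotone ∈ sysUp := by simp [sysUp]
  refine Drv.bound_of_dom fun M g f x k l ⟨hg, hf, hr, hdg, hdf⟩ => ?_
  have hg := M.sat_ltR_twoNegR.1 hg
  have hf := M.sat_ltR_twoNegR.1 hf
  rw [Model.sat_leR, Model.eval_negR, Model.real_negRS, Model.real_halfR, Model.real_rhoT] at hr
  obtain ⟨p, hp⟩ := (M.sat_domJ _ _ _ _).1 hdf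
  obtain ⟨q, hq⟩ := (M.sat_domJ _ _ _ _).1 hdg
  exact ⟨hg, hf, M.nonexpRes_of_comonotone hA (M.pos_of_eps_lt hg) hr,
    M.incl_of_partialRes hJ hf hp, M.incl_of_partialRes hJ hg hq⟩

theorem proves_sysUpStar_identity :
    Proves sysUpStar (Γ := []) (.all one (.all one (.all X (.all nat
      (ltR zeroR x3 ⊓ₗ ltR (twoNegR x0) x2 ⊓ₗ rhoGtHalf x3 ⊓ₗ rhoGtHalf x2 ⊓ₗ
        domJ x0 x2 x1 ⟶ₗ resIdentity x0 x3 x2 x1))))) := by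
  have hJ : partialResStar ∈ sysUpStar := by simp [sysUpStar]
  have hA : comonotone ∈ sysUpStar := by simp [sysUpStar]
  refine Drv.identity fun M g f x l ⟨hg, hf, hrg, hrf, hd⟩ => ?_
  obtain ⟨k, hk⟩ := M.exists_eps_lt_real hg
  have hf := M.sat_ltR_twoNegR.1 hf
  have hrf := (M.sat_rhoGtHalf _ _).1 hrf
  have hrg := (M.sat_rhoGtHalf _ _).1 hrg
  obtain ⟨p, hp⟩ := (M.sat_domJ _ _ _ _).1 hd
  have hJf := M.incl_of_partialResStar hJ hrf hf hp
  exact ⟨k, hk, hf, M.uniqueRes_of_half hA (M.pos_of_eps_lt hk) hrg, hJf,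
    M.incl_of_partialResStar hJ hrg hk (M.incl_combXS hk hf hJf)⟩

theorem proves_sysUpStar_bound :
    Proves sysUpStar (Γ := []) (.all one (.all one (.all X (.all nat (.all nat
      (ltR (twoNegR x1) x4 ⊓ₗ ltR (twoNegR x0) x3 ⊓ₗ rhoGtHalf x4 ⊓ₗ rhoGtHalf x3 ⊓ₗ
        domJ x1 x4 x2 ⊓ₗ domJ x0 x3 x2 ⟶ₗ resBound x0 x4 x3 x2)))))) := by
  have hJ : partialResStar ∈ sysUpStar := by simp [sysUpStar]
  have hA : comonotone ∈ sysUpStar := by simp [sysUpStar]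
  refine Drv.bound_of_dom fun M g f x k l ⟨hg, hf, hrg, hrf, hdg, hdf⟩ => ?_
  have hg := M.sat_ltR_twoNegR.1 hg
  have hf := M.sat_ltR_twoNegR.1 hf
  have hrf := (M.sat_rhoGtHalf _ _).1 hrf
  have hrg := (M.sat_rhoGtHalf _ _).1 hrg
  obtain ⟨p, hp⟩ := (M.sat_domJ _ _ _ _).1 hdf
  obtain ⟨q, hq⟩ := (M.sat_domJ _ _ _ _).1 hdg
  exact ⟨hg, hf, M.nonexpRes_of_comonotone hA (M.pos_of_eps_lt hg) hrg.le,
    M.incl_of_partialResStar hJ hrf hf hp, M.incl_of_partialResStar hJ hrg hg hq⟩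

end Deriv

end FinTypeArith

theorem mainTheorem9 :
    -- total resolvents, normed spaces: for all `γ`, `λ`, `x`, `l`
    -- (in the order of binding; `λ > 2⁻ˡ` makes `λ > 0` explicit)
    Proves sysV (Γ := []) (.all one (.all one (.all X (.all nat
      (ltR zeroR x3 ⊓ₗ ltR (twoNegR x0) x2 ⟶ₗ resIdentity x0 x3 x2 x1))))) ∧
    Proves sysV (Γ := []) (.all one (.all one (.all X (.all nat
      (ltR zeroR x3 ⊓ₗ ltR (twoNegR x0) x2 ⟶ₗ resBound x0 x3 x2 x1))))) ∧
    -- total resolvents, inner product spaces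
    Proves sysT (Γ := []) (.all one (.all one (.all X (.all nat
      (ltR zeroR x3 ⊓ₗ ltR (twoNegR x0) x2 ⟶ₗ resIdentity x0 x3 x2 x1))))) ∧
    Proves sysT (Γ := []) (.all one (.all one (.all X (.all nat
      (ltR zeroR x3 ⊓ₗ ltR (twoNegR x0) x2 ⟶ₗ resBound x0 x3 x2 x1))))) ∧
    -- total resolvents, comonotone operators
    Proves sysU (Γ := []) (.all one (.all one (.all X (.all nat
      (ltR zeroR x3 ⊓ₗ ltR (twoNegR x0) x2 ⊓ₗ ltR (negR x3) rhoT ⟶ₗ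
        resIdentity x0 x3 x2 x1))))) ∧
    Proves sysU (Γ := []) (.all one (.all one (.all X (.all nat
      (ltR zeroR x3 ⊓ₗ ltR (twoNegR x0) x2 ⊓ₗ leR (negR (halfR x3)) rhoT ⟶ₗ
        resBound x0 x3 x2 x1))))) ∧
    Proves sysUStar (Γ := []) (.all one (.all one (.all X (.all nat
      (ltR zeroR x3 ⊓ₗ ltR (twoNegR x0) x2 ⊓ₗ rhoGtHalf x2 ⊓ₗ rhoGtHalf x3 ⟶ₗ
        resIdentity x0 x3 x2 x1))))) ∧
    Proves sysUStar (Γ := []) (.all one (.all one (.all X (.all nat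
      (ltR zeroR x3 ⊓ₗ ltR (twoNegR x0) x2 ⊓ₗ rhoGtHalf x2 ⊓ₗ rhoGtHalf x3 ⟶ₗ
        resBound x0 x3 x2 x1))))) ∧
    -- partial resolvents: the identity for all `γ`, `λ`, `x`, `l`,
    -- the bound for all `γ`, `λ`, `x`, `k`, `l` (with `γ > 2⁻ᵏ` and `λ > 2⁻ˡ`)
    Proves sysVp (Γ := []) (.all one (.all one (.all X (.all nat
      (ltR zeroR x3 ⊓ₗ ltR (twoNegR x0) x2 ⊓ₗ domJ x0 x2 x1 ⟶ₗ
        resIdentity x0 x3 x2 x1))))) ∧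
    Proves sysVp (Γ := []) (.all one (.all one (.all X (.all nat (.all nat
      (ltR (twoNegR x1) x4 ⊓ₗ ltR (twoNegR x0) x3 ⊓ₗ domJ x1 x4 x2 ⊓ₗ domJ x0 x3 x2 ⟶ₗ
        resBound x0 x4 x3 x2)))))) ∧
    Proves sysTp (Γ := []) (.all one (.all one (.all X (.all nat
      (ltR zeroR x3 ⊓ₗ ltR (twoNegR x0) x2 ⊓ₗ domJ x0 x2 x1 ⟶ₗ
        resIdentity x0 x3 x2 x1))))) ∧
    Proves sysTp (Γ := []) (.all one (.all one (.all X (.all nat (.all nat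
      (ltR (twoNegR x1) x4 ⊓ₗ ltR (twoNegR x0) x3 ⊓ₗ domJ x1 x4 x2 ⊓ₗ domJ x0 x3 x2 ⟶ₗ
        resBound x0 x4 x3 x2)))))) ∧
    Proves sysUp (Γ := []) (.all one (.all one (.all X (.all nat
      (ltR zeroR x3 ⊓ₗ ltR (twoNegR x0) x2 ⊓ₗ ltR (negR x3) rhoT ⊓ₗ domJ x0 x2 x1 ⟶ₗ
        resIdentity x0 x3 x2 x1))))) ∧
    Proves sysUp (Γ := []) (.all one (.all one (.all X (.all nat (.all nat
      (ltR (twoNegR x1) x4 ⊓ₗ ltR (twoNegR x0) x3 ⊓ₗ leR (negR (halfR x4)) rhoT ⊓ₗ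
        domJ x1 x4 x2 ⊓ₗ domJ x0 x3 x2 ⟶ₗ resBound x0 x4 x3 x2)))))) ∧
    Proves sysUpStar (Γ := []) (.all one (.all one (.all X (.all nat
      (ltR zeroR x3 ⊓ₗ ltR (twoNegR x0) x2 ⊓ₗ rhoGtHalf x3 ⊓ₗ rhoGtHalf x2 ⊓ₗ
        domJ x0 x2 x1 ⟶ₗ resIdentity x0 x3 x2 x1))))) ∧
    Proves sysUpStar (Γ := []) (.all one (.all one (.all X (.all nat (.all nat
      (ltR (twoNegR x1) x4 ⊓ₗ ltR (twoNegR x0) x3 ⊓ₗ rhoGtHalf x4 ⊓ₗ rhoGtHalf x3 ⊓ₗ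
        domJ x1 x4 x2 ⊓ₗ domJ x0 x3 x2 ⟶ₗ resBound x0 x4 x3 x2)))))) := by
  exact ⟨Drv.identity_of_accretive (by simp [sysV]) (by simp [sysV]),
    Drv.bound_of_accretive (by simp [sysV]) (by simp [sysV]),
    Drv.identity_of_accretive (by simp [sysT]) (by simp [sysT]),
    Drv.bound_of_accretive (by simp [sysT]) (by simp [sysT]),
    proves_sysU_identity, proves_sysU_bound, proves_sysUStar_identity, proves_sysUStar_bound,
    Drv.identity_of_accretive_of_dom (by simp [sysVp]) (by simp [sysVp]),
    Drv.bound_of_accretive_of_dom (by simp [sysVp]) (by simp [sysVp]),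
    Drv.identity_of_accretive_of_dom (by simp [sysTp]) (by simp [sysTp]),
    Drv.bound_of_accretive_of_dom (by simp [sysTp]) (by simp [sysTp]),
    proves_sysUp_identity, proves_sysUp_bound, proves_sysUpStar_identity, proves_sysUpStar_bound⟩
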